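/- Let $\mathcal{N}$ be an exact category in the sense of Quillen, that is, an additive category with a class of short exact sequences (conflations) satisfying Quillen's axioms. For an interval $J\subseteq\mathbb{Z}$ let $C^q_J\mathcal{N}$ be the exact category of bounded acyclic chain complexes in $\mathcal{N}$ supported on $J$: complexes whose differentials factor as $d_i\colon P_i\twoheadrightarrow Z_{i-1}\rightarrowtail P_{i-1}$ such that every $Z_i\rightarrowtail P_i\twoheadrightarrow Z_{i-1}$ is a short exact sequence. Let $B^q_J\mathcal{N}$ be the exact category of bounded binary acyclic complexes supported on $J$, i.e. graded objects $P_*$ with two differentials $d,d'$ such that $(P_*,d)$ and $(P_*,d')$ both lie in $C^q_J\mathcal{N}$; morphisms are chain maps for both differentials. In both categories, short exact sequences are the degreewise short exact ones. Let $\Delta\colon C^q_J\mathcal{N}\to B^q_J\mathcal{N}$ be the exact functor which duplicates the differential. For $n\geq 1$ let $K_0(\Omega^n_J\mathcal{N})$ be the quotient of the class group $K_0\big((B^q_J)^n\mathcal{N}\big)$ by the sum, over $1\le k\le n$, of the images of the class groups of the categories $B^q_J\cdots C^q_J\cdots B^q_J\mathcal{N}$ ($n$ letters, with $C^q_J$ precisely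 in the $k$-th place) under the maps induced by $\Delta$ in the $k$-th place. Write $K_0(\Omega^n\mathcal{N}) := K_0(\Omega^n_{[0,\infty)}\mathcal{N})$. Inclusions of intervals and exact functors $\mathcal{N}\to\mathcal{M}$ induce homomorphisms between these groups. Let $n\geq 1$. For every exact category $\mathcal{N}$, the canonical homomorphism $K_0(\Omega^n_{[0,2]}\mathcal{N})\to K_0(\Omega^n\mathcal{N})$ is surjective. Moreover, the canonical homomorphism $K_0(\Omega^n_{[0,4]}\mathcal{N})\to K_0(\Omega^n\mathcal{N})$ admits a natural section: there are group homomorphisms $s_{\mathcal{N}}\colon K_0(\Omega^n\mathcal{N})\to K_0(\Omega^n_{[0,4]}\mathcal{N})$, one for each exact category $\mathcal{N}$, which are right inverse to the canonical homomorphisms and satisfy $s_{\mathcal{M}}\circ F_* = F_*\circ s_{\mathcal{N}}$ for every exact functor $F\colon\mathcal{N}\to\mathcal{M}$. -/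

import Mathlib

open CategoryTheory CategoryTheory.Limits

universe v u

/-! ## Categories with conflations, exact categories, exact functors -/

/-- A preadditive category with a distinguished class of short sequences `A ⟶ B ⟶ C`, called
conflations (or short exact sequences). The axioms of an exact category are in `IsExact` below. -/
structure ConflationCat : Type (max (u + 1) (v + 1)) where
  Obj : Type u
  [category : Category.{v} Obj]
  [preadditive : Preadditive Obj]
  conf : ShortComplex Obj → Prop

attribute [instance] ConflationCat.category ConflationCat.preadditive

namespace ConflationCat

/-- Admissible monomorphisms: first maps of conflations. -/
def AdmMono (N : ConflationCat.{v, u}) {A B : N.Obj} (f : A ⟶ B) : Prop :=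
  ∃ (C : N.Obj) (g : B ⟶ C) (w : f ≫ g = 0), N.conf (ShortComplex.mk f g w)

/-- Admissible epimorphisms: second maps of conflations. -/
def AdmEpi (N : ConflationCat.{v, u}) {B C : N.Obj} (g : B ⟶ C) : Prop :=
  ∃ (A : N.Obj) (f : A ⟶ B) (w : f ≫ g = 0), N.conf (ShortComplex.mk f g w)

/-- The axioms of an exact category in the sense of Quillen: the category is additive, and the
conflations are an isomorphism-closed class of kernel-cokernel pairs such that admissible
monomorphisms contain identities, are closed under composition, and have pushouts along arbitrary
morphisms which are again admissible monomorphisms; and dually for admissible epimorphisms. -/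
structure IsExact (N : ConflationCat.{v, u}) : Prop where
  hasZeroObject : HasZeroObject N.Obj
  hasBinaryBiproducts : HasBinaryBiproducts N.Obj
  isKernel : ∀ S : ShortComplex N.Obj, N.conf S → Nonempty (IsLimit (KernelFork.ofι S.f S.zero))
  isCokernel : ∀ S : ShortComplex N.Obj, N.conf S →
    Nonempty (IsColimit (CokernelCofork.ofπ S.g S.zero))
  of_iso : ∀ S T : ShortComplex N.Obj, Nonempty (S ≅ T) → N.conf S → N.conf T
  admMono_id : ∀ A : N.Obj, N.AdmMono (𝟙 A)
  admEpi_id : ∀ A : N.Obj, N.AdmEpi (𝟙 A)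
  admMono_comp : ∀ {A B C : N.Obj} (f : A ⟶ B) (g : B ⟶ C),
    N.AdmMono f → N.AdmMono g → N.AdmMono (f ≫ g)
  admEpi_comp : ∀ {A B C : N.Obj} (f : A ⟶ B) (g : B ⟶ C),
    N.AdmEpi f → N.AdmEpi g → N.AdmEpi (f ≫ g)
  pushout : ∀ {A B A' : N.Obj} (f : A ⟶ B) (g : A ⟶ A'), N.AdmMono f →
    ∃ (B' : N.Obj) (g' : B ⟶ B') (f' : A' ⟶ B'), IsPushout f g g' f' ∧ N.AdmMono f'
  pullback : ∀ {B C C' : N.Obj} (f : B ⟶ C) (g : C' ⟶ C), N.AdmEpi f →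
    ∃ (B' : N.Obj) (g' : B' ⟶ B) (f' : B' ⟶ C'), IsPullback g' f' f g ∧ N.AdmEpi f'

/-- Exact functors: additive functors which preserve conflations. -/
structure ExactFunctor (N M : ConflationCat.{v, u}) where
  functor : N.Obj ⥤ M.Obj
  [additive : functor.Additive]
  map_conf : ∀ S : ShortComplex N.Obj, N.conf S → M.conf (S.map functor)

attribute [instance] ExactFunctor.additive

/-- The identity functor. -/
def ExactFunctor.id (N : ConflationCat.{v, u}) : ExactFunctor N N where
  functor := 𝟭 N.Obj
  map_conf _ h := h

/-- Composition of exact functors. -/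
def ExactFunctor.comp {N M L : ConflationCat.{v, u}} (F : ExactFunctor N M)
    (G : ExactFunctor M L) : ExactFunctor N L where
  functor := F.functor ⋙ G.functor
  map_conf S h := G.map_conf _ (F.map_conf S h)

/-- A chain complex is acyclic if every differential factors as an admissible epimorphism
`e i : P i ⟶ Z (i - 1)` followed by an admissible monomorphism `m (i - 1) : Z (i - 1) ⟶ P (i - 1)`
such that every `Z i ⟶ P i ⟶ Z (i - 1)` is a conflation. -/
def Acyclic (N : ConflationCat.{v, u}) (P : ChainComplex N.Obj ℤ) : Prop :=
  ∃ (Z : ℤ → N.Obj) (m : ∀ i, Z i ⟶ P.X i) (e : ∀ i, P.X i ⟶ Z (i - 1))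
    (w : ∀ i, m i ≫ e i = 0),
    (∀ i, N.conf (ShortComplex.mk (m i) (e i) (w i))) ∧ ∀ i, P.d i (i - 1) = e i ≫ m (i - 1)

/-! ## Acyclic complexes and binary acyclic complexes -/

/-- A bounded graded object `X`, supported on `J`, with a family of differentials of degree `-1`
indexed by `ι`, each of which makes `X` an acyclic chain complex. For `ι = Unit` these are the
acyclic chain complexes, and for `ι = Bool` the binary acyclic complexes (with top differential
`d true` and bottom differential `d false`) supported on `J`. -/
structure AcyclicCx (ι : Type) (J : Set ℤ) (N : ConflationCat.{v, u}) : Type (max u v) where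
  X : ℤ → N.Obj
  d : ι → ∀ i j : ℤ, X i ⟶ X j
  shape : ∀ b i j, ¬ (ComplexShape.down ℤ).Rel i j → d b i j = 0
  d_comp_d : ∀ b i j k, d b i j ≫ d b j k = 0
  bounded : ∃ a c : ℤ, ∀ i, i ∉ Set.Icc a c → IsZero (X i)
  support : ∀ i, i ∉ J → IsZero (X i)
  acyclic : ∀ b, N.Acyclic
    { X := X, d := d b, shape := shape b, d_comp_d' := fun i j k _ _ => d_comp_d b i j k }

namespace AcyclicCx

variable {ι : Type} {J : Set ℤ} {N : ConflationCat.{v, u}}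

/-- Morphisms are maps of graded objects of degree `0` which are chain maps with respect to each
of the differentials. -/
@[ext]
structure Hom (P Q : AcyclicCx ι J N) : Type v where
  f : ∀ i, P.X i ⟶ Q.X i
  comm : ∀ b i j, f i ≫ Q.d b i j = P.d b i j ≫ f j

instance : Category.{v} (AcyclicCx ι J N) where
  Hom P Q := Hom P Q
  id P := { f := fun i => 𝟙 _, comm := by simp }
  comp φ ψ :=
    { f := fun i => φ.f i ≫ ψ.f i
      comm := fun b i j => by
        rw [Category.assoc, ψ.comm, ← Category.assoc, φ.comm, Category.assoc] }

@[ext]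
theorem hom_ext {P Q : AcyclicCx ι J N} (φ ψ : P ⟶ Q) (h : ∀ i, φ.f i = ψ.f i) : φ = ψ :=
  Hom.ext (funext h)

@[simp]
theorem id_f (P : AcyclicCx ι J N) (i : ℤ) : Hom.f (𝟙 P) i = 𝟙 (P.X i) := rfl

@[simp]
theorem comp_f {P Q R : AcyclicCx ι J N} (φ : P ⟶ Q) (ψ : Q ⟶ R) (i : ℤ) :
    Hom.f (φ ≫ ψ) i = φ.f i ≫ ψ.f i := rfl

instance (P Q : AcyclicCx ι J N) : Zero (P ⟶ Q) := ⟨{ f := fun _ => 0, comm := by simp }⟩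

instance (P Q : AcyclicCx ι J N) : Add (P ⟶ Q) :=
  ⟨fun φ ψ => { f := fun i => φ.f i + ψ.f i
                comm := fun b i j => by
                  rw [Preadditive.add_comp, Preadditive.comp_add, φ.comm, ψ.comm] }⟩

instance (P Q : AcyclicCx ι J N) : Neg (P ⟶ Q) :=
  ⟨fun φ => { f := fun i => - φ.f i
              comm := fun b i j => by
                rw [Preadditive.neg_comp, Preadditive.comp_neg, φ.comm] }⟩

instance (P Q : AcyclicCx ι J N) : AddCommGroup (P ⟶ Q) where
  add_assoc φ ψ χ := hom_ext _ _ fun i => add_assoc (φ.f i) (ψ.f i) (χ.f i)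
  zero_add φ := hom_ext _ _ fun i => zero_add (φ.f i)
  add_zero φ := hom_ext _ _ fun i => add_zero (φ.f i)
  nsmul := nsmulRec
  zsmul := zsmulRec
  neg_add_cancel φ := hom_ext _ _ fun i => neg_add_cancel (φ.f i)
  add_comm φ ψ := hom_ext _ _ fun i => add_comm (φ.f i) (ψ.f i)

instance : Preadditive (AcyclicCx ι J N) where
  add_comp _ _ _ φ ψ χ := hom_ext _ _ fun i => Preadditive.add_comp _ _ _ (φ.f i) (ψ.f i) (χ.f i)
  comp_add _ _ _ φ ψ χ := hom_ext _ _ fun i => Preadditive.comp_add _ _ _ (φ.f i) (ψ.f i) (χ.f i)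

/-- The functor which takes the object in degree `i`. -/
def eval (ι : Type) (J : Set ℤ) (N : ConflationCat.{v, u}) (i : ℤ) :
    AcyclicCx ι J N ⥤ N.Obj where
  obj P := P.X i
  map φ := φ.f i

instance (i : ℤ) : (eval ι J N i).Additive where
  map_add := rfl

end AcyclicCx

/-- Acyclic complexes with their degreewise conflations. -/
def acyclicCat (ι : Type) (J : Set ℤ) (N : ConflationCat.{v, u}) : ConflationCat.{v, max u v} where
  Obj := AcyclicCx ι J N
  conf S := ∀ i : ℤ, N.conf (S.map (AcyclicCx.eval ι J N i))

/-- The category of (bounded) acyclic chain complexes supported on `J`. -/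
abbrev Cq (J : Set ℤ) (N : ConflationCat.{v, u}) : ConflationCat.{v, max u v} :=
  acyclicCat Unit J N

/-- The category of (bounded) binary acyclic complexes supported on `J`. -/
abbrev Bq (J : Set ℤ) (N : ConflationCat.{v, u}) : ConflationCat.{v, max u v} :=
  acyclicCat Bool J N

/-- The exact functor from acyclic chain complexes to binary acyclic complexes which duplicates
the differential. -/
def diag (J : Set ℤ) (N : ConflationCat.{v, u}) : ExactFunctor (Cq J N) (Bq J N) where
  functor :=
    { obj := fun P : AcyclicCx Unit J N =>
        ({ X := P.X
           d := fun _ => P.d ()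
           shape := fun _ => P.shape ()
           d_comp_d := fun _ => P.d_comp_d ()
           bounded := P.bounded
           support := P.support
           acyclic := fun _ => P.acyclic () } : AcyclicCx Bool J N)
      map := fun {P Q} (φ : AcyclicCx.Hom P Q) =>
        { f := φ.f, comm := fun _ i j => φ.comm () i j } }
  additive := ⟨rfl⟩
  map_conf _ h := h

/-- An enlargement of the support gives an exact functor between categories of acyclic
complexes. -/
def enlarge (ι : Type) {J J' : Set ℤ} (hJ : J ⊆ J') (N : ConflationCat.{v, u}) :
    ExactFunctor (acyclicCat ι J N) (acyclicCat ι J' N) where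
  functor :=
    { obj := fun P : AcyclicCx ι J N =>
        ({ X := P.X
           d := P.d
           shape := P.shape
           d_comp_d := P.d_comp_d
           bounded := P.bounded
           support := fun i hi => P.support i fun h => hi (hJ h)
           acyclic := P.acyclic } : AcyclicCx ι J' N)
      map := fun {P Q} (φ : AcyclicCx.Hom P Q) => { f := φ.f, comm := φ.comm } }
  additive := ⟨rfl⟩
  map_conf _ h := h

theorem Acyclic.map {N M : ConflationCat.{v, u}} (F : ExactFunctor N M)
    {P : ChainComplex N.Obj ℤ} {Q : ChainComplex M.Obj ℤ} (hX : ∀ i, Q.X i = F.functor.obj (P.X i))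
    (hd : ∀ i j, Q.d i j = eqToHom (hX i) ≫ F.functor.map (P.d i j) ≫ eqToHom (hX j).symm)
    (h : N.Acyclic P) : M.Acyclic Q := by
  obtain ⟨X, d, s, c⟩ := Q
  obtain rfl : X = fun i => F.functor.obj (P.X i) := funext hX
  obtain ⟨Z, m, e, w, hc, hd'⟩ := h
  refine ⟨fun i => F.functor.obj (Z i), fun i => F.functor.map (m i), fun i => F.functor.map (e i),
    fun i => by rw [← F.functor.map_comp, w, F.functor.map_zero],
    fun i => F.map_conf _ (hc i), fun i => ?_⟩
  rw [hd, hd']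
  simp

/-- An exact functor, applied degreewise, gives an exact functor on categories of acyclic
complexes. -/
def acyclicMap (ι : Type) (J : Set ℤ) {N M : ConflationCat.{v, u}} (F : ExactFunctor N M) :
    ExactFunctor (acyclicCat ι J N) (acyclicCat ι J M) where
  functor :=
    { obj := fun P : AcyclicCx ι J N =>
        ({ X := fun i => F.functor.obj (P.X i)
           d := fun b i j => F.functor.map (P.d b i j)
           shape := fun b i j h => by rw [P.shape b i j h, F.functor.map_zero]
           d_comp_d := fun b i j k => by
             rw [← F.functor.map_comp, P.d_comp_d, F.functor.map_zero]
           bounded := by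
             obtain ⟨a, c, h⟩ := P.bounded
             exact ⟨a, c, fun i hi => F.functor.map_isZero (h i hi)⟩
           support := fun i hi => F.functor.map_isZero (P.support i hi)
           acyclic := fun b => (P.acyclic b).map F (fun _ => rfl) (fun i j => by simp) } :
          AcyclicCx ι J M)
      map := fun {P Q} (φ : AcyclicCx.Hom P Q) =>
        { f := fun i => F.functor.map (φ.f i)
          comm := fun b i j => by
            rw [← F.functor.map_comp, φ.comm, F.functor.map_comp] }
      map_id := fun P => AcyclicCx.hom_ext _ _ fun i => F.functor.map_id (P.X i)
      map_comp := fun φ ψ => AcyclicCx.hom_ext _ _ fun i => F.functor.map_comp (φ.f i) (ψ.f i) }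
  additive := ⟨AcyclicCx.hom_ext _ _ fun _ => F.functor.map_add⟩
  map_conf _ h i := F.map_conf _ (h i)

/-! ## The class group -/

/-- The relations `[B] = [A] + [C]`, one for each conflation `A ⟶ B ⟶ C`. -/
def K0Rel (N : ConflationCat.{v, u}) : AddSubgroup (FreeAbelianGroup N.Obj) :=
  AddSubgroup.closure { x | ∃ S : ShortComplex N.Obj, N.conf S ∧
    x = FreeAbelianGroup.of S.X₂ - (FreeAbelianGroup.of S.X₁ + FreeAbelianGroup.of S.X₃) }

/-- The class group `K_0` of a category with conflations. -/
abbrev K0 (N : ConflationCat.{v, u}) : Type u := FreeAbelianGroup N.Obj ⧸ N.K0Rel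

/-- The homomorphism which an exact functor induces on class groups. -/
def K0.map {N M : ConflationCat.{v, u}} (F : ExactFunctor N M) : K0 N →+ K0 M :=
  QuotientAddGroup.map _ _ (FreeAbelianGroup.map F.functor.obj) <| by
    rw [K0Rel, AddSubgroup.closure_le]
    rintro _ ⟨S, hS, rfl⟩
    exact AddSubgroup.subset_closure ⟨S.map F.functor, F.map_conf S hS, by simp⟩

theorem K0.map_comp {N M L : ConflationCat.{v, u}} (F : ExactFunctor N M) (G : ExactFunctor M L) :
    K0.map (F.comp G) = (K0.map G).comp (K0.map F) := by
  ext A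
  simp [K0.map, ExactFunctor.comp]

/-! ## Iterated binary acyclic complexes -/

/-- The `n`-fold iteration of `Bq J`. -/
def BqIter (J : Set ℤ) : ℕ → ConflationCat.{v, max u v} → ConflationCat.{v, max u v}
  | 0, N => N
  | n + 1, N => Bq J (BqIter J n N)

/-- The category `Bq J … Cq J … Bq J N` with `n` letters, of which precisely the `k`-th is
`Cq J`. -/
def faceCat (J : Set ℤ) (N : ConflationCat.{v, max u v}) :
    (n : ℕ) → Fin n → ConflationCat.{v, max u v}
  | 0, k => k.elim0
  | n + 1, ⟨0, _⟩ => Cq J (BqIter.{v, u} J n N)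
  | n + 1, ⟨k + 1, h⟩ => Bq J (faceCat J N n ⟨k, Nat.lt_of_succ_lt_succ h⟩)

/-- The exact functor `Bq J … Cq J … Bq J N ⟶ Bq J … Bq J … Bq J N` which duplicates the
differential in the `k`-th direction. -/
def face (J : Set ℤ) (N : ConflationCat.{v, max u v}) :
    (n : ℕ) → (k : Fin n) → ExactFunctor (faceCat.{v, u} J N n k) (BqIter.{v, u} J n N)
  | 0, k => k.elim0
  | n + 1, ⟨0, _⟩ => diag J (BqIter.{v, u} J n N)
  | n + 1, ⟨k + 1, h⟩ => acyclicMap Bool J (face J N n ⟨k, Nat.lt_of_succ_lt_succ h⟩)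

/-- The group `K_0(Ω^n_J N)`: the quotient of the class group of `n`-fold binary acyclic complexes
supported on `J` in each direction by the classes of those complexes whose top and bottom
differentials in one of the `n` directions coincide. -/
abbrev K0Omega (J : Set ℤ) (n : ℕ) (N : ConflationCat.{v, max u v}) : Type (max u v) :=
  K0 (BqIter.{v, u} J n N) ⧸ ⨆ k : Fin n, (K0.map (face.{v, u} J N n k)).range

/-! ## Functoriality in the exact category and in the support -/

/-- The functor on `n`-fold binary acyclic complexes induced by an exact functor. -/
def BqIterMap (J : Set ℤ) {N M : ConflationCat.{v, max u v}} (F : ExactFunctor N M) :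
    (n : ℕ) → ExactFunctor (BqIter.{v, u} J n N) (BqIter.{v, u} J n M)
  | 0 => F
  | n + 1 => acyclicMap Bool J (BqIterMap J F n)

/-- The inclusion of the `n`-fold binary acyclic complexes supported on `J` in each direction into
those supported on `J'`. -/
def BqIterEnlarge {J J' : Set ℤ} (hJ : J ⊆ J') (N : ConflationCat.{v, max u v}) :
    (n : ℕ) → ExactFunctor (BqIter.{v, u} J n N) (BqIter.{v, u} J' n N)
  | 0 => ExactFunctor.id N
  | n + 1 => (enlarge Bool hJ (BqIter.{v, u} J n N)).comp
      (acyclicMap Bool J' (BqIterEnlarge hJ N n))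

theorem face_map (J : Set ℤ) {N M : ConflationCat.{v, max u v}} (F : ExactFunctor N M) (n : ℕ)
    (k : Fin n) : ∃ G : ExactFunctor (faceCat.{v, u} J N n k) (faceCat.{v, u} J M n k),
      (face.{v, u} J N n k).comp (BqIterMap.{v, u} J F n) = G.comp (face.{v, u} J M n k) := by
  induction n with
  | zero => exact k.elim0
  | succ n ih =>
    obtain ⟨_ | k, h⟩ := k
    · exact ⟨acyclicMap Unit J (BqIterMap.{v, u} J F n), rfl⟩
    · obtain ⟨G, hG⟩ := ih ⟨k, Nat.lt_of_succ_lt_succ h⟩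
      exact ⟨acyclicMap Bool J G, congrArg (acyclicMap Bool J) hG⟩

theorem face_enlarge {J J' : Set ℤ} (hJ : J ⊆ J') (N : ConflationCat.{v, max u v}) (n : ℕ)
    (k : Fin n) : ∃ G : ExactFunctor (faceCat.{v, u} J N n k) (faceCat.{v, u} J' N n k),
      (face.{v, u} J N n k).comp (BqIterEnlarge.{v, u} hJ N n) =
        G.comp (face.{v, u} J' N n k) := by
  induction n with
  | zero => exact k.elim0
  | succ n ih =>
    obtain ⟨_ | k, h⟩ := k
    · exact ⟨(enlarge Unit hJ _).comp (acyclicMap Unit J' (BqIterEnlarge.{v, u} hJ N n)), rfl⟩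
    · obtain ⟨G, hG⟩ := ih ⟨k, Nat.lt_of_succ_lt_succ h⟩
      exact ⟨(enlarge Bool hJ _).comp (acyclicMap Bool J' G),
        congrArg (fun H => (enlarge Bool hJ _).comp (acyclicMap Bool J' H)) hG⟩

/-- A functor on `n`-fold binary acyclic complexes which is compatible with the degenerate
complexes induces a homomorphism on `K0Omega`. -/
def K0Omega.desc {J J' : Set ℤ} {n : ℕ} {N M : ConflationCat.{v, max u v}}
    (F : ExactFunctor (BqIter.{v, u} J n N) (BqIter.{v, u} J' n M))
    (hF : ∀ k, ∃ G : ExactFunctor (faceCat.{v, u} J N n k) (faceCat.{v, u} J' M n k),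
      (face.{v, u} J N n k).comp F = G.comp (face.{v, u} J' M n k)) :
    K0Omega.{v, u} J n N →+ K0Omega.{v, u} J' n M :=
  QuotientAddGroup.map _ _ (K0.map F) <| iSup_le fun k => by
    obtain ⟨G, hG⟩ := hF k
    rintro _ ⟨x, rfl⟩
    refine AddSubgroup.mem_comap.2 (AddSubgroup.mem_iSup_of_mem k ⟨K0.map G x, ?_⟩)
    rw [← AddMonoidHom.comp_apply, ← AddMonoidHom.comp_apply, ← K0.map_comp, ← K0.map_comp, hG]

/-- The homomorphism `K_0(Ω^n_J N) ⟶ K_0(Ω^n_J M)` induced by an exact functor `N ⟶ M`. -/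
def K0Omega.map (J : Set ℤ) (n : ℕ) {N M : ConflationCat.{v, max u v}} (F : ExactFunctor N M) :
    K0Omega.{v, u} J n N →+ K0Omega.{v, u} J n M :=
  K0Omega.desc (BqIterMap.{v, u} J F n) (face_map.{v, u} J F n)

/-- The natural homomorphism `K_0(Ω^n_J N) ⟶ K_0(Ω^n_{J'} N)` for `J ⊆ J'`. -/
def K0Omega.incl {J J' : Set ℤ} (hJ : J ⊆ J') (n : ℕ) (N : ConflationCat.{v, max u v}) :
    K0Omega.{v, u} J n N →+ K0Omega.{v, u} J' n N :=
  K0Omega.desc (BqIterEnlarge.{v, u} hJ N n) (face_enlarge.{v, u} hJ N n)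

end ConflationCat

/-- Exact categories. -/
structure ExactCat : Type (max (u + 1) (v + 1)) extends ConflationCat.{v, u} where
  isExact : toConflationCat.IsExact

/-! Take one direction first. A binary acyclic complex is a pair of acyclic complexes `X`, `Y` with
an isomorphism `φ` of the underlying graded objects; `cls` is its class modulo diagonal complexes,
and it vanishes if `φ` is a chain isomorphism. Comparing the extensions `X ⟶ ctr X ⟶ X[1]` and `Y ⟶
ctr Y ⟶ Y[1]` gives rules that hold as soon as the support lies in `inner J`, that is, leaves one
spare degree in `J`: a shift changes the sign (`cls_shift`), unipotent automorphisms do not matter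
(`cls_trans_unipotent`), and composition of graded isomorphisms becomes addition (`cls_trans`).

For the shortening, cut at the cycles `Z 0`: `truncGE X` is `… ⟶ X 2 ⟶ X 1 ⟶ Z 0`, `truncLE X` is `Z
0 ⟶ X 0 ⟶ X (-1) ⟶ …`, and `X` plus the contractible complex on `Z 0` is an extension of `truncLE X`
by `truncGE X`. The two differentials have different cycles, so the truncations of `X` and `Y` are
isomorphic as graded objects only after adding the cycles of the other complex. With these summands
in place, the shift of the upper truncations can be undone; the resulting sign is absorbed by
interchanging the roles of `X` and `Y` there (`cls_exchange`, `cls_stable`). The outcome,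
`cls_shorten`, replaces support `[0, n]` by `[0, max 2 (n - 1)]`.

Iteration gives surjectivity of the map from `[0, 2]` to `[0, ∞)`. Since the shortening is an exact
construction, it also induces homomorphisms `retract`, compatible with the inclusions of `[0, 2]`. A
class on `[0, 2]` that dies on `[0, ∞)` dies on some `[0, m]`, and is pulled back by `retract` to
zero on `[0, 4]` (`incl_eq_zero`). Hence the map from `[0, 2]` to `[0, 4]` factors through the
surjection onto the group for `[0, ∞)`. This factorization is the section, and its naturality is
inherited from the inclusions.

Several directions are treated one at a time: `swap` interchanges directions, and an induction over
all exact categories shows that both generators and relations can be shortened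
(`shortenable_and_relationsShortenable`). This needs that acyclic complexes form an exact category
with exact cycle functors, which rests on a 3×3 lemma (`Conf.exists_kernel`). -/

open scoped ZeroObject


namespace ConflationCat

/-! ## Conflations in exact categories -/

/-- Exactness as a type class. -/
class Exact (N : ConflationCat.{v, u}) : Prop where
  isExact : N.IsExact

instance (N : ConflationCat.{v, u}) [h : N.Exact] : HasZeroObject N.Obj := h.isExact.hasZeroObject

instance (N : ConflationCat.{v, u}) [h : N.Exact] : HasBinaryBiproducts N.Obj :=
  h.isExact.hasBinaryBiproducts

/-- The pair of composable morphisms `f`, `g` is a conflation. -/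
def Conf (N : ConflationCat.{v, u}) {A B C : N.Obj} (f : A ⟶ B) (g : B ⟶ C) : Prop :=
  ∃ w : f ≫ g = 0, N.conf (ShortComplex.mk f g w)

variable {N : ConflationCat.{v, u}}

theorem admMono_iff {A B : N.Obj} (f : A ⟶ B) :
    N.AdmMono f ↔ ∃ (C : N.Obj) (g : B ⟶ C), N.Conf f g := Iff.rfl

theorem admEpi_iff {B C : N.Obj} (g : B ⟶ C) :
    N.AdmEpi g ↔ ∃ (A : N.Obj) (f : A ⟶ B), N.Conf f g := Iff.rfl

namespace Conf

variable {A B C : N.Obj} {f : A ⟶ B} {g : B ⟶ C}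

theorem admMono (h : N.Conf f g) : N.AdmMono f := ⟨C, g, h⟩

theorem admEpi (h : N.Conf f g) : N.AdmEpi g := ⟨A, f, h⟩

theorem w (h : N.Conf f g) : f ≫ g = 0 := h.1

variable [N.Exact]

theorem exists_lift (h : N.Conf f g) {T : N.Obj} (x : T ⟶ B) (hx : x ≫ g = 0) :
    ∃ y : T ⟶ A, y ≫ f = x := by
  obtain ⟨w, h⟩ := h
  obtain ⟨hl⟩ := Exact.isExact.isKernel _ h
  exact ⟨_, KernelFork.IsLimit.lift' hl x hx |>.2⟩

theorem exists_desc (h : N.Conf f g) {T : N.Obj} (x : B ⟶ T) (hx : f ≫ x = 0) :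
    ∃ y : C ⟶ T, g ≫ y = x := by
  obtain ⟨w, h⟩ := h
  obtain ⟨hl⟩ := Exact.isExact.isCokernel _ h
  exact ⟨_, CokernelCofork.IsColimit.desc' hl x hx |>.2⟩

theorem mono (h : N.Conf f g) : Mono f := by
  obtain ⟨w, h⟩ := h
  obtain ⟨hl⟩ := Exact.isExact.isKernel _ h
  exact mono_of_isLimit_fork hl

theorem epi (h : N.Conf f g) : Epi g := by
  obtain ⟨w, h⟩ := h
  obtain ⟨hl⟩ := Exact.isExact.isCokernel _ h
  exact epi_of_isColimit_cofork hl

/-- Conflations are closed under isomorphism. -/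
theorem of_iso (h : N.Conf f g) {A' B' C' : N.Obj} {f' : A' ⟶ B'} {g' : B' ⟶ C'}
    (a : A ≅ A') (b : B ≅ B') (c : C ≅ C') (h₁ : f ≫ b.hom = a.hom ≫ f')
    (h₂ : g ≫ c.hom = b.hom ≫ g') : N.Conf f' g' := by
  obtain ⟨w, h⟩ := h
  have w' : f' ≫ g' = 0 := by
    rw [← cancel_epi a.hom, ← Category.assoc, ← h₁, Category.assoc, ← h₂, ← Category.assoc, w]
    simp
  exact ⟨w', Exact.isExact.of_iso _ _
    ⟨ShortComplex.isoMk a b c h₁.symm h₂.symm⟩ h⟩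

/-- Another cokernel of the inflation of a conflation gives a conflation. -/
theorem of_cokernel (h : N.Conf f g) {C' : N.Obj} {g' : B ⟶ C'} (w : f ≫ g' = 0) [Epi g']
    (hd : ∃ s : C' ⟶ C, g' ≫ s = g) : N.Conf f g' := by
  obtain ⟨r, hr⟩ := h.exists_desc g' w
  obtain ⟨s, hs⟩ := hd
  have := h.epi
  refine h.of_iso (Iso.refl _) (Iso.refl _) ⟨r, s, ?_, ?_⟩ (by simp) (by simp [hr])
  · rw [← cancel_epi g, ← Category.assoc, hr, hs, Category.comp_id]
  · rw [← cancel_epi g', ← Category.assoc, hs, hr, Category.comp_id]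

/-- Another kernel of the deflation of a conflation gives a conflation. -/
theorem of_kernel (h : N.Conf f g) {A' : N.Obj} {f' : A' ⟶ B} (w : f' ≫ g = 0) [Mono f']
    (hd : ∃ s : A ⟶ A', s ≫ f' = f) : N.Conf f' g := by
  obtain ⟨r, hr⟩ := h.exists_lift f' w
  obtain ⟨s, hs⟩ := hd
  have := h.mono
  refine h.of_iso ⟨s, r, ?_, ?_⟩ (Iso.refl _) (Iso.refl _) (by simp [hs]) (by simp)
  · rw [← cancel_mono f, Category.assoc, hr, hs, Category.id_comp]
  · rw [← cancel_mono f', Category.assoc, hs, hr, Category.id_comp]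

end Conf

theorem AdmMono.conf_of_cokernel [N.Exact] {A B C : N.Obj} {f : A ⟶ B} (hf : N.AdmMono f)
    {g : B ⟶ C} (w : f ≫ g = 0) [Epi g]
    (hd : ∀ {T : N.Obj} (x : B ⟶ T), f ≫ x = 0 → ∃ y : C ⟶ T, g ≫ y = x) : N.Conf f g := by
  obtain ⟨C', g', h⟩ := hf
  exact Conf.of_cokernel h w (hd g' (Conf.w h))

theorem AdmEpi.conf_of_kernel [N.Exact] {A B C : N.Obj} {g : B ⟶ C} (hg : N.AdmEpi g)
    {f : A ⟶ B} (w : f ≫ g = 0) [Mono f]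
    (hd : ∀ {T : N.Obj} (x : T ⟶ B), x ≫ g = 0 → ∃ y : T ⟶ A, y ≫ f = x) : N.Conf f g := by
  obtain ⟨A', f', h⟩ := hg
  exact Conf.of_kernel h w (hd f' (Conf.w h))

section

variable [N.Exact]

theorem conf_id_zero (A : N.Obj) {Z : N.Obj} (hZ : IsZero Z) (z : A ⟶ Z) : N.Conf (𝟙 A) z := by
  have : Epi z := ⟨fun _ _ _ => hZ.eq_of_src _ _⟩
  refine AdmMono.conf_of_cokernel (Exact.isExact.admMono_id A) (hZ.eq_of_tgt _ _) fun x hx => ?_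
  exact ⟨0, by simpa using hx.symm⟩

theorem conf_zero_id (A : N.Obj) {Z : N.Obj} (hZ : IsZero Z) (z : Z ⟶ A) : N.Conf z (𝟙 A) := by
  have : Mono z := ⟨fun _ _ _ => hZ.eq_of_tgt _ _⟩
  refine AdmEpi.conf_of_kernel (Exact.isExact.admEpi_id A) (hZ.eq_of_src _ _) fun x hx => ?_
  exact ⟨0, by simpa using hx.symm⟩

theorem conf_iso_zero {A B : N.Obj} (e : A ≅ B) {Z : N.Obj} (hZ : IsZero Z) (z : B ⟶ Z) :
    N.Conf e.hom z :=
  (conf_id_zero A hZ (e.hom ≫ z)).of_iso (Iso.refl _) e (Iso.refl _) (by simp) (by simp)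

theorem conf_zero_iso {A B : N.Obj} (e : A ≅ B) {Z : N.Obj} (hZ : IsZero Z) (z : Z ⟶ A) :
    N.Conf z e.hom :=
  (conf_zero_id A hZ z).of_iso (Iso.refl _) (Iso.refl _) e (by simp) (by simp)

theorem conf_zero_zero {A B C : N.Obj} (hA : IsZero A) (hB : IsZero B) (hC : IsZero C)
    (f : A ⟶ B) (g : B ⟶ C) : N.Conf f g := by
  obtain rfl : f = (hA.iso hB).hom := hA.eq_of_src _ _
  exact conf_iso_zero _ hC g

/-- The pushout of a conflation. -/
theorem Conf.exists_pushout {A B C : N.Obj} {f : A ⟶ B} {g : B ⟶ C} (h : N.Conf f g)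
    {A' : N.Obj} (a : A ⟶ A') :
    ∃ (B' : N.Obj) (b : B ⟶ B') (f' : A' ⟶ B') (g' : B' ⟶ C),
      IsPushout f a b f' ∧ b ≫ g' = g ∧ N.Conf f' g' := by
  obtain ⟨B', b, f', hp, hf'⟩ := Exact.isExact.pushout f a h.admMono
  let g' : B' ⟶ C := hp.desc g 0 (by simp [h.w])
  have h₁ : b ≫ g' = g := hp.inl_desc _ _ _
  have h₂ : f' ≫ g' = 0 := hp.inr_desc _ _ _
  have := h.epi
  have : Epi g' := by
    have : Epi (b ≫ g') := h₁ ▸ h.epi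
    exact epi_of_epi b g'
  refine ⟨B', b, f', g', hp, h₁, hf'.conf_of_cokernel h₂ fun {T} x hx => ?_⟩
  obtain ⟨y, hy⟩ := h.exists_desc (b ≫ x) (by rw [← Category.assoc, hp.w, Category.assoc, hx,
    comp_zero])
  refine ⟨y, hp.hom_ext ?_ ?_⟩
  · rw [← Category.assoc, h₁, hy]
  · rw [← Category.assoc, h₂, hx, zero_comp]

/-- The pullback of a conflation. -/
theorem Conf.exists_pullback {A B C : N.Obj} {f : A ⟶ B} {g : B ⟶ C} (h : N.Conf f g)
    {C' : N.Obj} (c : C' ⟶ C) :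
    ∃ (B' : N.Obj) (b : B' ⟶ B) (f' : A ⟶ B') (g' : B' ⟶ C'),
      IsPullback b g' g c ∧ f' ≫ b = f ∧ N.Conf f' g' := by
  obtain ⟨B', b, g', hp, hg'⟩ := Exact.isExact.pullback g c h.admEpi
  let f' : A ⟶ B' := hp.lift f 0 (by simp [h.w])
  have h₁ : f' ≫ b = f := hp.lift_fst _ _ _
  have h₂ : f' ≫ g' = 0 := hp.lift_snd _ _ _
  have : Mono f' := by
    have : Mono (f' ≫ b) := h₁ ▸ h.mono
    exact mono_of_mono f' b
  refine ⟨B', b, f', g', hp, h₁, hg'.conf_of_kernel h₂ fun {T} x hx => ?_⟩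
  obtain ⟨y, hy⟩ := h.exists_lift (x ≫ b) (by rw [Category.assoc, hp.w, ← Category.assoc, hx,
    zero_comp])
  refine ⟨y, hp.hom_ext ?_ ?_⟩
  · rw [Category.assoc, h₁, hy]
  · rw [Category.assoc, h₂, hx, comp_zero]

theorem conf_biprod (A B : N.Obj) : N.Conf (biprod.inl : A ⟶ A ⊞ B) (biprod.snd : A ⊞ B ⟶ B) := by
  have hz := isZero_zero N.Obj
  -- The pushout of `0 ⟶ B` along `0 ⟶ A` is the direct sum, so the split sequence is a pushout of
  -- the trivial conflation `0 ⟶ B ⟶ B`.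
  obtain ⟨B', b, f', g', hp, h₁, h⟩ := (conf_zero_id B hz (0 : 0 ⟶ B)).exists_pushout
    (0 : (0 : N.Obj) ⟶ A)
  let r : B' ⟶ A := hp.desc 0 (𝟙 A) (by simp)
  have hr₁ : b ≫ r = 0 := hp.inl_desc _ _ _
  have hr₂ : f' ≫ r = 𝟙 A := hp.inr_desc _ _ _
  refine h.of_iso (Iso.refl _) ⟨biprod.lift r g', biprod.desc f' b, ?_, ?_⟩ (Iso.refl _) ?_ ?_
  · apply hp.hom_ext
    · simp [reassoc_of% hr₁, reassoc_of% h₁, biprod.lift_desc]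
    · simp [reassoc_of% hr₂, reassoc_of% h.w, biprod.lift_desc]
  · ext <;> simp [hr₁, hr₂, h₁, h.w]
  · ext <;> simp [hr₂, h.w]
  · simp

theorem conf_biprod' (A B : N.Obj) : N.Conf (biprod.inr : B ⟶ A ⊞ B) (biprod.fst : A ⊞ B ⟶ A) :=
  (conf_biprod B A).of_iso (Iso.refl _) (biprod.braiding _ _) (Iso.refl _)
    (by ext <;> simp) (by ext <;> simp)

/-- Split short exact sequences are conflations. -/
theorem conf_of_splitting {A B C : N.Obj} {f : A ⟶ B} {g : B ⟶ C} (r : B ⟶ A) (s : C ⟶ B)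
    (hfr : f ≫ r = 𝟙 A) (hsg : s ≫ g = 𝟙 C) (hfg : f ≫ g = 0) (hsr : s ≫ r = 0)
    (hid : r ≫ f + g ≫ s = 𝟙 B) : N.Conf f g :=
  (conf_biprod A C).of_iso (Iso.refl _)
    ⟨biprod.desc f s, biprod.lift r g, by ext <;> simp [hfr, hsg, hfg, hsr],
      by simp [biprod.lift_desc, hid]⟩ (Iso.refl _) (by simp) (by ext <;> simp [hsg, hfg])

/-- `F` plays the role of `C / A` and is found as the pushout of `g` along the quotient map `p`;
this is the third isomorphism theorem. -/
theorem Conf.noether_mono {A B C D E : N.Obj} {f : A ⟶ B} {p : B ⟶ D} (h : N.Conf f p)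
    {g : B ⟶ C} {q : C ⟶ E} (h' : N.Conf g q) :
    ∃ (F : N.Obj) (r : C ⟶ F) (s : D ⟶ F) (t : F ⟶ E),
      N.Conf (f ≫ g) r ∧ N.Conf s t ∧ g ≫ r = p ≫ s ∧ r ≫ t = q := by
  obtain ⟨F, r, s, t, hp, hrt, hst⟩ := h'.exists_pushout p
  have := h.epi
  have := h'.epi
  have : Epi r := by
    constructor
    intro T x y hxy
    refine hp.hom_ext hxy ?_
    rw [← cancel_epi p, ← Category.assoc, ← hp.w, Category.assoc, hxy, ← Category.assoc, hp.w,
      Category.assoc]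
  refine ⟨F, r, s, t, ?_, hst, hp.w, hrt⟩
  refine AdmMono.conf_of_cokernel (Exact.isExact.admMono_comp _ _ h.admMono h'.admMono)
    (by rw [Category.assoc, hp.w, ← Category.assoc, h.w, zero_comp]) fun {T} x hx => ?_
  obtain ⟨y, hy⟩ := h.exists_desc (g ≫ x) (by rw [← Category.assoc, hx])
  exact ⟨hp.desc x y hy.symm, hp.inl_desc _ _ _⟩

theorem Conf.noether_epi {A B C D E : N.Obj} {k : A ⟶ C} {p : C ⟶ B} (h : N.Conf k p)
    {l : D ⟶ B} {q : B ⟶ E} (h' : N.Conf l q) :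
    ∃ (F : N.Obj) (r : F ⟶ C) (s : A ⟶ F) (t : F ⟶ D),
      N.Conf r (p ≫ q) ∧ N.Conf s t ∧ r ≫ p = t ≫ l ∧ s ≫ r = k := by
  obtain ⟨F, r, s, t, hp, hsr, hst⟩ := h.exists_pullback l
  have := h'.mono
  have : Mono r := by
    constructor
    intro T x y hxy
    refine hp.hom_ext hxy ?_
    rw [← cancel_mono l, Category.assoc, ← hp.w, ← Category.assoc, hxy, Category.assoc, hp.w,
      Category.assoc]
  refine ⟨F, r, s, t, ?_, hst, hp.w, hsr⟩
  refine AdmEpi.conf_of_kernel (Exact.isExact.admEpi_comp _ _ h.admEpi h'.admEpi)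
    (by rw [← Category.assoc, hp.w, Category.assoc, h'.w, comp_zero]) fun {T} x hx => ?_
  obtain ⟨y, hy⟩ := h'.exists_lift (x ≫ p) (by rw [Category.assoc, hx])
  exact ⟨hp.lift x y hy.symm, hp.lift_fst _ _ _⟩

theorem Conf.biprod_right {A B C : N.Obj} {f : A ⟶ B} {g : B ⟶ C} (h : N.Conf f g) (X : N.Obj) :
    N.Conf (biprod.map f (𝟙 X)) (biprod.fst ≫ g) := by
  have := h.mono
  have : Mono (biprod.map f (𝟙 X)) := by
    constructor
    intro T x y hxy
    apply biprod.hom_ext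
    · rw [← cancel_mono f]
      simpa using hxy =≫ biprod.fst
    · simpa using hxy =≫ biprod.snd
  refine AdmEpi.conf_of_kernel
    (Exact.isExact.admEpi_comp _ _ (conf_biprod' B X).admEpi h.admEpi) (by simp [h.w])
    fun {T} x hx => ?_
  obtain ⟨y, hy⟩ := h.exists_lift (x ≫ biprod.fst) (by simpa using hx)
  exact ⟨biprod.lift y (x ≫ biprod.snd), by ext <;> simp [hy]⟩

/-- Direct sums of conflations are conflations. -/
theorem Conf.biprod {A B C A' B' C' : N.Obj} {f : A ⟶ B} {g : B ⟶ C} (h : N.Conf f g)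
    {f' : A' ⟶ B'} {g' : B' ⟶ C'} (h' : N.Conf f' g') :
    N.Conf (biprod.map f f') (biprod.map g g') := by
  have h₁ := h.biprod_right A'
  have h₂ : N.Conf (biprod.map (𝟙 B) f') (biprod.snd ≫ g') :=
    (h'.biprod_right B).of_iso (biprod.braiding _ _) (biprod.braiding _ _) (Iso.refl _)
      (by ext <;> simp) (by ext <;> simp)
  have e : biprod.map f f' = biprod.map f (𝟙 A') ≫ biprod.map (𝟙 B) f' := by ext <;> simp
  have := h.epi
  have := h'.epi
  refine AdmMono.conf_of_cokernel (e ▸ Exact.isExact.admMono_comp _ _ h₁.admMono h₂.admMono)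
    (by ext <;> simp [h.w, h'.w]) fun {T} x hx => ?_
  obtain ⟨y, hy⟩ := h.exists_desc (biprod.inl ≫ x) (by simpa using biprod.inl ≫= hx)
  obtain ⟨y', hy'⟩ := h'.exists_desc (biprod.inr ≫ x) (by simpa using biprod.inr ≫= hx)
  exact ⟨biprod.desc y y', by ext <;> simp [hy, hy']⟩

/-- A morphism of conflations which is the identity on both ends is an isomorphism. -/
theorem Conf.isIso_of_ends {A C D Q : N.Obj} {i : A ⟶ D} {p : D ⟶ C} (h : N.Conf i p)
    {j : A ⟶ Q} {q : Q ⟶ C} (h' : N.Conf j q) (φ : D ⟶ Q) (h₁ : i ≫ φ = j) (h₂ : φ ≫ q = p) :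
    IsIso φ := by
  have := h.mono
  have := h'.mono
  have : Mono φ := by
    refine Preadditive.mono_of_cancel_zero _ fun {T} x hx => ?_
    obtain ⟨y, rfl⟩ := h.exists_lift x (by rw [← h₂, ← Category.assoc, hx, zero_comp])
    rw [Category.assoc, h₁] at hx
    rw [zero_of_comp_mono j hx, zero_comp]
  -- Since `φ` is mono, it suffices to split it on the other side. On the fibre product `E` of `D`
  -- and `Q` over `C`, the projection `a` to `Q` is a deflation. The endomorphism `𝟙 - c ≫ s`
  -- factors through `A`, so `a` factors through `φ`, and passing to the cokernel of `ker a` yields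
  -- the inverse.
  obtain ⟨E, a, b, c, hE, hb, hc⟩ := h'.exists_pullback p
  -- `c : E ⟶ D` is split by `s`
  let s : D ⟶ E := hE.lift φ (𝟙 D) (by rw [h₂, Category.id_comp])
  have hs₁ : s ≫ a = φ := hE.lift_fst _ _ _
  have hs₂ : s ≫ c = 𝟙 D := hE.lift_snd _ _ _
  -- `a : E ⟶ Q` is a deflation
  have ha : N.AdmEpi a := by
    obtain ⟨E', a', b', c', hE', -, hc'⟩ := h.exists_pullback q
    exact (hc'.of_iso (Iso.refl _) (hE'.flip.isoIsPullback _ _ hE) (Iso.refl _)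
      (f' := b' ≫ (hE'.flip.isoIsPullback _ _ hE).hom) (g' := a) (by simp) (by simp)).admEpi
  obtain ⟨t, ht⟩ := hc.exists_lift (𝟙 E - c ≫ s) (by simp [hs₂])
  -- `a` factors through `φ`
  have hab : a = (t ≫ i + c) ≫ φ := by
    have := ht =≫ a
    simp only [Category.assoc, hb, Preadditive.sub_comp, Category.id_comp, hs₁] at this
    rw [Preadditive.add_comp, Category.assoc, h₁, this]
    simp
  obtain ⟨K, k, hk⟩ := (admEpi_iff a).1 ha
  obtain ⟨ψ, hψ⟩ := hk.exists_desc (t ≫ i + c) (by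
    rw [← cancel_mono φ, Category.assoc, ← hab, hk.w, zero_comp])
  have := hk.epi
  refine ⟨ψ, ?_, ?_⟩
  · have e : ψ ≫ φ = 𝟙 Q := by
      rw [← cancel_epi a, ← Category.assoc, hψ, ← hab, Category.comp_id]
    rw [← cancel_mono φ, Category.assoc, e, Category.comp_id, Category.id_comp]
  · rw [← cancel_epi a, ← Category.assoc, hψ, ← hab, Category.comp_id]

/-- In a morphism of conflations which is the identity on the left, the middle morphism is a
deflation if the right one is. -/
theorem Conf.exists_kernel_of_left_id {A B C B' C' : N.Obj} {i : A ⟶ B} {p : B ⟶ C}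
    (h : N.Conf i p) {i' : A ⟶ B'} {p' : B' ⟶ C'} (h' : N.Conf i' p') (b : B ⟶ B') (c : C ⟶ C')
    (h₁ : i ≫ b = i') (h₂ : b ≫ p' = p ≫ c) {K : N.Obj} {k : K ⟶ C} (hk : N.Conf k c) :
    ∃ l : K ⟶ B, N.Conf l b ∧ l ≫ p = k := by
  obtain ⟨Q, x, y, z, hQ, hy, hz⟩ := h'.exists_pullback c
  -- The short five lemma identifies `B` with the pullback of `p'` along `c`; hence `b` is a base
  -- change of `c` and has the same kernel.
  let φ : B ⟶ Q := hQ.lift b p h₂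
  have hφ₁ : φ ≫ x = b := hQ.lift_fst _ _ _
  have hφ₂ : φ ≫ z = p := hQ.lift_snd _ _ _
  have : IsIso φ := h.isIso_of_ends hz φ (hQ.hom_ext
    (by rw [Category.assoc, hφ₁, h₁, hy]) (by rw [Category.assoc, hφ₂, h.w, hz.w])) hφ₂
  obtain ⟨Q', x', y', z', hQ', hy', hz'⟩ := hk.exists_pullback p'
  let e := hQ'.flip.isoIsPullback _ _ hQ
  have e₁ : e.hom ≫ x = z' := by simp [e]
  have e₂ : e.hom ≫ z = x' := by simp [e]
  refine ⟨y' ≫ e.hom ≫ inv φ, hz'.of_iso (Iso.refl _) (e ≪≫ (asIso φ).symm) (Iso.refl _)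
    (by simp) ?_, ?_⟩
  · simp [← hφ₁, e₁]
  · simp [← hφ₂, e₂, hy']

/-- In a morphism of conflations whose outer components are deflations, the middle component is
a deflation and the kernels form a conflation. -/
theorem Conf.exists_kernel {A B C A' B' C' : N.Obj} {i : A ⟶ B} {p : B ⟶ C} (h : N.Conf i p)
    {i' : A' ⟶ B'} {p' : B' ⟶ C'} (h' : N.Conf i' p') {a : A ⟶ A'} {b : B ⟶ B'} {c : C ⟶ C'}
    (h₁ : i ≫ b = a ≫ i') (h₂ : b ≫ p' = p ≫ c) {K L : N.Obj} {k : K ⟶ A} {l : L ⟶ C}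
    (hk : N.Conf k a) (hl : N.Conf l c) :
    ∃ (M : N.Obj) (m : M ⟶ B) (x : K ⟶ M) (y : M ⟶ L),
      N.Conf m b ∧ N.Conf x y ∧ x ≫ m = k ≫ i ∧ m ≫ p = y ≫ l := by
  -- With `D = B / K`, the morphism `b` factors as the deflation `r` followed by a morphism `β` of
  -- extensions which is the identity on the left end `A'`.
  obtain ⟨D, r, s, t, hr, hst, hrs, hrt⟩ := hk.noether_mono h
  have := hk.epi
  have := hr.epi
  obtain ⟨β, hβ⟩ := hr.exists_desc b (by rw [Category.assoc, h₁, ← Category.assoc, hk.w, zero_comp])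
  have hsβ : s ≫ β = i' := by
    rw [← cancel_epi a, ← Category.assoc, ← hrs, Category.assoc, hβ, h₁]
  have hβp : β ≫ p' = t ≫ c := by
    rw [← cancel_epi r, ← Category.assoc, hβ, h₂, ← Category.assoc, hrt]
  obtain ⟨l', hl', hlt⟩ := hst.exists_kernel_of_left_id h' β c hsβ hβp hl
  obtain ⟨M, m, x, y, hm, hxy, hmy, hxm⟩ := hr.noether_epi hl'
  refine ⟨M, m, x, y, hβ ▸ hm, hxy, hxm, ?_⟩
  rw [← hrt, ← Category.assoc, hmy, Category.assoc, hlt]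

end

/-! ## Cycles and extensions of acyclic complexes -/

section

variable {N : ConflationCat.{v, u}}

/-- The morphism `m` is a kernel of the differential of `P` in degree `i`. -/
structure IsCycles (P : ChainComplex N.Obj ℤ) (i : ℤ) {Z : N.Obj} (m : Z ⟶ P.X i) : Prop where
  mono : Mono m
  w : m ≫ P.d i (i - 1) = 0
  exists_lift : ∀ {T : N.Obj} (x : T ⟶ P.X i), x ≫ P.d i (i - 1) = 0 → ∃ y : T ⟶ Z, y ≫ m = x

theorem IsCycles.w' {P : ChainComplex N.Obj ℤ} {i : ℤ} {Z : N.Obj} {m : Z ⟶ P.X i}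
    (h : IsCycles P i m) (j : ℤ) : m ≫ P.d i j = 0 := by
  by_cases hj : i - 1 = j
  · subst hj; exact h.w
  · rw [P.shape i j (fun h => hj (by simp at h; omega)), comp_zero]

variable [N.Exact]

theorem isCycles_of_conf {P : ChainComplex N.Obj ℤ} {i : ℤ} {Z Y : N.Obj} {m : Z ⟶ P.X i}
    {e : P.X i ⟶ Y} (h : N.Conf m e) {n : Y ⟶ P.X (i - 1)} (hn : Mono n)
    (hd : P.d i (i - 1) = e ≫ n) : IsCycles P i m where
  mono := h.mono
  w := by rw [hd, ← Category.assoc, h.w, zero_comp]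
  exists_lift x hx := h.exists_lift x (by
    rw [← cancel_mono n, Category.assoc, ← hd, hx, zero_comp])

/-- Chain maps which form a conflation in each degree. -/
def ConfCx (N : ConflationCat.{v, u}) {P Q R : ChainComplex N.Obj ℤ} (f : P ⟶ Q) (g : Q ⟶ R) :
    Prop := ∀ i, N.Conf (f.f i) (g.f i)

variable {P Q R : ChainComplex N.Obj ℤ} {f : P ⟶ Q} {g : Q ⟶ R}

/-- The inductive step for the acyclicity of extensions. -/
theorem ConfCx.step (h : N.ConfCx f g) {i : ℤ} {ZP YP ZR YR : N.Obj}
    {mP : ZP ⟶ P.X i} {eP : P.X i ⟶ YP} {nP : YP ⟶ P.X (i - 1)} (hP : N.Conf mP eP)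
    (hdP : P.d i (i - 1) = eP ≫ nP)
    {mR : ZR ⟶ R.X i} {eR : R.X i ⟶ YR} {nR : YR ⟶ R.X (i - 1)} (hR : N.Conf mR eR)
    (hdR : R.d i (i - 1) = eR ≫ nR) (hnR : Mono nR)
    {Y : N.Obj} {n : Y ⟶ Q.X (i - 1)} (hn : IsCycles Q (i - 1) n) {x : YP ⟶ Y} {y : Y ⟶ YR}
    (hxy : N.Conf x y) (hx : x ≫ n = nP ≫ f.f (i - 1)) (hy : n ≫ g.f (i - 1) = y ≫ nR) :
    ∃ (Z : N.Obj) (m : Z ⟶ Q.X i) (e : Q.X i ⟶ Y) (x' : ZP ⟶ Z) (y' : Z ⟶ ZR),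
      N.Conf m e ∧ Q.d i (i - 1) = e ≫ n ∧ N.Conf x' y' ∧
      x' ≫ m = mP ≫ f.f i ∧ m ≫ g.f i = y' ≫ mR := by
  obtain ⟨e, he⟩ := hn.exists_lift (Q.d i (i - 1)) (Q.d_comp_d _ _ _)
  have := hn.mono
  obtain ⟨Z, m, x', y', hm, hxy', hx', hy'⟩ := (h i).exists_kernel hxy (a := eP) (b := e) (c := eR)
    (by rw [← cancel_mono n, Category.assoc, he, f.comm, hdP, Category.assoc, Category.assoc, hx])
    (by rw [← cancel_mono nR, Category.assoc, ← hy, ← Category.assoc, he, Category.assoc, ← hdR,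
      g.comm]) hP hR
  exact ⟨Z, m, e, x', y', hm, he.symm, hxy', hx', hy'⟩

/-- Extensions of acyclic complexes are acyclic, and the cycles form conflations. -/
theorem ConfCx.acyclic (h : N.ConfCx f g) {a : ℤ} (ha : ∀ i < a, IsZero (Q.X i))
    {ZP ZR : ℤ → N.Obj} {mP : ∀ i, ZP i ⟶ P.X i} {eP : ∀ i, P.X i ⟶ ZP (i - 1)}
    (hP : ∀ i, N.Conf (mP i) (eP i)) (hdP : ∀ i, P.d i (i - 1) = eP i ≫ mP (i - 1))
    {mR : ∀ i, ZR i ⟶ R.X i} {eR : ∀ i, R.X i ⟶ ZR (i - 1)}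
    (hR : ∀ i, N.Conf (mR i) (eR i)) (hdR : ∀ i, R.d i (i - 1) = eR i ≫ mR (i - 1)) :
    ∃ (Z : ℤ → N.Obj) (m : ∀ i, Z i ⟶ Q.X i) (e : ∀ i, Q.X i ⟶ Z (i - 1))
      (x : ∀ i, ZP i ⟶ Z i) (y : ∀ i, Z i ⟶ ZR i),
      (∀ i, N.Conf (m i) (e i)) ∧ (∀ i, Q.d i (i - 1) = e i ≫ m (i - 1)) ∧
      (∀ i, N.Conf (x i) (y i)) ∧ (∀ i, x i ≫ m i = mP i ≫ f.f i) ∧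
      (∀ i, m i ≫ g.f i = y i ≫ mR i) := by
  -- The cycles are built upwards, starting in the degrees below `a`, where everything vanishes; one
  -- degree determines the next through the 3×3 lemma.
  have key : ∀ i, ∃ (Z : N.Obj) (m : Z ⟶ Q.X i) (x : ZP i ⟶ Z) (y : Z ⟶ ZR i),
      IsCycles Q i m ∧ N.Conf x y ∧ x ≫ m = mP i ≫ f.f i ∧ m ≫ g.f i = y ≫ mR i := by
    have low : ∀ i < a, ∃ (Z : N.Obj) (m : Z ⟶ Q.X i) (x : ZP i ⟶ Z) (y : Z ⟶ ZR i),
        IsCycles Q i m ∧ N.Conf x y ∧ x ≫ m = mP i ≫ f.f i ∧ m ≫ g.f i = y ≫ mR i := by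
      intro i hi
      have hQ := ha i hi
      have := (h i).mono
      have := (h i).epi
      have := (hP i).mono
      have := (hR i).mono
      have hP0 : IsZero (P.X i) := IsZero.of_mono (f.f i) hQ
      have hR0 : IsZero (R.X i) := IsZero.of_epi (g.f i) hQ
      have hZP : IsZero (ZP i) := IsZero.of_mono (mP i) hP0
      have hZR : IsZero (ZR i) := IsZero.of_mono (mR i) hR0
      refine ⟨0, 0, 0, 0, ⟨⟨fun _ _ _ => (isZero_zero _).eq_of_tgt _ _⟩, by simp, fun x _ => ⟨0,
        hQ.eq_of_tgt _ _⟩⟩, conf_zero_zero hZP (isZero_zero _) hZR _ _, hZP.eq_of_src _ _,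
        hR0.eq_of_tgt _ _⟩
    intro i
    by_cases hi : i < a
    · exact low i hi
    · induction i, (show a - 1 ≤ i by omega) using Int.leInduction with
      | base => exact low _ (by omega)
      | succ i hi' ih =>
        obtain ⟨j, rfl⟩ : ∃ j, i = j - 1 := ⟨i + 1, by omega⟩
        obtain ⟨Y, n, x, y, hn, hxy, hx, hy⟩ : ∃ (Z : N.Obj) (m : Z ⟶ Q.X (j - 1))
            (x : ZP (j - 1) ⟶ Z) (y : Z ⟶ ZR (j - 1)), IsCycles Q (j - 1) m ∧ N.Conf x y ∧
            x ≫ m = mP (j - 1) ≫ f.f (j - 1) ∧ m ≫ g.f (j - 1) = y ≫ mR (j - 1) := by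
          by_cases hj : j - 1 < a
          · exact low _ hj
          · exact ih hj
        rw [sub_add_cancel]
        obtain ⟨Z, m, e, x', y', hm, hd, hxy', hx', hy'⟩ := h.step (hP j) (hdP j) (hR j) (hdR j)
          (hR _).mono hn hxy hx hy
        exact ⟨Z, m, x', y', isCycles_of_conf hm hn.mono hd, hxy', hx', hy'⟩
  choose Z m x y hm hxy hx hy using key
  -- The cycles have been chosen independently in each degree. The inductive step is run again from
  -- the chosen cycles in degree `i - 1`, and its kernel is identified with the chosen cycles in
  -- degree `i`, both being kernels of the differential.
  have key' : ∀ i, ∃ e : Q.X i ⟶ Z (i - 1), N.Conf (m i) e ∧ Q.d i (i - 1) = e ≫ m (i - 1) := by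
    intro i
    obtain ⟨Z', m', e, -, -, hm', hd, -⟩ := h.step (hP i) (hdP i) (hR i) (hdR i) (hR _).mono
      (hm (i - 1)) (hxy _) (hx _) (hy _)
    have := (hm i).mono
    have := (hm (i - 1)).mono
    refine ⟨e, hm'.of_kernel ?_ ((hm i).exists_lift m' ?_), hd⟩
    · rw [← cancel_mono (m (i - 1)), Category.assoc, ← hd, (hm i).w, zero_comp]
    · rw [hd, ← Category.assoc, hm'.w, zero_comp]
  choose e he hd using key'
  exact ⟨Z, m, e, x, y, he, hd, hxy, hx, hy⟩

end

namespace AcyclicCx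

variable {ι : Type} {J : Set ℤ} {N : ConflationCat.{v, u}}

@[simp]
theorem add_f {P Q : AcyclicCx ι J N} (φ ψ : P ⟶ Q) (i : ℤ) :
    Hom.f (φ + ψ) i = φ.f i + ψ.f i := rfl

@[simp]
theorem zero_f {P Q : AcyclicCx ι J N} (i : ℤ) : Hom.f (0 : P ⟶ Q) i = 0 := rfl

/-- The underlying chain complex with respect to one of the differentials. -/
abbrev cx (P : AcyclicCx ι J N) (b : ι) : ChainComplex N.Obj ℤ :=
  { X := P.X, d := P.d b, shape := P.shape b, d_comp_d' := fun i j k _ _ => P.d_comp_d b i j k }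

/-- The chain map underlying a morphism. -/
abbrev cxMap {P Q : AcyclicCx ι J N} (φ : P ⟶ Q) (b : ι) : P.cx b ⟶ Q.cx b :=
  { f := φ.f, comm' := fun i j _ => φ.comm b i j }

/-- The cycles of an acyclic complex. -/
noncomputable def Z (P : AcyclicCx ι J N) (b : ι) : ℤ → N.Obj := (P.acyclic b).choose

/-- The inclusion of the cycles. -/
noncomputable def m (P : AcyclicCx ι J N) (b : ι) : ∀ i, P.Z b i ⟶ P.X i :=
  (P.acyclic b).choose_spec.choose

/-- The projection onto the cycles in the next degree. -/
noncomputable def e (P : AcyclicCx ι J N) (b : ι) : ∀ i, P.X i ⟶ P.Z b (i - 1) :=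
  (P.acyclic b).choose_spec.choose_spec.choose

theorem conf_m_e (P : AcyclicCx ι J N) (b : ι) (i : ℤ) : N.Conf (P.m b i) (P.e b i) :=
  ⟨_, (P.acyclic b).choose_spec.choose_spec.choose_spec.choose_spec.1 i⟩

theorem d_eq (P : AcyclicCx ι J N) (b : ι) (i : ℤ) :
    P.d b i (i - 1) = P.e b i ≫ P.m b (i - 1) :=
  (P.acyclic b).choose_spec.choose_spec.choose_spec.choose_spec.2 i

variable [N.Exact]

theorem isCycles (P : AcyclicCx ι J N) (b : ι) (i : ℤ) : IsCycles (P.cx b) i (P.m b i) :=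
  isCycles_of_conf (P.conf_m_e b i) (P.conf_m_e b _).mono (P.d_eq b i)

instance (P : AcyclicCx ι J N) (b : ι) (i : ℤ) : Mono (P.m b i) := (P.conf_m_e b i).mono

theorem m_d (P : AcyclicCx ι J N) (b : ι) (i j : ℤ) : P.m b i ≫ P.d b i j = 0 :=
  (P.isCycles b i).w' j

/-- The differential as a morphism to the cycles. -/
noncomputable def E (P : AcyclicCx ι J N) (b : ι) (i j : ℤ) : P.X i ⟶ P.Z b j :=
  ((P.isCycles b j).exists_lift (P.d b i j) (P.d_comp_d b _ _ _)).choose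

@[simp]
theorem E_m (P : AcyclicCx ι J N) (b : ι) (i j : ℤ) : P.E b i j ≫ P.m b j = P.d b i j :=
  ((P.isCycles b j).exists_lift (P.d b i j) (P.d_comp_d b _ _ _)).choose_spec

@[simp]
theorem E_m_assoc (P : AcyclicCx ι J N) (b : ι) (i j : ℤ) {T : N.Obj} (x : P.X j ⟶ T) :
    P.E b i j ≫ P.m b j ≫ x = P.d b i j ≫ x := by rw [← Category.assoc, E_m]

theorem E_eq_zero (P : AcyclicCx ι J N) (b : ι) {i j : ℤ} (h : i - 1 ≠ j) : P.E b i j = 0 := by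
  rw [← cancel_mono (P.m b j), E_m, P.shape b i j (fun h' => h (by simp at h'; omega)), zero_comp]

@[simp]
theorem m_E (P : AcyclicCx ι J N) (b : ι) (i j : ℤ) : P.m b i ≫ P.E b i j = 0 := by
  rw [← cancel_mono (P.m b j), Category.assoc, E_m, m_d, zero_comp]

@[simp]
theorem d_E (P : AcyclicCx ι J N) (b : ι) (i j k : ℤ) : P.d b i j ≫ P.E b j k = 0 := by
  rw [← E_m, Category.assoc, m_E, comp_zero]

@[simp]
theorem d_E_assoc (P : AcyclicCx ι J N) (b : ι) (i j k : ℤ) {T : N.Obj} (x : P.Z b k ⟶ T) :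
    P.d b i j ≫ P.E b j k ≫ x = 0 := by rw [← Category.assoc, d_E, zero_comp]

theorem conf_m_E (P : AcyclicCx ι J N) (b : ι) (i : ℤ) :
    N.Conf (P.m b i) (P.E b i (i - 1)) := by
  have : P.E b i (i - 1) = P.e b i := by
    rw [← cancel_mono (P.m b _), E_m, d_eq]
  rw [this]
  exact P.conf_m_e b i

theorem m_f_d {P Q : AcyclicCx ι J N} (φ : P ⟶ Q) (b : ι) (i j : ℤ) :
    (P.m b i ≫ φ.f i) ≫ Q.d b i j = 0 := by
  rw [Category.assoc, φ.comm, ← Category.assoc, m_d, zero_comp]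

/-- The morphism which a chain map induces on cycles. -/
noncomputable def ZMap {P Q : AcyclicCx ι J N} (φ : P ⟶ Q) (b : ι) (i : ℤ) : P.Z b i ⟶ Q.Z b i :=
  ((Q.isCycles b i).exists_lift (P.m b i ≫ φ.f i) (m_f_d φ b i _)).choose

@[simp]
theorem ZMap_m {P Q : AcyclicCx ι J N} (φ : P ⟶ Q) (b : ι) (i : ℤ) :
    ZMap φ b i ≫ Q.m b i = P.m b i ≫ φ.f i :=
  ((Q.isCycles b i).exists_lift (P.m b i ≫ φ.f i) (m_f_d φ b i _)).choose_spec

@[simp]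
theorem ZMap_m_assoc {P Q : AcyclicCx ι J N} (φ : P ⟶ Q) (b : ι) (i : ℤ) {T : N.Obj}
    (x : Q.X i ⟶ T) : ZMap φ b i ≫ Q.m b i ≫ x = P.m b i ≫ φ.f i ≫ x := by
  rw [← Category.assoc, ZMap_m, Category.assoc]

theorem E_ZMap {P Q : AcyclicCx ι J N} (φ : P ⟶ Q) (b : ι) (i j : ℤ) :
    P.E b i j ≫ ZMap φ b j = φ.f i ≫ Q.E b i j := by
  rw [← cancel_mono (Q.m b j), Category.assoc, ZMap_m, E_m_assoc, Category.assoc, E_m, φ.comm]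

theorem ZMap_id (P : AcyclicCx ι J N) (b : ι) (i : ℤ) : ZMap (𝟙 P) b i = 𝟙 _ := by
  rw [← cancel_mono (P.m b i)]; simp

theorem ZMap_comp {P Q R : AcyclicCx ι J N} (φ : P ⟶ Q) (ψ : Q ⟶ R) (b : ι) (i : ℤ) :
    ZMap (φ ≫ ψ) b i = ZMap φ b i ≫ ZMap ψ b i := by
  rw [← cancel_mono (R.m b i)]; simp

theorem ZMap_add {P Q : AcyclicCx ι J N} (φ ψ : P ⟶ Q) (b : ι) (i : ℤ) :
    ZMap (φ + ψ) b i = ZMap φ b i + ZMap ψ b i := by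
  rw [← cancel_mono (Q.m b i), ZMap_m, add_f, Preadditive.add_comp, Preadditive.comp_add, ZMap_m,
    ZMap_m]

/-- `ConfCx.acyclic` produces a conflation with some object of cycles in the middle; kernels being
unique, it is isomorphic to the one formed by the chosen cycles. -/
theorem conf_ZMap {S : ShortComplex (AcyclicCx ι J N)} (hS : (acyclicCat ι J N).conf S) (b : ι)
    (i : ℤ) : N.Conf (ZMap S.f b i) (ZMap S.g b i) := by
  obtain ⟨a, c, hac⟩ := S.X₂.bounded
  have h : N.ConfCx (cxMap S.f b) (cxMap S.g b) := fun i => ⟨_, hS i⟩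
  obtain ⟨Z, m, e, x, y, he, hd, hxy, hx, hy⟩ := h.acyclic (a := a)
    (fun i hi => hac i fun h => by have := h.1; omega)
    (fun i => S.X₁.conf_m_e b i) (fun i => S.X₁.d_eq b i)
    (fun i => S.X₃.conf_m_e b i) (fun i => S.X₃.d_eq b i)
  have hm : IsCycles (S.X₂.cx b) i (m i) := isCycles_of_conf (he i) (he _).mono (hd i)
  have hm' := S.X₂.isCycles b i
  have := hm.mono
  have := hm'.mono
  obtain ⟨s, hs⟩ := hm'.exists_lift (m i) hm.w
  obtain ⟨t, ht⟩ := hm.exists_lift (S.X₂.m b i) hm'.w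
  refine (hxy i).of_iso (Iso.refl _) ⟨s, t, ?_, ?_⟩ (Iso.refl _) ?_ ?_
  · rw [← cancel_mono (m i), Category.assoc, ht, hs, Category.id_comp]
  · rw [← cancel_mono (S.X₂.m b i), Category.assoc, hs, ht, Category.id_comp]
  · rw [← cancel_mono (S.X₂.m b i), Category.assoc, hs, hx]
    simp
  · rw [← cancel_mono (S.X₃.m b i)]
    simp only [Iso.refl_hom, Category.comp_id, Category.assoc, ZMap_m]
    rw [reassoc_of% hs]
    exact (hy i).symm

end AcyclicCx

/-- The exact functor which takes the cycles in degree `i`. -/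
noncomputable def cycles (ι : Type) (J : Set ℤ) (N : ConflationCat.{v, max u v}) [N.Exact]
    (b : ι) (i : ℤ) : ExactFunctor (acyclicCat ι J N) N where
  functor :=
    { obj := fun P : AcyclicCx ι J N => P.Z b i
      map := fun φ => AcyclicCx.ZMap φ b i
      map_id := fun P => AcyclicCx.ZMap_id P b i
      map_comp := fun φ ψ => AcyclicCx.ZMap_comp φ ψ b i }
  additive := ⟨fun {_ _} φ ψ => AcyclicCx.ZMap_add φ ψ b i⟩
  map_conf _ hS := (AcyclicCx.conf_ZMap hS b i).2

/-! ## Acyclic complexes form an exact category -/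

namespace AcyclicCx

variable {ι : Type} {J : Set ℤ} {N : ConflationCat.{v, u}}

theorem conf_iff {P Q R : AcyclicCx ι J N} (f : P ⟶ Q) (g : Q ⟶ R) :
    (acyclicCat ι J N).Conf f g ↔ ∀ i, N.Conf (f.f i) (g.f i) := by
  constructor
  · rintro ⟨w, h⟩ i
    exact ⟨_, h i⟩
  · intro h
    exact ⟨hom_ext _ _ fun i => (h i).w, fun i => (h i).2⟩

end AcyclicCx

variable {N : ConflationCat.{v, u}}

theorem Conf.isZero [N.Exact] {A B C : N.Obj} {f : A ⟶ B} {g : B ⟶ C} (h : N.Conf f g)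
    (hA : IsZero A) (hC : IsZero C) : IsZero B := by
  obtain ⟨y, hy⟩ := h.exists_lift (𝟙 B) (hC.eq_of_tgt _ _)
  rw [IsZero.iff_id_eq_zero, ← hy, hA.eq_of_tgt y 0, zero_comp]

theorem Conf.isZero_left [N.Exact] {A B C : N.Obj} {f : A ⟶ B} {g : B ⟶ C} (h : N.Conf f g)
    (hB : IsZero B) : IsZero A := by
  have := h.mono
  exact IsZero.of_mono f hB

theorem Conf.isZero_right [N.Exact] {A B C : N.Obj} {f : A ⟶ B} {g : B ⟶ C} (h : N.Conf f g)
    (hB : IsZero B) : IsZero C := by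
  have := h.epi
  exact IsZero.of_epi g hB

namespace AcyclicCx

variable {ι : Type} {J : Set ℤ} [N.Exact]

/-- An extension of acyclic complexes. -/
abbrev ext (P R : AcyclicCx ι J N) (X : ℤ → N.Obj) (d : ι → ∀ i j, X i ⟶ X j)
    (shape : ∀ b i j, ¬ (ComplexShape.down ℤ).Rel i j → d b i j = 0)
    (hd : ∀ b i j k, d b i j ≫ d b j k = 0) (f : ∀ i, P.X i ⟶ X i) (g : ∀ i, X i ⟶ R.X i)
    (h : ∀ i, N.Conf (f i) (g i)) (hf : ∀ b i j, f i ≫ d b i j = P.d b i j ≫ f j)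
    (hg : ∀ b i j, g i ≫ R.d b i j = d b i j ≫ g j) : AcyclicCx ι J N where
  X := X
  d := d
  shape := shape
  d_comp_d := hd
  bounded := by
    obtain ⟨a, c, hP⟩ := P.bounded
    obtain ⟨a', c', hR⟩ := R.bounded
    refine ⟨min a a', max c c', fun i hi => (h i).isZero (hP i fun hi' => hi ?_)
      (hR i fun hi' => hi ?_)⟩
    · exact ⟨(min_le_left _ _).trans hi'.1, hi'.2.trans (le_max_left _ _)⟩
    · exact ⟨(min_le_right _ _).trans hi'.1, hi'.2.trans (le_max_right _ _)⟩
  support i hi := (h i).isZero (P.support i hi) (R.support i hi)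
  acyclic b := by
    obtain ⟨a, c, hP⟩ := P.bounded
    obtain ⟨a', c', hR⟩ := R.bounded
    let Q : ChainComplex N.Obj ℤ :=
      { X := X, d := d b, shape := shape b, d_comp_d' := fun i j k _ _ => hd b i j k }
    have hc : N.ConfCx (P := P.cx b) (Q := Q) (R := R.cx b)
      { f := f, comm' := fun i j _ => hf b i j } { f := g, comm' := fun i j _ => hg b i j } := h
    obtain ⟨Z, m, e, -, -, hme, hde, -⟩ := hc.acyclic (a := min a a')
      (fun i hi => (h i).isZero (hP i fun hi' => by have := hi'.1; omega)
        (hR i fun hi' => by have := hi'.1; omega))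
      (P.conf_m_e b) (P.d_eq b) (R.conf_m_e b) (R.d_eq b)
    exact ⟨Z, m, e, fun i => (hme i).1, fun i => (hme i).2, hde⟩

omit [N.Exact] in
theorem isPushout_of_f {A B C D : AcyclicCx ι J N} {f : A ⟶ B} {g : A ⟶ C} {h : B ⟶ D} {k : C ⟶ D}
    (H : ∀ i, IsPushout (f.f i) (g.f i) (h.f i) (k.f i)) : IsPushout f g h k where
  w := hom_ext _ _ fun i => (H i).w
  isColimit' := ⟨PushoutCocone.IsColimit.mk _
    (fun s =>
      { f := fun i => (H i).desc (s.inl.f i) (s.inr.f i)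
          (by rw [← comp_f, ← comp_f, s.condition])
        comm := fun b i j => (H i).hom_ext
          (by rw [(H i).inl_desc_assoc, Hom.comm, ← Category.assoc, h.comm, Category.assoc,
            (H j).inl_desc])
          (by rw [(H i).inr_desc_assoc, Hom.comm, ← Category.assoc, k.comm, Category.assoc,
            (H j).inr_desc]) })
    (fun s => hom_ext _ _ fun i => (H i).inl_desc _ _ _)
    (fun s => hom_ext _ _ fun i => (H i).inr_desc _ _ _)
    (fun s x h₁ h₂ => hom_ext _ _ fun i => (H i).hom_ext
      (((congrArg (fun y => Hom.f y i) h₁)).trans ((H i).inl_desc _ _ _).symm)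
      (((congrArg (fun y => Hom.f y i) h₂)).trans ((H i).inr_desc _ _ _).symm))⟩

omit [N.Exact] in
theorem isPullback_of_f {A B C D : AcyclicCx ι J N} {f : A ⟶ B} {g : A ⟶ C} {h : B ⟶ D} {k : C ⟶ D}
    (H : ∀ i, IsPullback (f.f i) (g.f i) (h.f i) (k.f i)) : IsPullback f g h k where
  w := hom_ext _ _ fun i => (H i).w
  isLimit' := ⟨PullbackCone.IsLimit.mk _
    (fun s =>
      { f := fun i => (H i).lift (s.fst.f i) (s.snd.f i)
          (by rw [← comp_f, ← comp_f, s.condition])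
        comm := fun b i j => (H j).hom_ext
          (by rw [Category.assoc, ← f.comm, (H i).lift_fst_assoc, Hom.comm, Category.assoc,
            (H j).lift_fst])
          (by rw [Category.assoc, ← g.comm, (H i).lift_snd_assoc, Hom.comm, Category.assoc,
            (H j).lift_snd]) })
    (fun s => hom_ext _ _ fun i => (H i).lift_fst _ _ _)
    (fun s => hom_ext _ _ fun i => (H i).lift_snd _ _ _)
    (fun s x h₁ h₂ => hom_ext _ _ fun i => (H i).hom_ext
      (((congrArg (fun y => Hom.f y i) h₁)).trans ((H i).lift_fst _ _ _).symm)
      (((congrArg (fun y => Hom.f y i) h₂)).trans ((H i).lift_snd _ _ _).symm))⟩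

/-- Isomorphisms from degreewise isomorphisms. -/
@[simps]
def isoMk {P Q : AcyclicCx ι J N} (φ : P ⟶ Q) (ψ : ∀ i, Q.X i ⟶ P.X i)
    (h₁ : ∀ i, φ.f i ≫ ψ i = 𝟙 _) (h₂ : ∀ i, ψ i ≫ φ.f i = 𝟙 _) : P ≅ Q where
  hom := φ
  inv :=
    { f := ψ
      comm := fun b i j => by
        rw [← Category.comp_id (ψ i ≫ _), ← h₁, ← Category.assoc, Category.assoc (ψ i), ← φ.comm,
          ← Category.assoc (ψ i), h₂, Category.id_comp] }
  hom_inv_id := hom_ext _ _ h₁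
  inv_hom_id := hom_ext _ _ h₂

instance : HasZeroObject (AcyclicCx ι J N) :=
  ⟨⟨{ X := fun _ => 0
      d := fun _ _ _ => 0
      shape := fun _ _ _ _ => rfl
      d_comp_d := fun _ _ _ _ => by simp
      bounded := ⟨0, 0, fun _ _ => isZero_zero _⟩
      support := fun _ _ => isZero_zero _
      acyclic := fun b => ⟨fun _ => 0, fun _ => 0, fun _ => 0, by simp,
        fun i => (conf_zero_zero (isZero_zero _) (isZero_zero _) (isZero_zero _) 0 0).2,
        fun i => by simp⟩ },
    by
      rw [IsZero.iff_id_eq_zero]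
      exact hom_ext _ _ fun i => (isZero_zero N.Obj).eq_of_src _ _⟩⟩

/-- The direct sum of acyclic complexes. -/
noncomputable abbrev sum (P Q : AcyclicCx ι J N) : AcyclicCx ι J N :=
  ext P Q (fun i => P.X i ⊞ Q.X i) (fun b i j => biprod.map (P.d b i j) (Q.d b i j))
    (fun b i j h => by rw [P.shape b i j h, Q.shape b i j h]; ext <;> simp)
    (fun b i j k => by ext <;> simp [P.d_comp_d, Q.d_comp_d])
    (fun _ => biprod.inl) (fun _ => biprod.snd) (fun _ => conf_biprod _ _) (by simp) (by simp)

@[simp]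
theorem sum_X (P Q : AcyclicCx ι J N) (i : ℤ) : (sum P Q).X i = (P.X i ⊞ Q.X i) := rfl

/-- The direct sum of morphisms. -/
@[simps]
noncomputable def sumMap {P Q P' Q' : AcyclicCx ι J N} (φ : P ⟶ P') (ψ : Q ⟶ Q') :
    sum P Q ⟶ sum P' Q' where
  f i := biprod.map (φ.f i) (ψ.f i)
  comm b i j := by
    ext <;> simp [φ.comm, ψ.comm]

@[simps]
noncomputable def sumInl (P Q : AcyclicCx ι J N) : P ⟶ sum P Q where
  f i := biprod.inl
  comm b i j := by simp

@[simps]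
noncomputable def sumInr (P Q : AcyclicCx ι J N) : Q ⟶ sum P Q where
  f i := biprod.inr
  comm b i j := by simp

@[simps]
noncomputable def sumFst (P Q : AcyclicCx ι J N) : sum P Q ⟶ P where
  f i := biprod.fst
  comm b i j := by simp

@[simps]
noncomputable def sumSnd (P Q : AcyclicCx ι J N) : sum P Q ⟶ Q where
  f i := biprod.snd
  comm b i j := by simp

instance : HasBinaryBiproducts (AcyclicCx ι J N) where
  has_binary_biproduct P Q := hasBinaryBiproduct_of_total
    { pt := sum P Q
      fst := sumFst P Q
      snd := sumSnd P Q
      inl := sumInl P Q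
      inr := sumInr P Q
      inl_fst := hom_ext _ _ fun i => by simp
      inl_snd := hom_ext _ _ fun i => by simp
      inr_fst := hom_ext _ _ fun i => by simp
      inr_snd := hom_ext _ _ fun i => by simp } (hom_ext _ _ fun i => biprod.total)

/-- Degreewise reasoning is not enough, since the cokernel has to be acyclic. It is an extension of
the two given cokernels, so `ext` applies. -/
theorem exists_comp_mono {A B C : AcyclicCx ι J N} (f : A ⟶ B) (g : B ⟶ C)
    (hf : (acyclicCat ι J N).AdmMono f) (hg : (acyclicCat ι J N).AdmMono g) :
    (acyclicCat ι J N).AdmMono (f ≫ g) := by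
  obtain ⟨D, p, hp⟩ := (admMono_iff (N := acyclicCat ι J N) f).1 hf
  obtain ⟨E, q, hq⟩ := (admMono_iff (N := acyclicCat ι J N) g).1 hg
  have hp := (conf_iff f p).1 hp
  have hq := (conf_iff g q).1 hq
  choose F r s t hr hst hrs hrt using fun i => (hp i).noether_mono (hq i)
  have hd : ∀ (b : ι) (i j : ℤ), ∃ y : F i ⟶ F j, r i ≫ y = C.d b i j ≫ r j := fun b i j =>
    (hr i).exists_desc _ (by
      rw [Category.assoc, ← Category.assoc (g.f i), g.comm, ← Category.assoc, ← Category.assoc,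
        f.comm, Category.assoc, Category.assoc, ← Category.assoc (f.f j), (hr j).w, comp_zero])
  choose d hd using hd
  have hre : ∀ i, Epi (r i) := fun i => (hr i).epi
  have hpe : ∀ i, Epi (p.f i) := fun i => (hp i).epi
  let Q := ext D E F d (fun b i j h => by
      rw [← cancel_epi (r i), hd, C.shape b i j h, zero_comp, comp_zero])
    (fun b i j k => by
      rw [← cancel_epi (r i), reassoc_of% hd, hd, ← Category.assoc, C.d_comp_d, zero_comp,
        comp_zero]) s t hst
    (fun b i j => by
      rw [← cancel_epi (p.f i), ← Category.assoc, ← hrs, Category.assoc, hd, ← Category.assoc,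
        g.comm, Category.assoc, hrs, ← Category.assoc, ← p.comm, Category.assoc])
    (fun b i j => by
      rw [← cancel_epi (r i), ← Category.assoc, hrt, q.comm, ← Category.assoc, hd, Category.assoc,
        hrt])
  exact Conf.admMono (N := acyclicCat ι J N) (C := Q)
    (g := ({ f := r, comm := fun b i j => hd b i j } : Hom C Q)) ((conf_iff _ _).2 hr)

theorem exists_comp_epi {A B C : AcyclicCx ι J N} (f : A ⟶ B) (g : B ⟶ C)
    (hf : (acyclicCat ι J N).AdmEpi f) (hg : (acyclicCat ι J N).AdmEpi g) :
    (acyclicCat ι J N).AdmEpi (f ≫ g) := by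
  obtain ⟨D, k, hk⟩ := (admEpi_iff (N := acyclicCat ι J N) f).1 hf
  obtain ⟨E, l, hl⟩ := (admEpi_iff (N := acyclicCat ι J N) g).1 hg
  have hk := (conf_iff k f).1 hk
  have hl := (conf_iff l g).1 hl
  choose F r s t hr hst hrt hsr using fun i => (hk i).noether_epi (hl i)
  have hd : ∀ (b : ι) (i j : ℤ), ∃ y : F i ⟶ F j, y ≫ r j = r i ≫ A.d b i j := fun b i j =>
    (hr j).exists_lift _ (by
      rw [Category.assoc, ← Category.assoc (A.d b i j), ← f.comm, Category.assoc, ← g.comm,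
        ← Category.assoc, ← Category.assoc, Category.assoc (r i), (hr i).w, zero_comp])
  choose d hd using hd
  have hre : ∀ i, Mono (r i) := fun i => (hr i).mono
  have hle : ∀ i, Mono (l.f i) := fun i => (hl i).mono
  let Q := ext D E F d (fun b i j h => by
      rw [← cancel_mono (r j), hd, A.shape b i j h, zero_comp, comp_zero])
    (fun b i j k => by
      rw [← cancel_mono (r k), Category.assoc, hd, reassoc_of% hd, A.d_comp_d, zero_comp,
        comp_zero]) s t hst
    (fun b i j => by
      rw [← cancel_mono (r j), Category.assoc, hd, ← Category.assoc, hsr, k.comm, Category.assoc,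
        hsr])
    (fun b i j => by
      rw [← cancel_mono (l.f j), Category.assoc, ← l.comm, ← Category.assoc, ← hrt, Category.assoc,
        f.comm, ← Category.assoc, ← hd, Category.assoc, hrt, Category.assoc])
  exact Conf.admEpi (N := acyclicCat ι J N) (A := Q)
    (f := ({ f := r, comm := fun b i j => (hd b i j).symm } : Hom Q A)) ((conf_iff _ _).2 hr)

/-- The degreewise pushout is acyclic because it is an extension of the cokernel `C` of `f` by `A'`.
-/
theorem exists_isPushout {A B A' : AcyclicCx ι J N} (f : A ⟶ B) (g : A ⟶ A')
    (hf : (acyclicCat ι J N).AdmMono f) : ∃ (B' : AcyclicCx ι J N) (g' : B ⟶ B') (f' : A' ⟶ B'),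
      IsPushout f g g' f' ∧ (acyclicCat ι J N).AdmMono f' := by
  obtain ⟨C, p, hp⟩ := (admMono_iff (N := acyclicCat ι J N) f).1 hf
  have hp := (conf_iff f p).1 hp
  choose F r s t hF hrt hst using fun i => (hp i).exists_pushout (g.f i)
  let d : ι → ∀ i j, F i ⟶ F j := fun b i j => (hF i).desc (B.d b i j ≫ r j) (A'.d b i j ≫ s j) (by
    rw [← Category.assoc, f.comm, Category.assoc, (hF j).w, ← Category.assoc, ← Category.assoc,
      g.comm])
  have hr : ∀ b i j, r i ≫ d b i j = B.d b i j ≫ r j := fun b i j => (hF i).inl_desc _ _ _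
  have hs : ∀ b i j, s i ≫ d b i j = A'.d b i j ≫ s j := fun b i j => (hF i).inr_desc _ _ _
  have ht : ∀ b i j, t i ≫ C.d b i j = d b i j ≫ t j := fun b i j => (hF i).hom_ext
    (by rw [← Category.assoc, hrt, p.comm, reassoc_of% hr, hrt])
    (by rw [← Category.assoc, (hst i).w, reassoc_of% hs, (hst j).w, zero_comp, comp_zero])
  let Q := ext A' C F d
    (fun b i j h => (hF i).hom_ext (by rw [hr, B.shape b i j h, zero_comp, comp_zero])
      (by rw [hs, A'.shape b i j h, zero_comp, comp_zero]))
    (fun b i j k => (hF i).hom_ext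
      (by rw [reassoc_of% hr, hr, ← Category.assoc, B.d_comp_d, zero_comp, comp_zero])
      (by rw [reassoc_of% hs, hs, ← Category.assoc, A'.d_comp_d, zero_comp, comp_zero]))
    s t hst hs ht
  refine ⟨Q, { f := r, comm := hr }, { f := s, comm := hs }, isPushout_of_f hF, ?_⟩
  exact Conf.admMono (N := acyclicCat ι J N) (C := C)
    (g := ({ f := t, comm := ht } : Hom Q C)) ((conf_iff _ _).2 hst)

theorem exists_isPullback {B C C' : AcyclicCx ι J N} (f : B ⟶ C) (g : C' ⟶ C)
    (hf : (acyclicCat ι J N).AdmEpi f) : ∃ (B' : AcyclicCx ι J N) (g' : B' ⟶ B) (f' : B' ⟶ C'),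
      IsPullback g' f' f g ∧ (acyclicCat ι J N).AdmEpi f' := by
  obtain ⟨A, k, hk⟩ := (admEpi_iff (N := acyclicCat ι J N) f).1 hf
  have hk := (conf_iff k f).1 hk
  choose F r s t hF hsr hst using fun i => (hk i).exists_pullback (g.f i)
  let d : ι → ∀ i j, F i ⟶ F j := fun b i j => (hF j).lift (r i ≫ B.d b i j) (t i ≫ C'.d b i j) (by
    rw [Category.assoc, ← f.comm, ← Category.assoc, (hF i).w, Category.assoc, Category.assoc,
      g.comm])
  have hr : ∀ b i j, r i ≫ B.d b i j = d b i j ≫ r j := fun b i j => ((hF j).lift_fst _ _ _).symm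
  have ht : ∀ b i j, t i ≫ C'.d b i j = d b i j ≫ t j := fun b i j => ((hF j).lift_snd _ _ _).symm
  have hs : ∀ b i j, s i ≫ d b i j = A.d b i j ≫ s j := fun b i j => (hF j).hom_ext
    (by rw [Category.assoc, ← hr, ← Category.assoc, hsr, k.comm, Category.assoc, hsr])
    (by rw [Category.assoc, ← ht, ← Category.assoc, (hst i).w, Category.assoc, (hst j).w,
      zero_comp, comp_zero])
  let Q := ext A C' F d
    (fun b i j h => (hF j).hom_ext (by rw [← hr, B.shape b i j h, zero_comp, comp_zero])
      (by rw [← ht, C'.shape b i j h, zero_comp, comp_zero]))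
    (fun b i j k => (hF k).hom_ext
      (by rw [Category.assoc, ← hr, ← Category.assoc, ← hr, Category.assoc, B.d_comp_d, zero_comp,
        comp_zero])
      (by rw [Category.assoc, ← ht, ← Category.assoc, ← ht, Category.assoc, C'.d_comp_d, zero_comp,
        comp_zero])) s t hst hs ht
  refine ⟨Q, { f := r, comm := hr }, { f := t, comm := ht }, isPullback_of_f hF, ?_⟩
  exact Conf.admEpi (N := acyclicCat ι J N) (A := A) (f := ({ f := s, comm := hs } : Hom A Q))
    ((conf_iff _ _).2 hst)

theorem isKernel {S : ShortComplex (AcyclicCx ι J N)} (h : (acyclicCat ι J N).conf S) :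
    Nonempty (IsLimit (KernelFork.ofι S.f S.zero)) := by
  have h' : ∀ i, N.Conf (S.f.f i) (S.g.f i) := (conf_iff S.f S.g).1 ⟨S.zero, h⟩
  have hm : ∀ i, Mono (S.f.f i) := fun i => (h' i).mono
  have : Mono S.f := ⟨fun x y hxy => hom_ext _ _ fun i => by
    rw [← cancel_mono (S.f.f i)]
    exact congrArg (fun z => Hom.f z i) hxy⟩
  have key : ∀ {T : AcyclicCx ι J N} (x : T ⟶ S.X₂), x ≫ S.g = 0 → ∃ y : T ⟶ S.X₁, y ≫ S.f = x := by
    intro T x hx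
    choose y hy using fun i => (h' i).exists_lift (x.f i) (congrArg (fun z => Hom.f z i) hx)
    refine ⟨{ f := y, comm := fun b i j => ?_ }, hom_ext _ _ hy⟩
    rw [← cancel_mono (S.f.f j), Category.assoc, ← S.f.comm, reassoc_of% hy, x.comm, Category.assoc,
      hy]
  exact ⟨KernelFork.IsLimit.ofι _ _ (fun x hx => (key x hx).choose)
    (fun x hx => (key x hx).choose_spec)
    (fun x hx y hy => by rw [← cancel_mono S.f, hy, (key x hx).choose_spec])⟩

theorem isCokernel {S : ShortComplex (AcyclicCx ι J N)} (h : (acyclicCat ι J N).conf S) :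
    Nonempty (IsColimit (CokernelCofork.ofπ S.g S.zero)) := by
  have h' : ∀ i, N.Conf (S.f.f i) (S.g.f i) := (conf_iff S.f S.g).1 ⟨S.zero, h⟩
  have hm : ∀ i, Epi (S.g.f i) := fun i => (h' i).epi
  have : Epi S.g := ⟨fun x y hxy => hom_ext _ _ fun i => by
    rw [← cancel_epi (S.g.f i)]
    exact congrArg (fun z => Hom.f z i) hxy⟩
  have key : ∀ {T : AcyclicCx ι J N} (x : S.X₂ ⟶ T), S.f ≫ x = 0 → ∃ y : S.X₃ ⟶ T, S.g ≫ y = x := by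
    intro T x hx
    choose y hy using fun i => (h' i).exists_desc (x.f i) (congrArg (fun z => Hom.f z i) hx)
    refine ⟨{ f := y, comm := fun b i j => ?_ }, hom_ext _ _ hy⟩
    rw [← cancel_epi (S.g.f i), reassoc_of% hy, x.comm, ← Category.assoc, S.g.comm, Category.assoc,
      hy]
  exact ⟨CokernelCofork.IsColimit.ofπ _ _ (fun x hx => (key x hx).choose)
    (fun x hx => (key x hx).choose_spec)
    (fun x hx y hy => by rw [← cancel_epi S.g, hy, (key x hx).choose_spec])⟩

omit [N.Exact] in
theorem isZero_X {P : AcyclicCx ι J N} (h : IsZero P) (i : ℤ) : IsZero (P.X i) :=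
  (AcyclicCx.eval ι J N i).map_isZero h

theorem conf_id (A : AcyclicCx ι J N) :
    (acyclicCat ι J N).Conf (𝟙 A) (0 : A ⟶ (0 : AcyclicCx ι J N)) :=
  (conf_iff _ _).2 fun i => conf_id_zero _ (isZero_X (isZero_zero _) i) _

theorem conf_id' (A : AcyclicCx ι J N) :
    (acyclicCat ι J N).Conf (0 : (0 : AcyclicCx ι J N) ⟶ A) (𝟙 A) :=
  (conf_iff _ _).2 fun i => conf_zero_id _ (isZero_X (isZero_zero _) i) _

end AcyclicCx

instance (ι : Type) (J : Set ℤ) [N.Exact] : (acyclicCat ι J N).Exact where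
  isExact :=
    { hasZeroObject := inferInstanceAs (HasZeroObject (AcyclicCx ι J N))
      hasBinaryBiproducts := inferInstanceAs (HasBinaryBiproducts (AcyclicCx ι J N))
      isKernel := fun _ h => AcyclicCx.isKernel h
      isCokernel := fun _ h => AcyclicCx.isCokernel h
      of_iso := fun _ _ ⟨e⟩ h i =>
        Exact.isExact.of_iso _ _ ⟨(AcyclicCx.eval ι J N i).mapShortComplex.mapIso e⟩ (h i)
      admMono_id := fun A => (AcyclicCx.conf_id A).admMono
      admEpi_id := fun A => (AcyclicCx.conf_id' A).admEpi
      admMono_comp := AcyclicCx.exists_comp_mono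
      admEpi_comp := AcyclicCx.exists_comp_epi
      pushout := AcyclicCx.exists_isPushout
      pullback := AcyclicCx.exists_isPullback }

/-! ## Classes of pairs of acyclic complexes -/

section K0

variable {N : ConflationCat.{v, u}}

/-- The class of an object. -/
def K0.of (A : N.Obj) : K0 N := QuotientAddGroup.mk (FreeAbelianGroup.of A)

theorem K0.of_conf {A B C : N.Obj} {f : A ⟶ B} {g : B ⟶ C} (h : N.Conf f g) :
    K0.of B = K0.of A + K0.of C := by
  obtain ⟨w, h⟩ := h
  rw [K0.of, K0.of, K0.of, ← QuotientAddGroup.mk_add, QuotientAddGroup.eq, neg_add_eq_sub,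
    ← neg_mem_iff, neg_sub]
  exact AddSubgroup.subset_closure ⟨_, h, rfl⟩

theorem K0.of_isZero [N.Exact] {A : N.Obj} (h : IsZero A) : K0.of A = 0 := by
  have := K0.of_conf (conf_zero_zero h h h (𝟙 A) (𝟙 A))
  simpa using this

theorem K0.of_iso [N.Exact] {A B : N.Obj} (e : A ≅ B) : K0.of A = K0.of B := by
  have := K0.of_conf (conf_iso_zero e (isZero_zero _) 0)
  rw [this, K0.of_isZero (isZero_zero _), add_zero]

theorem K0.map_of {M : ConflationCat.{v, u}} (F : ExactFunctor N M) (A : N.Obj) :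
    K0.map F (K0.of A) = K0.of (F.functor.obj A) := by
  simp [K0.map, K0.of]

theorem K0.hom_ext {G : Type*} [AddCommGroup G] {f g : K0 N →+ G}
    (h : ∀ A : N.Obj, f (K0.of A) = g (K0.of A)) : f = g :=
  QuotientAddGroup.addMonoidHom_ext _ (FreeAbelianGroup.lift_ext _ _ h)

/-- A homomorphism on the class group from an additive function. -/
def K0.lift {G : Type*} [AddCommGroup G] (f : N.Obj → G)
    (hf : ∀ S : ShortComplex N.Obj, N.conf S → f S.X₂ = f S.X₁ + f S.X₃) : K0 N →+ G :=
  QuotientAddGroup.lift _ (FreeAbelianGroup.lift f) <| by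
    rw [K0Rel, AddSubgroup.closure_le]
    rintro _ ⟨S, hS, rfl⟩
    simp [hf S hS]

theorem K0.lift_of {G : Type*} [AddCommGroup G] (f : N.Obj → G)
    (hf : ∀ S : ShortComplex N.Obj, N.conf S → f S.X₂ = f S.X₁ + f S.X₃) (A : N.Obj) :
    K0.lift f hf (K0.of A) = f A := by
  simp [K0.lift, K0.of]

end K0

variable {M : ConflationCat.{v, u}}

/-- The class group of binary acyclic complexes modulo the diagonal ones. -/
abbrev DiagQuot (J : Set ℤ) (M : ConflationCat.{v, u}) : Type (max u v) :=
  K0 (Bq J M) ⧸ (K0.map (diag J M)).range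

/-- The class of a binary acyclic complex modulo the diagonal ones. -/
def DiagQuot.of {J : Set ℤ} (P : AcyclicCx Bool J M) : DiagQuot J M :=
  QuotientAddGroup.mk (K0.of (N := Bq J M) P)

/-- The graded object `X` vanishes outside `J`. -/
def SuppIn (J : Set ℤ) (X : ℤ → M.Obj) : Prop := ∀ i ∉ J, IsZero (X i)

/-- The graded object `X` is bounded. -/
abbrev Bdd (X : ℤ → M.Obj) : Prop := ∃ a c : ℤ, ∀ i ∉ Set.Icc a c, IsZero (X i)

/-- Acyclic complexes without condition on the support. -/
abbrev Ac (M : ConflationCat.{v, u}) := AcyclicCx Unit Set.univ M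

section

variable [M.Exact]

/-- The binary acyclic complex given by a pair of acyclic complexes and an isomorphism of the
underlying graded objects. -/
abbrev bin (J : Set ℤ) (X Y : Ac M) (φ : ∀ i, X.X i ≅ Y.X i) (h : SuppIn J X.X) :
    AcyclicCx Bool J M where
  X := X.X
  d b i j := bif b then X.d () i j else (φ i).hom ≫ Y.d () i j ≫ (φ j).inv
  shape b i j h := by
    cases b
    · simp [Y.shape () i j h]
    · exact X.shape () i j h
  d_comp_d b i j k := by
    cases b
    · simp [← Category.assoc (Y.d () i j), Y.d_comp_d]
    · exact X.d_comp_d () i j k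
  bounded := X.bounded
  support := h
  acyclic b := by
    cases b
    · obtain ⟨Z, m, e, w, hc, hd⟩ := Y.acyclic ()
      refine ⟨Z, fun i => m i ≫ (φ i).inv, fun i => (φ i).hom ≫ e i, fun i => by simp [w],
        fun i => ?_, fun i => ?_⟩
      · exact (Conf.of_iso ⟨w i, hc i⟩ (Iso.refl _) (φ i).symm (Iso.refl _) (by simp)
          (by simp)).2
      · have := hd i
        dsimp at this ⊢
        simp [this]
    · exact X.acyclic ()

/-- Morphisms of binary acyclic complexes. -/
abbrev binMap {J : Set ℤ} {X Y X' Y' : Ac M} {φ : ∀ i, X.X i ≅ Y.X i} {h : SuppIn J X.X}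
    {φ' : ∀ i, X'.X i ≅ Y'.X i} {h' : SuppIn J X'.X} (f : X ⟶ X') (g : Y ⟶ Y')
    (hfg : ∀ i, f.f i ≫ (φ' i).hom = (φ i).hom ≫ g.f i) :
    bin J X Y φ h ⟶ bin J X' Y' φ' h' where
  f := f.f
  comm b i j := by
    cases b
    · have := hfg j
      rw [← Iso.eq_comp_inv] at this
      simp only [cond_false]
      rw [reassoc_of% hfg i, this]
      simp only [Category.assoc, Iso.inv_hom_id_assoc]
      rw [← Category.assoc (g.f i), g.comm, Category.assoc]
    · exact f.comm () i j

/-- The class of the binary acyclic complex given by a pair of acyclic complexes and an isomorphism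
of the underlying graded objects. -/
def cls (J : Set ℤ) (X Y : Ac M) (φ : ∀ i, X.X i ≅ Y.X i) (h : SuppIn J X.X) : DiagQuot J M :=
  DiagQuot.of (bin J X Y φ h)

omit [M.Exact] in
theorem DiagQuot.of_conf {J : Set ℤ} {P Q R : AcyclicCx Bool J M} (f : P ⟶ Q) (g : Q ⟶ R)
    (h : ∀ i, M.Conf (f.f i) (g.f i)) :
    DiagQuot.of Q = DiagQuot.of P + DiagQuot.of R := by
  rw [DiagQuot.of, K0.of_conf (N := Bq J M) ((AcyclicCx.conf_iff f g).2 h)]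
  rfl

theorem DiagQuot.of_iso {J : Set ℤ} {P Q : AcyclicCx Bool J M} (e : P ≅ Q) :
    DiagQuot.of P = DiagQuot.of Q :=
  congrArg QuotientAddGroup.mk (K0.of_iso (N := Bq J M) e)

omit [M.Exact] in
theorem DiagQuot.of_diag {J : Set ℤ} (P : AcyclicCx Unit J M) :
    DiagQuot.of ((diag J M).functor.obj P) = 0 :=
  (QuotientAddGroup.eq_zero_iff _).2 ⟨K0.of (N := Cq J M) P, K0.map_of (diag J M) P⟩

theorem cls_add {J : Set ℤ} {X₁ X₂ X₃ Y₁ Y₂ Y₃ : Ac M} {φ₁ : ∀ i, X₁.X i ≅ Y₁.X i}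
    {φ₂ : ∀ i, X₂.X i ≅ Y₂.X i} {φ₃ : ∀ i, X₃.X i ≅ Y₃.X i} (h₁ : SuppIn J X₁.X)
    (h₂ : SuppIn J X₂.X) (h₃ : SuppIn J X₃.X) (f : X₁ ⟶ X₂) (g : X₂ ⟶ X₃)
    (h : ∀ i, M.Conf (f.f i) (g.f i)) (f' : Y₁ ⟶ Y₂) (g' : Y₂ ⟶ Y₃)
    (hf : ∀ i, f.f i ≫ (φ₂ i).hom = (φ₁ i).hom ≫ f'.f i)
    (hg : ∀ i, g.f i ≫ (φ₃ i).hom = (φ₂ i).hom ≫ g'.f i) :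
    cls J X₂ Y₂ φ₂ h₂ = cls J X₁ Y₁ φ₁ h₁ + cls J X₃ Y₃ φ₃ h₃ :=
  DiagQuot.of_conf (binMap f f' hf) (binMap g g' hg) h

theorem cls_congr {J : Set ℤ} {X Y X' Y' : Ac M} {φ : ∀ i, X.X i ≅ Y.X i}
    {φ' : ∀ i, X'.X i ≅ Y'.X i} (h : SuppIn J X.X) (h' : SuppIn J X'.X) (f : X ≅ X') (g : Y ≅ Y')
    (hfg : ∀ i, f.hom.f i ≫ (φ' i).hom = (φ i).hom ≫ g.hom.f i) :
    cls J X Y φ h = cls J X' Y' φ' h' :=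
  DiagQuot.of_iso (AcyclicCx.isoMk (binMap f.hom g.hom hfg) f.inv.f
    (fun i => congrArg (fun x => AcyclicCx.Hom.f x i) f.hom_inv_id)
    (fun i => congrArg (fun x => AcyclicCx.Hom.f x i) f.inv_hom_id))

theorem cls_self {J : Set ℤ} (X : Ac M) (h : SuppIn J X.X) :
    cls J X X (fun _ => Iso.refl _) h = 0 := by
  let P : AcyclicCx Unit J M :=
    { X := X.X, d := X.d, shape := X.shape, d_comp_d := X.d_comp_d, bounded := X.bounded,
      support := h, acyclic := X.acyclic }
  rw [← DiagQuot.of_diag P]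
  refine DiagQuot.of_iso (AcyclicCx.isoMk (P := bin J X X (fun _ => Iso.refl _) h)
    (Q := (diag J M).functor.obj P) { f := fun i => 𝟙 (X.X i), comm := ?_ }
    (fun i => 𝟙 (X.X i)) ?_ ?_)
  · intro b i j
    cases b <;> simp [P, diag]
  · intro i; exact Category.comp_id _
  · intro i; exact Category.comp_id _

theorem cls_isoApp {J : Set ℤ} {X Y : Ac M} (f : X ≅ Y) (h : SuppIn J X.X)
    {φ : ∀ i, X.X i ≅ Y.X i} (hφ : ∀ i, (φ i).hom = f.hom.f i) : cls J X Y φ h = 0 := by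
  rw [← cls_self X h]
  exact (cls_congr _ _ (Iso.refl _) f (fun i => by simp [hφ])).symm

/-! ## Contractible complexes and shifts -/

/-- The contractible complex `⋯ ⟶ G i ⊞ G (i - 1) ⟶ G (i - 1) ⊞ G (i - 2) ⟶ ⋯`. -/
noncomputable abbrev ctr (G : ℤ → M.Obj) (hG : Bdd G) : Ac M where
  X i := G i ⊞ G (i - 1)
  d _ i j := if h : i - 1 = j then biprod.snd ≫ eqToHom (by rw [h]) ≫ biprod.inl else 0
  shape _ i j h := dif_neg fun h' => h (by simp; omega)
  d_comp_d _ i j k := by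
    split_ifs <;> simp
  bounded := by
    obtain ⟨a, c, h⟩ := hG
    refine ⟨a, c + 1, fun i hi => (conf_biprod _ _).isZero (h i fun hi' => hi ?_)
      (h _ fun hi' => hi ?_)⟩
    · exact ⟨hi'.1, by have := hi'.2; omega⟩
    · exact ⟨by have := hi'.1; omega, by have := hi'.2; omega⟩
  support i hi := absurd trivial hi
  acyclic _ := ⟨G, fun i => biprod.inl, fun i => biprod.snd, fun i => by simp,
    fun i => (conf_biprod _ _).2, fun i => by simp⟩

/-- The map of contractible complexes given by a map of graded objects. -/
@[simps]
noncomputable def ctrMap {G H : ℤ → M.Obj} (hG : Bdd G) (hH : Bdd H) (f : ∀ i, G i ⟶ H i) :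
    ctr G hG ⟶ ctr H hH where
  f i := biprod.map (f i) (f (i - 1))
  comm _ i j := by
    by_cases h : i - 1 = j
    · subst h; simp
    · simp [h]

/-- The isomorphism of contractible complexes given by an isomorphism of graded objects. -/
noncomputable def ctrIso {G H : ℤ → M.Obj} (hG : Bdd G) (hH : Bdd H) (f : ∀ i, G i ≅ H i) :
    ctr G hG ≅ ctr H hH where
  hom := ctrMap hG hH fun i => (f i).hom
  inv := ctrMap hH hG fun i => (f i).inv
  hom_inv_id := AcyclicCx.hom_ext _ _ fun i => by ext <;> simp
  inv_hom_id := AcyclicCx.hom_ext _ _ fun i => by ext <;> simp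

theorem suppIn_ctr {J : Set ℤ} {G : ℤ → M.Obj} {hG : Bdd G}
    (h : ∀ i, (i ∉ J ∨ i + 1 ∉ J) → IsZero (G i)) : SuppIn J (ctr G hG).X := fun i hi =>
  (conf_biprod _ _).isZero (h i (Or.inl hi)) (h (i - 1) (Or.inr (by simpa using hi)))

theorem Conf.neg_right {A B C : M.Obj} {f : A ⟶ B} {g : B ⟶ C} (h : M.Conf f g) :
    M.Conf f (-g) :=
  h.of_iso (Iso.refl _) (Iso.refl _) ⟨-𝟙 C, -𝟙 C, by simp, by simp⟩ (by simp) (by simp)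

/-- The shift of an acyclic complex. -/
abbrev AcyclicCx.shift (X : Ac M) : Ac M where
  X i := X.X (i - 1)
  d b i j := - X.d b (i - 1) (j - 1)
  shape b i j h := by
    rw [X.shape b _ _ (fun h' => h (by simp at h' ⊢; omega)), neg_zero]
  d_comp_d b i j k := by simp [X.d_comp_d]
  bounded := by
    obtain ⟨a, c, h⟩ := X.bounded
    exact ⟨a + 1, c + 1, fun i hi => h _ fun hi' => hi
      ⟨by have := hi'.1; omega, by have := hi'.2; omega⟩⟩
  support i hi := absurd trivial hi
  acyclic b := ⟨fun i => X.Z b (i - 1), fun i => X.m b (i - 1), fun i => - X.e b (i - 1),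
    fun i => by simp [(X.conf_m_e b (i - 1)).w], fun i => (X.conf_m_e b (i - 1)).neg_right.2,
    fun i => by simp [X.d_eq]⟩

/-- The shift of a morphism. -/
@[simps]
def AcyclicCx.shiftMap {X Y : Ac M} (φ : X ⟶ Y) : X.shift ⟶ Y.shift where
  f i := φ.f (i - 1)
  comm b i j := by simp [φ.comm]

/-- The embedding of an acyclic complex into a contractible complex. -/
@[simps]
noncomputable def toCtr (X : Ac M) : X ⟶ ctr X.X X.bounded where
  f i := biprod.lift (𝟙 _) (X.d () i (i - 1))
  comm _ i j := by
    by_cases h : i - 1 = j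
    · subst h
      ext <;> simp [X.d_comp_d]
    · rw [X.shape () i j (fun h' => h (by simp at h'; omega))]
      simp [h]

/-- The projection of a contractible complex onto a shift. -/
@[simps]
noncomputable def fromCtr (X : Ac M) : ctr X.X X.bounded ⟶ X.shift where
  f i := biprod.desc (-X.d () i (i - 1)) (𝟙 _)
  comm _ i j := by
    by_cases h : i - 1 = j
    · subst h
      ext <;> simp [X.d_comp_d]
    · have := X.shape () (i - 1) (j - 1) (fun h' => h (by simp at h'; omega))
      simp [h, this]

/-- In each degree, the graph of the differential is a complement of the second summand. -/
theorem conf_ctr (X : Ac M) (i : ℤ) : M.Conf ((toCtr X).f i) ((fromCtr X).f i) :=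
  conf_of_splitting biprod.fst biprod.inr (by simp) (by simp) (by simp) (by simp)
    (by ext <;> simp)

/-- An isomorphism of the graded objects underlying two contractible complexes. -/
@[simps]
noncomputable def ctrTri {G H : ℤ → M.Obj} {hG : Bdd G} {hH : Bdd H} (φ φ' : ∀ i, G i ≅ H i)
    (n : ∀ i, G i ⟶ H (i - 1)) (i : ℤ) : (ctr G hG).X i ≅ (ctr H hH).X i where
  hom := biprod.desc (biprod.lift (φ i).hom (n i)) (biprod.lift 0 (φ' (i - 1)).hom)
  inv := biprod.desc (biprod.lift (φ i).inv (-(φ i).inv ≫ n i ≫ (φ' (i - 1)).inv))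
    (biprod.lift 0 (φ' (i - 1)).inv)
  hom_inv_id := by ext <;> simp
  inv_hom_id := by ext <;> simp

end

variable {M : ConflationCat.{v, u}} [M.Exact]

/-! ## Cutting off graded objects -/

section Cut

/-- The object `A` if `p` holds and the zero object otherwise. -/
noncomputable def cut (p : Prop) [Decidable p] (A : M.Obj) : M.Obj := if p then A else 0

variable (p : Prop) [Decidable p]

/-- The inclusion of a cut off object. -/
noncomputable def cutIn (A : M.Obj) : cut p A ⟶ A := if h : p then eqToHom (if_pos h) else 0

/-- The projection onto a cut off object. -/
noncomputable def cutOut (A : M.Obj) : A ⟶ cut p A :=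
  if h : p then eqToHom (if_pos h).symm else 0

variable {p}

theorem isZero_cut (h : ¬ p) (A : M.Obj) : IsZero (cut p A) := by
  rw [cut, if_neg h]
  exact isZero_zero _

variable (p)

theorem isZero_cut_of (A : M.Obj) (h : IsZero A) : IsZero (cut p A) := by
  by_cases hp : p
  · rwa [cut, if_pos hp]
  · exact isZero_cut hp A

@[simp]
theorem cutIn_cutOut (A : M.Obj) : cutIn p A ≫ cutOut p A = 𝟙 _ := by
  by_cases hp : p
  · rw [cutIn, cutOut, dif_pos hp, dif_pos hp]
    exact eqToHom_trans _ _
  · exact (isZero_cut hp A).eq_of_src _ _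

@[simp]
theorem cutIn_cutOut_assoc (A : M.Obj) {T : M.Obj} (x : cut p A ⟶ T) :
    cutIn p A ≫ cutOut p A ≫ x = x := by
  rw [← Category.assoc, cutIn_cutOut, Category.id_comp]

variable {p}

theorem cutOut_cutIn (h : p) (A : M.Obj) : cutOut p A ≫ cutIn p A = 𝟙 A := by
  rw [cutIn, cutOut, dif_pos h, dif_pos h]
  exact eqToHom_trans _ _

theorem cutOut_cutIn_assoc (h : p) (A : M.Obj) {T : M.Obj} (x : A ⟶ T) :
    cutOut p A ≫ cutIn p A ≫ x = x := by
  rw [← Category.assoc, cutOut_cutIn h, Category.id_comp]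

variable (p)

theorem cut_total {q : Prop} [Decidable q] (hpq : q ↔ ¬ p) (A : M.Obj) :
    cutOut p A ≫ cutIn p A + cutOut q A ≫ cutIn q A = 𝟙 A := by
  by_cases hp : p
  · rw [cutOut_cutIn hp, (isZero_cut (fun h => hpq.1 h hp) A).eq_of_tgt (cutOut q A) 0]
    simp
  · rw [cutOut_cutIn (hpq.2 hp), (isZero_cut hp A).eq_of_tgt (cutOut p A) 0]
    simp

theorem cutIn_cutOut_of_not {q : Prop} [Decidable q] (hpq : ¬ (p ∧ q)) (A : M.Obj) :
    cutIn p A ≫ cutOut q A = 0 := by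
  by_cases hp : p
  · exact (isZero_cut (fun h => hpq ⟨hp, h⟩) A).eq_of_tgt _ _
  · exact (isZero_cut hp A).eq_of_src _ _

theorem conf_cut {q : Prop} [Decidable q] (hpq : q ↔ ¬ p) (A : M.Obj) :
    M.Conf (cutIn p A) (cutOut q A) :=
  conf_of_splitting (cutOut p A) (cutIn q A) (by simp) (by simp)
    (cutIn_cutOut_of_not p (fun h => hpq.1 h.2 h.1) A)
    (cutIn_cutOut_of_not q (fun h => hpq.1 h.1 h.2) A)
    (cut_total p hpq A)

/-- Cutting off a morphism. -/
noncomputable def cutMap {A B : M.Obj} (f : A ⟶ B) : cut p A ⟶ cut p B :=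
  cutIn p A ≫ f ≫ cutOut p B

theorem cutMap_cutIn {A B : M.Obj} (f : A ⟶ B) : cutMap p f ≫ cutIn p B = cutIn p A ≫ f := by
  by_cases hp : p
  · simp [cutMap, cutOut_cutIn hp]
  · exact (isZero_cut hp A).eq_of_src _ _

theorem cutOut_cutMap {A B : M.Obj} (f : A ⟶ B) : cutOut p A ≫ cutMap p f = f ≫ cutOut p B := by
  by_cases hp : p
  · simp [cutMap, cutOut_cutIn_assoc hp]
  · exact (isZero_cut hp B).eq_of_tgt _ _

@[simp]
theorem cutMap_id (A : M.Obj) : cutMap p (𝟙 A) = 𝟙 _ := by simp [cutMap]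

theorem cutMap_comp {A B C : M.Obj} (f : A ⟶ B) (g : B ⟶ C) :
    cutMap p (f ≫ g) = cutMap p f ≫ cutMap p g := by
  have := cutOut_cutMap p g
  simp only [cutMap, Category.assoc] at this ⊢
  rw [this]

/-- Cutting off an isomorphism. -/
@[simps]
noncomputable def cutIso {A B : M.Obj} (f : A ≅ B) : cut p A ≅ cut p B where
  hom := cutMap p f.hom
  inv := cutMap p f.inv
  hom_inv_id := by rw [← cutMap_comp, f.hom_inv_id, cutMap_id]
  inv_hom_id := by rw [← cutMap_comp, f.inv_hom_id, cutMap_id]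

theorem Conf.cut {A B C : M.Obj} {f : A ⟶ B} {g : B ⟶ C} (h : M.Conf f g) :
    M.Conf (cutMap p f) (cutMap p g) := by
  by_cases hp : p
  · exact h.of_iso ⟨cutOut p A, cutIn p A, cutOut_cutIn hp A, cutIn_cutOut p A⟩
      ⟨cutOut p B, cutIn p B, cutOut_cutIn hp B, cutIn_cutOut p B⟩
      ⟨cutOut p C, cutIn p C, cutOut_cutIn hp C, cutIn_cutOut p C⟩
      (cutOut_cutMap p f).symm (cutOut_cutMap p g).symm
  · exact conf_zero_zero (isZero_cut hp A) (isZero_cut hp B) (isZero_cut hp C) _ _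

end Cut

/-! ## Classes of contractible complexes -/

/-- The degrees in `J` whose successors are also in `J`. -/
def inner (J : Set ℤ) : Set ℤ := {i | i ∈ J ∧ i + 1 ∈ J}

omit [M.Exact] in
theorem SuppIn.of_inner {J : Set ℤ} {G : ℤ → M.Obj} (h : SuppIn (inner J) G) : SuppIn J G :=
  fun i hi => h i fun hi' => hi hi'.1

theorem SuppIn.ctr {J : Set ℤ} {G : ℤ → M.Obj} {hG : Bdd G} (h : SuppIn (inner J) G) :
    SuppIn J (ctr G hG).X :=
  suppIn_ctr fun i hi => h i fun hi' => hi.elim (fun h => h hi'.1) fun h => h hi'.2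

omit [M.Exact] in
theorem SuppIn.prev {J : Set ℤ} {G : ℤ → M.Obj} (h : SuppIn (inner J) G) :
    SuppIn J (fun i => G (i - 1)) :=
  fun i hi => h _ fun hi' => hi (by have := hi'.2; rwa [sub_add_cancel] at this)

/-- The off-diagonal entry `n` lowers the degree in `G`, so the isomorphism respects the filtration
by degree and is diagonal on its graded pieces. The induction on the length of `G` splits off the
top degree. -/
theorem cls_ctrTri {J : Set ℤ} {G H : ℤ → M.Obj} (hG : Bdd G) (hH : Bdd H)
    (φ φ' : ∀ i, G i ≅ H i) (n : ∀ i, G i ⟶ H (i - 1)) (h : SuppIn (inner J) G) :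
    cls J (ctr G hG) (ctr H hH) (ctrTri φ φ' n) h.ctr =
      cls J (ctr G hG) (ctr H hH) (ctrTri φ φ' fun _ => 0) h.ctr := by
  have key : ∀ (k : ℕ) (a : ℤ) {G H : ℤ → M.Obj} (hG : Bdd G) (hH : Bdd H)
      (φ φ' : ∀ i, G i ≅ H i) (n : ∀ i, G i ⟶ H (i - 1)) (h : SuppIn (inner J) G),
      (∀ i, ¬ (a ≤ i ∧ i < a + k) → IsZero (G i)) →
      cls J (ctr G hG) (ctr H hH) (ctrTri φ φ' n) h.ctr =
        cls J (ctr G hG) (ctr H hH) (ctrTri φ φ' fun _ => 0) h.ctr := by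
    intro k a
    induction k with
    | zero =>
      intro G H hG hH φ φ' n h hz
      obtain rfl : n = fun _ => 0 :=
        funext fun i => (hz i fun hi => by have := hi.2; simp at this; omega).eq_of_src _ _
      rfl
    | succ k ih =>
      intro G H hG hH φ φ' n h hz
      have bdd : ∀ {G : ℤ → M.Obj} (p : ℤ → Prop) [∀ i, Decidable (p i)], Bdd G →
          Bdd (fun i => cut (p i) (G i)) := fun p _ ⟨a, c, h⟩ =>
        ⟨a, c, fun i hi => isZero_cut_of _ _ (h i hi)⟩
      have supp : ∀ (p : ℤ → Prop) [∀ i, Decidable (p i)],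
          SuppIn (inner J) (fun i => cut (p i) (G i)) := fun p _ i hi => isZero_cut_of _ _ (h i hi)
      have split : ∀ n : ∀ i, G i ⟶ H (i - 1),
          cls J (ctr G hG) (ctr H hH) (ctrTri φ φ' n) h.ctr =
          cls J (ctr _ (bdd (fun i => i < a + k) hG)) (ctr _ (bdd (fun i => i < a + k) hH))
            (ctrTri (fun i => cutIso _ (φ i)) (fun i => cutIso _ (φ' i))
              fun i => cutIn _ _ ≫ n i ≫ cutOut _ _) (supp _).ctr +
          cls J (ctr _ (bdd (fun i => ¬ i < a + k) hG)) (ctr _ (bdd (fun i => ¬ i < a + k) hH))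
            (ctrTri (fun i => cutIso _ (φ i)) (fun i => cutIso _ (φ' i))
              fun i => cutIn _ _ ≫ n i ≫ cutOut _ _) (supp _).ctr := by
        intro n
        -- These two identities say that `n` preserves the part of degree below `a + k` and induces
        -- a map on the quotient.
        have h₁ : ∀ i, n i ≫ cutOut (¬ i - 1 < a + k) (H (i - 1)) =
            cutOut (¬ i < a + k) (G i) ≫ cutIn _ _ ≫ n i ≫ cutOut _ _ := by
          intro i
          by_cases hi : i < a + k
          · exact (isZero_cut (by push Not; omega) _).eq_of_tgt _ _
          · rw [cutOut_cutIn_assoc hi]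
        have h₂ : ∀ i, cutIn (i < a + k) (G i) ≫ n i =
            (cutIn (i < a + k) (G i) ≫ n i ≫ cutOut _ _) ≫ cutIn (i - 1 < a + k) (H (i - 1)) := by
          intro i
          by_cases hi : i < a + k
          · rw [Category.assoc, Category.assoc, cutOut_cutIn (by omega), Category.comp_id]
          · exact (isZero_cut hi _).eq_of_src _ _
        refine cls_add _ _ _ (ctrMap _ _ fun i => cutIn _ _) (ctrMap _ _ fun i => cutOut _ _)
          (fun i => (conf_cut _ Iff.rfl _).biprod (conf_cut _ Iff.rfl _))
          (ctrMap _ _ fun i => cutIn _ _) (ctrMap _ _ fun i => cutOut _ _)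
          (fun i => ?_) (fun i => ?_)
        · ext
          · simp [cutMap_cutIn]
          · simp only [ctrMap_f, ctrTri_hom, biprod.inl_map_assoc, biprod.inl_desc, biprod.lift_snd,
              Category.assoc, biprod.inl_desc_assoc]
            simpa using h₂ i
          · simp
          · simp [cutMap_cutIn]
        · ext
          · simp [cutOut_cutMap]
          · simp only [ctrMap_f, ctrTri_hom, biprod.inl_map_assoc, biprod.inl_desc, biprod.lift_snd,
              Category.assoc, biprod.inl_desc_assoc]
            simpa using (h₁ i).symm
          · simp
          · simp [cutOut_cutMap]
      -- The quotient is concentrated in the single degree `a + k`, so no degree-lowering map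
      -- survives on it.
      have hn : (fun i => cutIn (¬ i < a + k) (G i) ≫ n i ≫ cutOut (¬ i - 1 < a + k) _) =
          fun _ => 0 := by
        funext i
        by_cases hi : i < a + k + 1
        · exact (isZero_cut (by push Not; omega) _).eq_of_tgt _ _
        · exact (isZero_cut_of _ _ (hz i fun h => hi (by have := h.2; push_cast at this; omega))
            ).eq_of_src _ _
      rw [split n, split fun _ => 0, hn, ih _ _ _ _ _ (supp _)]
      · congr 3 <;> simp
      · intro i hi
        by_cases hi' : i < a + k
        · exact isZero_cut_of _ _ (hz i fun h => hi ⟨h.1, hi'⟩)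
        · exact isZero_cut hi' _
  obtain ⟨a, c, hac⟩ := hG
  refine key (c + 1 - a).toNat a _ hH φ φ' n h fun i hi => hac i fun hi' => hi ⟨hi'.1, ?_⟩
  have := hi'.1
  have := hi'.2
  omega

/-- The diagonal isomorphism of the graded objects underlying two contractible complexes. -/
@[simps]
noncomputable def ctrDiag {G H : ℤ → M.Obj} {hG : Bdd G} {hH : Bdd H} (φ φ' : ∀ i, G i ≅ H i)
    (i : ℤ) : (ctr G hG).X i ≅ (ctr H hH).X i where
  hom := biprod.map (φ i).hom (φ' (i - 1)).hom
  inv := biprod.map (φ i).inv (φ' (i - 1)).inv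

theorem ctrTri_zero {G H : ℤ → M.Obj} {hG : Bdd G} {hH : Bdd H} (φ φ' : ∀ i, G i ≅ H i) :
    ctrTri (hG := hG) (hH := hH) φ φ' (fun _ => 0) = ctrDiag φ φ' := by
  funext i
  ext <;> simp

variable {J : Set ℤ}

/-- The extensions `X ⟶ ctr X ⟶ X[1]` and `Y ⟶ ctr Y ⟶ Y[1]` match under a triangular isomorphism
whose off-diagonal entry measures how far `φ`, `φ'` are from a chain map; `cls_ctrTri` removes that
entry. It is essential later that `φ` and `φ'` are independent of each other. -/
theorem cls_add_cls_shift {X Y : Ac M} (φ φ' : ∀ i, X.X i ≅ Y.X i) (h : SuppIn (inner J) X.X) :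
    cls J X Y φ h.of_inner + cls J X.shift Y.shift (fun i => φ' (i - 1)) h.prev =
      cls J (ctr X.X X.bounded) (ctr Y.X Y.bounded) (ctrDiag φ φ') h.ctr := by
  rw [← ctrTri_zero, ← cls_ctrTri _ _ φ φ' (fun i => (φ i).hom ≫ Y.d () i (i - 1) -
    X.d () i (i - 1) ≫ (φ' (i - 1)).hom) h]
  refine (cls_add _ _ _ (toCtr X) (fromCtr X) (conf_ctr X) (toCtr Y) (fromCtr Y) ?_ ?_).symm
  · intro i
    ext <;> simp
  · intro i
    ext
    · simp
      abel
    · simp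

/-- For `φ' = φ` the diagonal isomorphism of contractible complexes is a chain map, so the sum of
the two classes is zero. -/
theorem cls_shift {X Y : Ac M} (φ : ∀ i, X.X i ≅ Y.X i) (h : SuppIn (inner J) X.X) :
    cls J X.shift Y.shift (fun i => φ (i - 1)) h.prev = - cls J X Y φ h.of_inner := by
  have := cls_add_cls_shift φ φ h
  rw [cls_isoApp (ctrIso X.bounded Y.bounded φ) _ (fun i => rfl)] at this
  exact (neg_eq_of_add_eq_zero_right this).symm

/-- Two isomorphisms of graded objects which differ by an automorphism. -/
theorem cls_trans_sub {X Y : Ac M} (σ : ∀ i, X.X i ≅ X.X i) (φ : ∀ i, X.X i ≅ Y.X i)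
    (h : SuppIn (inner J) X.X) :
    cls J X Y (fun i => σ i ≪≫ φ i) h.of_inner - cls J X Y φ h.of_inner =
      cls J (ctr X.X X.bounded) (ctr X.X X.bounded) (ctrDiag σ fun _ => Iso.refl _) h.ctr := by
  -- Use `σ ≫ φ` on the unshifted part and `φ` on the shifted part. Identifying `ctr Y` with `ctr X`
  -- through `φ` leaves `σ` on one summand only; in particular the difference no longer depends on
  -- the differentials.
  have := cls_add_cls_shift (fun i => σ i ≪≫ φ i) φ h
  rw [cls_shift φ h, ← sub_eq_add_neg] at this
  rw [this]
  refine cls_congr _ _ (Iso.refl _) (ctrIso Y.bounded X.bounded fun i => (φ i).symm) fun i => ?_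
  ext <;> simp [ctrIso]

/-- Unipotent automorphisms do not change the class. -/
theorem cls_trans_unipotent {X Y : Ac M} (σ : ∀ i, X.X i ≅ X.X i) (φ : ∀ i, X.X i ≅ Y.X i)
    (h : SuppIn (inner J) X.X) {G G' : ℤ → M.Obj} (f : ∀ i, G i ⟶ X.X i) (g : ∀ i, X.X i ⟶ G' i)
    (hfg : ∀ i, M.Conf (f i) (g i)) (hf : ∀ i, f i ≫ (σ i).hom = f i)
    (hg : ∀ i, (σ i).hom ≫ g i = g i) :
    cls J X Y (fun i => σ i ≪≫ φ i) h.of_inner = cls J X Y φ h.of_inner := by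
  rw [← sub_eq_zero, cls_trans_sub σ φ h]
  obtain ⟨a, c, hac⟩ := X.bounded
  have bG : Bdd G := ⟨a, c, fun i hi => (hfg i).isZero_left (hac i hi)⟩
  have bG' : Bdd G' := ⟨a, c, fun i hi => (hfg i).isZero_right (hac i hi)⟩
  have hG : SuppIn (inner J) G := fun i hi => (hfg i).isZero_left (h i hi)
  have hG' : SuppIn (inner J) G' := fun i hi => (hfg i).isZero_right (h i hi)
  -- The conflation `G ⟶ X ⟶ G'` of graded objects induces one of contractible complexes, and on
  -- both ends the automorphism is the identity.
  rw [cls_add (hG.ctr (hG := bG)) h.ctr (hG'.ctr (hG := bG')) (φ₁ := fun _ => Iso.refl _)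
    (φ₃ := fun _ => Iso.refl _) (ctrMap _ _ f) (ctrMap _ _ g) (fun i => (hfg i).biprod (hfg _))
    (ctrMap _ _ f) (ctrMap _ _ g), cls_self, cls_self, add_zero]
  · intro i
    ext <;> simp [hf]
  · intro i
    ext <;> simp [hg]

/-- The swap of the summands of a direct sum of graded objects. -/
@[simps]
noncomputable def braid (G H : ℤ → M.Obj) (i : ℤ) : (G i ⊞ H i) ≅ (H i ⊞ G i) where
  hom := biprod.lift biprod.snd biprod.fst
  inv := biprod.lift biprod.snd biprod.fst

/-- The swap of the summands of a direct sum of acyclic complexes. -/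
noncomputable def sumBraid (X Y : Ac M) : X.sum Y ≅ Y.sum X :=
  AcyclicCx.isoMk { f := fun i => (braid X.X Y.X i).hom, comm := fun b i j => by ext <;> simp }
    (fun i => (braid X.X Y.X i).inv) (fun i => by ext <;> simp) (fun i => by ext <;> simp)

theorem SuppIn.sum {J : Set ℤ} {G H : ℤ → M.Obj} (hG : SuppIn J G) (hH : SuppIn J H) :
    SuppIn J (fun i => G i ⊞ H i) := fun i hi => (conf_biprod _ _).isZero (hG i hi) (hH i hi)

omit [M.Exact] in
theorem SuppIn.of_iso {J : Set ℤ} {G H : ℤ → M.Obj} (hG : SuppIn J G) (φ : ∀ i, G i ≅ H i) :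
    SuppIn J H := fun i hi => (hG i hi).of_iso (φ i).symm

theorem cls_sum {X Y X' Y' : Ac M} (φ : ∀ i, X.X i ≅ X'.X i) (ψ : ∀ i, Y.X i ≅ Y'.X i)
    (hX : SuppIn J X.X) (hY : SuppIn J Y.X) :
    cls J (X.sum Y) (X'.sum Y') (fun i => biprod.mapIso (φ i) (ψ i)) (hX.sum hY) =
      cls J X X' φ hX + cls J Y Y' ψ hY :=
  cls_add _ _ _ (AcyclicCx.sumInl X Y) (AcyclicCx.sumSnd X Y) (fun _ => conf_biprod _ _)
    (AcyclicCx.sumInl X' Y') (AcyclicCx.sumSnd X' Y') (fun i => by simp) (fun i => by simp)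

/-- The class is additive under composition of isomorphisms of graded objects. -/
theorem cls_trans {X Y Z : Ac M} (φ : ∀ i, X.X i ≅ Y.X i) (ψ : ∀ i, Y.X i ≅ Z.X i)
    (h : SuppIn (inner J) X.X) :
    cls J X Z (fun i => φ i ≪≫ ψ i) h.of_inner =
      cls J X Y φ h.of_inner + cls J Y Z ψ (h.of_iso φ).of_inner := by
  -- As in Whitehead's lemma, `φ ⊕ ψ` and `(φ ≫ ψ) ⊕ 𝟙` differ by the flip of `X ⊕ Y` along `φ`. By
  -- `cls_trans_sub` the difference depends only on the flip as a graded automorphism, so it may be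
  -- computed on `X ⊕ X`, where the flip is a chain map and contributes zero.
  have hY := h.of_iso φ
  have hXY := h.sum hY
  have e₁ := cls_sum φ ψ h.of_inner hY.of_inner
  have e₂ := cls_sum (fun i => φ i ≪≫ ψ i) (fun i => Iso.refl (Y.X i)) h.of_inner hY.of_inner
  rw [cls_self, add_zero] at e₂
  rw [← e₁, ← e₂]
  -- the automorphism by which the two isomorphisms differ
  let σ : ∀ i, (X.sum Y).X i ≅ (X.sum Y).X i := fun i =>
    { hom := biprod.desc (biprod.lift 0 (φ i).hom) (biprod.lift (φ i).inv 0)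
      inv := biprod.desc (biprod.lift 0 (φ i).hom) (biprod.lift (φ i).inv 0)
      hom_inv_id := by ext <;> simp
      inv_hom_id := by ext <;> simp }
  have e₃ := cls_trans_sub (X := X.sum Y) (Y := Z.sum Y) σ
    (fun i => biprod.mapIso (φ i ≪≫ ψ i) (Iso.refl (Y.X i))) hXY
  have e₄ := cls_trans_sub (X := X.sum X) (Y := X.sum X) (braid X.X X.X) (fun i => Iso.refl _)
    (h.sum h)
  rw [cls_self, cls_isoApp (sumBraid X X) _ (fun i => by simp [sumBraid]), sub_zero] at e₄
  have e₅ : cls J (X.sum Y) (Y.sum Z) (fun i => biprod.mapIso (φ i) (ψ i)) hXY.of_inner =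
      cls J (X.sum Y) (Z.sum Y)
        (fun i => σ i ≪≫ biprod.mapIso (φ i ≪≫ ψ i) (Iso.refl (Y.X i))) hXY.of_inner := by
    refine cls_congr _ _ (Iso.refl _) (sumBraid Y Z) fun i => ?_
    ext <;> simp [σ, sumBraid]
  have e₆ : cls J (ctr (X.sum Y).X (X.sum Y).bounded) (ctr (X.sum Y).X (X.sum Y).bounded)
      (ctrDiag σ fun _ => Iso.refl _) hXY.ctr =
      cls J (ctr (X.sum X).X (X.sum X).bounded) (ctr (X.sum X).X (X.sum X).bounded)
      (ctrDiag (braid X.X X.X) fun _ => Iso.refl _) (h.sum h).ctr := by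
    refine cls_congr _ _
      (ctrIso _ _ fun i => biprod.mapIso (Iso.refl (X.X i)) (φ i).symm)
      (ctrIso _ _ fun i => biprod.mapIso (Iso.refl (X.X i)) (φ i).symm) fun i => ?_
    apply biprod.hom_ext' <;> apply biprod.hom_ext' <;> apply biprod.hom_ext <;>
      apply biprod.hom_ext <;> simp [σ, ctrIso]
  rw [e₅, ← sub_eq_zero, ← neg_sub, e₃, e₆, ← e₄, neg_zero]

variable {M : ConflationCat.{v, u}} [M.Exact]

/-! ## Exchanging summands -/

section Exchange

variable {J : Set ℤ}

omit [M.Exact] in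
theorem SuppIn.mono {J J' : Set ℤ} (hJ : J ⊆ J') {G : ℤ → M.Obj} (h : SuppIn J G) : SuppIn J' G :=
  fun i hi => h i fun h' => hi (hJ h')

theorem comp_lift_assoc {A B C D E : M.Obj} (f : A ⟶ B) (g : B ⟶ C) (h : B ⟶ D) (k : C ⊞ D ⟶ E) :
    f ≫ biprod.lift g h ≫ k = biprod.lift (f ≫ g) (f ≫ h) ≫ k := by
  rw [← Category.assoc]
  congr 1
  ext <;> simp

@[simp]
theorem lift_zero_right {A B C : M.Obj} (f : A ⟶ B) :
    biprod.lift f (0 : A ⟶ C) = f ≫ biprod.inl := by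
  ext <;> simp

@[simp]
theorem lift_zero_left {A B C : M.Obj} (f : A ⟶ C) :
    biprod.lift (0 : A ⟶ B) f = f ≫ biprod.inr := by
  ext <;> simp

/-- The automorphism of `A ⊞ B` given by a morphism `A ⟶ B`. -/
@[simps]
noncomputable def lowerUnipotent {A B : M.Obj} (p : A ⟶ B) : A ⊞ B ≅ A ⊞ B where
  hom := 𝟙 _ + biprod.fst ≫ p ≫ biprod.inr
  inv := 𝟙 _ - biprod.fst ≫ p ≫ biprod.inr
  hom_inv_id := by simp
  inv_hom_id := by simp

/-- The automorphism of `A ⊞ B` given by a morphism `B ⟶ A`. -/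
@[simps]
noncomputable def upperUnipotent {A B : M.Obj} (q : B ⟶ A) : A ⊞ B ≅ A ⊞ B where
  hom := 𝟙 _ + biprod.snd ≫ q ≫ biprod.inl
  inv := 𝟙 _ - biprod.snd ≫ q ≫ biprod.inl
  hom_inv_id := by simp
  inv_hom_id := by simp

theorem cls_lowerUnipotent {X X' Y : Ac M} (p : ∀ i, X.X i ⟶ X'.X i)
    (φ : ∀ i, (X.sum X').X i ≅ Y.X i) (h : SuppIn (inner J) (X.sum X').X) :
    cls J (X.sum X') Y (fun i => lowerUnipotent (p i) ≪≫ φ i) h.of_inner =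
      cls J (X.sum X') Y φ h.of_inner :=
  cls_trans_unipotent _ _ h (fun _ => biprod.inr) (fun _ => biprod.fst)
    (fun _ => conf_biprod' _ _) (fun _ => by simp) (fun _ => by simp)

theorem cls_upperUnipotent {X X' Y : Ac M} (q : ∀ i, X'.X i ⟶ X.X i)
    (φ : ∀ i, (X.sum X').X i ≅ Y.X i) (h : SuppIn (inner J) (X.sum X').X) :
    cls J (X.sum X') Y (fun i => upperUnipotent (q i) ≪≫ φ i) h.of_inner =
      cls J (X.sum X') Y φ h.of_inner :=
  cls_trans_unipotent _ _ h (fun _ => biprod.inl) (fun _ => biprod.snd)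
    (fun _ => conf_biprod _ _) (fun _ => by simp) (fun _ => by simp)

/-- The isomorphism `A ⊞ (B ⊞ C) ≅ A' ⊞ (B ⊞ C')` given by an isomorphism `A ⊞ C ≅ A' ⊞ C'`. -/
@[simps]
noncomputable def mapOuter {A C A' C' : M.Obj} (B : M.Obj) (a : A ⊞ C ≅ A' ⊞ C') :
    A ⊞ (B ⊞ C) ≅ A' ⊞ (B ⊞ C') where
  hom := biprod.lift biprod.fst (biprod.snd ≫ biprod.snd) ≫ a.hom ≫ biprod.map (𝟙 _) biprod.inr +
    biprod.snd ≫ biprod.fst ≫ biprod.inl ≫ biprod.inr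
  inv := biprod.lift biprod.fst (biprod.snd ≫ biprod.snd) ≫ a.inv ≫ biprod.map (𝟙 _) biprod.inr +
    biprod.snd ≫ biprod.fst ≫ biprod.inl ≫ biprod.inr
  hom_inv_id := by
    have : biprod.map (𝟙 A') (biprod.inr : C' ⟶ B ⊞ C') ≫
        biprod.lift biprod.fst (biprod.snd ≫ biprod.snd) = 𝟙 _ := by ext <;> simp
    simp only [Preadditive.comp_add, Preadditive.add_comp, Category.assoc, reassoc_of% this]
    ext <;> simp [comp_lift_assoc]
  inv_hom_id := by
    have : biprod.map (𝟙 A) (biprod.inr : C ⟶ B ⊞ C) ≫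
        biprod.lift biprod.fst (biprod.snd ≫ biprod.snd) = 𝟙 _ := by ext <;> simp
    simp only [Preadditive.comp_add, Preadditive.add_comp, Category.assoc, reassoc_of% this]
    ext <;> simp [comp_lift_assoc]

/-- The isomorphism `(B ⊞ C) ⊞ A ≅ (B ⊞ C') ⊞ A'` given by an isomorphism `A ⊞ C ≅ A' ⊞ C'`. -/
@[simps]
noncomputable def mapOuter' {A C A' C' : M.Obj} (B : M.Obj) (a : A ⊞ C ≅ A' ⊞ C') :
    (B ⊞ C) ⊞ A ≅ (B ⊞ C') ⊞ A' where
  hom := biprod.lift biprod.snd (biprod.fst ≫ biprod.snd) ≫ a.hom ≫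
      biprod.lift (biprod.snd ≫ biprod.inr) biprod.fst +
    biprod.fst ≫ biprod.fst ≫ biprod.inl ≫ biprod.inl
  inv := biprod.lift biprod.snd (biprod.fst ≫ biprod.snd) ≫ a.inv ≫
      biprod.lift (biprod.snd ≫ biprod.inr) biprod.fst +
    biprod.fst ≫ biprod.fst ≫ biprod.inl ≫ biprod.inl
  hom_inv_id := by
    have : biprod.lift ((biprod.snd : A' ⊞ C' ⟶ _) ≫ (biprod.inr : C' ⟶ B ⊞ C')) biprod.fst ≫
        biprod.lift biprod.snd (biprod.fst ≫ biprod.snd) = 𝟙 _ := by ext <;> simp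
    simp only [Preadditive.comp_add, Preadditive.add_comp, Category.assoc, reassoc_of% this]
    ext <;> simp [comp_lift_assoc]
  inv_hom_id := by
    have : biprod.lift ((biprod.snd : A ⊞ C ⟶ _) ≫ (biprod.inr : C ⟶ B ⊞ C)) biprod.fst ≫
        biprod.lift biprod.snd (biprod.fst ≫ biprod.snd) = 𝟙 _ := by ext <;> simp
    simp only [Preadditive.comp_add, Preadditive.add_comp, Category.assoc, reassoc_of% this]
    ext <;> simp [comp_lift_assoc]

/-- The signed exchange of the last summands of `(B ⊞ C) ⊞ (B' ⊞ C')`. -/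
@[simps]
noncomputable def exchange (B C B' C' : M.Obj) : (B ⊞ C) ⊞ (B' ⊞ C') ≅ (B ⊞ C') ⊞ (B' ⊞ C) where
  hom := biprod.lift (biprod.lift (biprod.fst ≫ biprod.fst) (biprod.snd ≫ biprod.snd))
    (biprod.lift (biprod.snd ≫ biprod.fst) (-(biprod.fst ≫ biprod.snd)))
  inv := biprod.lift (biprod.lift (biprod.fst ≫ biprod.fst) (-(biprod.snd ≫ biprod.snd)))
    (biprod.lift (biprod.snd ≫ biprod.fst) (biprod.fst ≫ biprod.snd))
  hom_inv_id := by ext <;> simp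
  inv_hom_id := by ext <;> simp

theorem conf_biprod_left (A B C : M.Obj) :
    M.Conf (biprod.map (𝟙 A) (biprod.inl : B ⟶ B ⊞ C)) (biprod.snd ≫ biprod.snd) :=
  conf_of_splitting (biprod.map (𝟙 A) biprod.fst) (biprod.inr ≫ biprod.inr) (by ext <;> simp)
    (by simp) (by ext <;> simp) (by ext <;> simp) (by ext <;> simp)

theorem conf_biprod_right (A B C : M.Obj) :
    M.Conf (biprod.map (𝟙 A) (biprod.inr : C ⟶ B ⊞ C)) (biprod.snd ≫ biprod.fst) :=
  conf_of_splitting (biprod.map (𝟙 A) biprod.snd) (biprod.inl ≫ biprod.inr) (by ext <;> simp)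
    (by simp) (by ext <;> simp) (by ext <;> simp) (by ext <;> simp)

/-- The exchange of the last summands of two graded objects, up to isomorphism. -/
noncomputable abbrev exchangeIso {C C' E E' B K H L : M.Obj} (γ : C ≅ B ⊞ K) (γ' : C' ≅ B ⊞ L)
    (ε : E ≅ H ⊞ K) (ε' : E' ≅ H ⊞ L) : C ⊞ E' ≅ C' ⊞ E :=
  biprod.mapIso γ ε' ≪≫ exchange B K H L ≪≫ (biprod.mapIso γ' ε).symm

-- The three unipotent factors multiply to the signed interchange of the copies of `K` in `C` and in
-- `E`, as in the factorization of the matrix `(0 1; -1 0)`. The sign in `exchange` is what makes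
-- this possible.
set_option maxHeartbeats 2000000 in
theorem exchangeIso_eq {C C' D D' E E' B K H L : M.Obj} (γ : C ≅ B ⊞ K) (γ' : C' ≅ B ⊞ L)
    (ε : E ≅ H ⊞ K) (ε' : E' ≅ H ⊞ L) (a : D ⊞ K ≅ D' ⊞ L) :
    biprod.mapIso (Iso.refl C) (biprod.mapIso (Iso.refl D) ε ≪≫ mapOuter H a ≪≫
      (biprod.mapIso (Iso.refl D') ε').symm) ≪≫ mapOuter D' (exchangeIso γ γ' ε ε') =
    lowerUnipotent (-(γ.hom ≫ biprod.snd ≫ biprod.inr ≫ ε.inv ≫ biprod.inr)) ≪≫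
    upperUnipotent (biprod.snd ≫ ε.hom ≫ biprod.snd ≫ biprod.inr ≫ γ.inv) ≪≫
    lowerUnipotent (-(γ.hom ≫ biprod.snd ≫ biprod.inr ≫ ε.inv ≫ biprod.inr)) ≪≫
    (biprod.associator _ _ _).symm ≪≫ biprod.mapIso (biprod.mapIso γ (Iso.refl D) ≪≫
      mapOuter' B a ≪≫ (biprod.mapIso γ' (Iso.refl D')).symm) (Iso.refl E) ≪≫
      biprod.associator _ _ _ := by
  ext1
  refine (cancel_epi (biprod.map γ.inv (biprod.map (𝟙 _) ε.inv))).1 ?_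
  refine (cancel_mono (biprod.map γ'.hom (biprod.map (𝟙 _) ε.hom))).1 ?_
  ext <;> simp [comp_lift_assoc]

/-- Trades `D` and `D'` for `E'` and `E`, with sides interchanged. After adding the identity of `E`,
the left isomorphism is, up to unipotent factors, the vanishing one on `D ⊕ E` followed by the right
one plus the identity of `D'`. -/
theorem cls_exchange (C C' D D' E E' : Ac M) {B K H L : ℤ → M.Obj} (γ : ∀ i, C.X i ≅ B i ⊞ K i)
    (γ' : ∀ i, C'.X i ≅ B i ⊞ L i) (ε : ∀ i, E.X i ≅ H i ⊞ K i) (ε' : ∀ i, E'.X i ≅ H i ⊞ L i)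
    (a : ∀ i, D.X i ⊞ K i ≅ D'.X i ⊞ L i) (hC : SuppIn (inner J) C.X) (hD : SuppIn (inner J) D.X)
    (hE : SuppIn (inner J) E.X) (hD' : SuppIn (inner J) D'.X) (hE' : SuppIn (inner J) E'.X)
    (h : cls J (D.sum E) (D'.sum E') (fun i => biprod.mapIso (Iso.refl _) (ε i) ≪≫
      mapOuter (H i) (a i) ≪≫ (biprod.mapIso (Iso.refl _) (ε' i)).symm) (hD.sum hE).of_inner = 0) :
    cls J (C.sum D) (C'.sum D') (fun i => biprod.mapIso (γ i) (Iso.refl _) ≪≫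
      mapOuter' (B i) (a i) ≪≫ (biprod.mapIso (γ' i) (Iso.refl _)).symm) (hC.sum hD).of_inner =
    cls J (C.sum E') (C'.sum E) (fun i => exchangeIso (γ i) (γ' i) (ε i) (ε' i))
      (hC.sum hE').of_inner := by
  set α : ∀ i, (D.sum E).X i ≅ (D'.sum E').X i := fun i =>
    biprod.mapIso (Iso.refl _) (ε i) ≪≫ mapOuter (H i) (a i) ≪≫
      (biprod.mapIso (Iso.refl _) (ε' i)).symm with hα
  set ν : ∀ i, (C.sum D).X i ≅ (C'.sum D').X i := fun i =>
    biprod.mapIso (γ i) (Iso.refl _) ≪≫ mapOuter' (B i) (a i) ≪≫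
      (biprod.mapIso (γ' i) (Iso.refl _)).symm with hν
  set μ : ∀ i, (C.sum E').X i ≅ (C'.sum E).X i := fun i =>
    exchangeIso (γ i) (γ' i) (ε i) (ε' i) with hμ
  have hCDE := hC.sum (hD.sum hE)
  have hCDE' := hC.sum (hD'.sum hE')
  have e₁ : cls J (C.sum (D.sum E)) (C'.sum (D'.sum E)) (fun i =>
      (biprod.associator _ _ _).symm ≪≫ biprod.mapIso (ν i) (Iso.refl _) ≪≫
        biprod.associator _ _ _) hCDE.of_inner = cls J _ _ ν (hC.sum hD).of_inner := by
    rw [cls_add (hC.sum hD).of_inner hCDE.of_inner hE.of_inner (φ₁ := ν)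
      (φ₃ := fun _ => Iso.refl _) (AcyclicCx.sumMap (𝟙 C) (AcyclicCx.sumInl D E))
      (AcyclicCx.sumSnd C _ ≫ AcyclicCx.sumSnd D E)
      (fun i => conf_biprod_left _ _ _) (AcyclicCx.sumMap (𝟙 C') (AcyclicCx.sumInl D' E))
      (AcyclicCx.sumSnd C' _ ≫ AcyclicCx.sumSnd D' E), cls_self, add_zero]
    · intro i
      ext <;> simp [comp_lift_assoc]
    · intro i
      ext <;> simp
  have e₂ : cls J (C.sum (D'.sum E')) (C'.sum (D'.sum E)) (fun i => mapOuter (D'.X i) (μ i))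
      hCDE'.of_inner = cls J _ _ μ (hC.sum hE').of_inner := by
    rw [cls_add (hC.sum hE').of_inner hCDE'.of_inner hD'.of_inner (φ₁ := μ)
      (φ₃ := fun _ => Iso.refl _) (AcyclicCx.sumMap (𝟙 C) (AcyclicCx.sumInr D' E'))
      (AcyclicCx.sumSnd C _ ≫ AcyclicCx.sumFst D' E')
      (fun i => conf_biprod_right _ _ _) (AcyclicCx.sumMap (𝟙 C') (AcyclicCx.sumInr D' E))
      (AcyclicCx.sumSnd C' _ ≫ AcyclicCx.sumFst D' E), cls_self, add_zero]
    · intro i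
      ext <;> simp [comp_lift_assoc]
    · intro i
      ext <;> simp
  have e₃ : cls J (C.sum (D.sum E)) (C.sum (D'.sum E'))
      (fun i => biprod.mapIso (Iso.refl _) (α i)) hCDE.of_inner = 0 := by
    rw [cls_sum (fun i => Iso.refl (C.X i)) α hC.of_inner (hD.sum hE).of_inner, cls_self, h,
      add_zero]
  have e₄ := cls_trans (X := C.sum (D.sum E)) (Y := C.sum (D'.sum E')) (Z := C'.sum (D'.sum E))
    (fun i => biprod.mapIso (Iso.refl _) (α i))
    (fun i => mapOuter (D'.X i) (μ i)) hCDE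
  rw [e₃, e₂, zero_add] at e₄
  rw [← e₁, ← e₄]
  rw [← cls_lowerUnipotent _ _ hCDE, ← cls_upperUnipotent _ _ hCDE, ← cls_lowerUnipotent _ _ hCDE]
  congr 1
  funext i
  exact (exchangeIso_eq (γ i) (γ' i) (ε i) (ε' i) (a i)).symm

end Exchange

variable {M : ConflationCat.{v, u}} [M.Exact]

/-! ## Complexes which are stably isomorphic as graded objects -/

section Stable

variable {J : Set ℤ}

theorem Bdd.sum {G H : ℤ → M.Obj} (hG : Bdd G) (hH : Bdd H) : Bdd (fun i => G i ⊞ H i) := by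
  obtain ⟨a, c, h⟩ := hG
  obtain ⟨a', c', h'⟩ := hH
  refine ⟨min a a', max c c', fun i hi => (conf_biprod _ _).isZero (h i fun h => hi ?_)
    (h' i fun h => hi ?_)⟩
  · exact ⟨(min_le_left _ _).trans h.1, h.2.trans (le_max_left _ _)⟩
  · exact ⟨(min_le_right _ _).trans h.1, h.2.trans (le_max_right _ _)⟩

theorem lift_map_assoc {A B C D E F : M.Obj} (f : A ⟶ B) (g : A ⟶ C) (h : B ⟶ D) (k : C ⟶ E)
    (l : D ⊞ E ⟶ F) :
    biprod.lift f g ≫ biprod.map h k ≫ l = biprod.lift (f ≫ h) (g ≫ k) ≫ l := by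
  rw [← Category.assoc]
  congr 1
  ext <;> simp

/-- The summands of `A[1] ⊞ (A ⊞ ctr G)` are those of `ctr (A ⊞ G)`. -/
@[simps]
noncomputable def coneIso (A A' G G' : M.Obj) : A' ⊞ (A ⊞ (G ⊞ G')) ≅ (A ⊞ G) ⊞ (A' ⊞ G') where
  hom := biprod.lift (biprod.lift (biprod.snd ≫ biprod.fst) (biprod.snd ≫ biprod.snd ≫ biprod.fst))
    (biprod.lift biprod.fst (biprod.snd ≫ biprod.snd ≫ biprod.snd))
  inv := biprod.lift (biprod.snd ≫ biprod.fst) (biprod.lift (biprod.fst ≫ biprod.fst)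
    (biprod.lift (biprod.fst ≫ biprod.snd) (biprod.snd ≫ biprod.snd)))
  hom_inv_id := by ext <;> simp
  inv_hom_id := by ext <;> simp

/-- After a unipotent correction by the differential of `A`, both sides are extensions of `A[1]` by
`A ⊕ ctr G`, with identities on sub and quotient: `ctr (A ⊕ G)` is the cone of the identity of `A`
plus `ctr G`. -/
theorem cls_coneIso (A : Ac M) {G : ℤ → M.Obj} (hG : Bdd G)
    (hA : SuppIn (inner J) A.X) (hA' : SuppIn (inner J) A.shift.X)
    (hG' : SuppIn (inner J) (ctr G hG).X) :
    cls J (A.shift.sum (A.sum (ctr G hG))) (ctr _ (Bdd.sum A.bounded hG))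
      (fun i => coneIso (A.X i) (A.X (i - 1)) (G i) (G (i - 1)))
      (hA'.sum (hA.sum hG')).of_inner = 0 := by
  rw [← cls_upperUnipotent (X := A.shift) (X' := A.sum (ctr G hG))
    (fun i => biprod.fst ≫ A.d () i (i - 1)) _ (hA'.sum (hA.sum hG'))]
  let f : A.sum (ctr G hG) ⟶ ctr _ (Bdd.sum A.bounded hG) :=
    AcyclicCx.sumFst A _ ≫ toCtr A ≫ ctrMap _ _ (fun i => biprod.inl) +
      AcyclicCx.sumSnd A _ ≫ ctrMap _ _ (fun i => biprod.inr)
  let g : ctr _ (Bdd.sum A.bounded hG) ⟶ A.shift :=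
    ctrMap _ A.bounded (fun i => biprod.fst) ≫ fromCtr A
  rw [cls_add (hA.sum hG').of_inner (hA'.sum (hA.sum hG')).of_inner hA'.of_inner
    (φ₁ := fun _ => Iso.refl _) (φ₃ := fun _ => Iso.refl _) (AcyclicCx.sumInr _ _)
    (AcyclicCx.sumFst _ _) (fun _ => conf_biprod' _ _) f g, cls_self, cls_self, add_zero]
  · intro i
    ext <;> simp [f]
  · intro i
    ext <;> simp [g, lift_map_assoc, biprod.lift_desc]

/-- Under `coneIso` on both sides, the two copies of `a` become the chain isomorphism `ctr (A ⊕ G) ≅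
ctr (A' ⊕ G')` induced by `a`. This is the analogue of `cls_shift` for complexes that are only
stably isomorphic as graded objects. -/
theorem cls_stable (A A' : Ac M) {G G' : ℤ → M.Obj} (hG : Bdd G) (hG' : Bdd G')
    (a : ∀ i, A.X i ⊞ G i ≅ A'.X i ⊞ G' i)
    (sA : SuppIn (inner J) A.X) (sA' : SuppIn (inner J) A'.X) (tA : SuppIn (inner J) A.shift.X)
    (tA' : SuppIn (inner J) A'.shift.X)
    (sG : SuppIn (inner J) (ctr G hG).X) (sG' : SuppIn (inner J) (ctr G' hG').X) :
    cls J (A.shift.sum (A.sum (ctr G hG))) (A'.shift.sum (A'.sum (ctr G' hG')))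
      (fun i => biprod.mapIso (Iso.refl _) (biprod.associator _ _ _).symm ≪≫
      mapOuter _ (a (i - 1)) ≪≫ (biprod.mapIso (Iso.refl _) ((biprod.associator _ _ _).symm ≪≫
        biprod.mapIso (a i).symm (Iso.refl _))).symm)
      (tA.sum (sA.sum sG)).of_inner = 0 := by
  have s := tA.sum (sA.sum sG)
  have s' := tA'.sum (sA'.sum sG')
  have e₁ := cls_trans (X := A.shift.sum (A.sum (ctr G hG)))
    (Y := A'.shift.sum (A'.sum (ctr G' hG'))) (Z := ctr _ (Bdd.sum A'.bounded hG'))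
    (fun i => biprod.mapIso (Iso.refl _) (biprod.associator _ _ _).symm ≪≫
      mapOuter _ (a (i - 1)) ≪≫ (biprod.mapIso (Iso.refl _) ((biprod.associator _ _ _).symm ≪≫
        biprod.mapIso (a i).symm (Iso.refl _))).symm)
    (fun i => coneIso (A'.X i) (A'.X (i - 1)) (G' i) (G' (i - 1))) s
  have e₂ := cls_trans (X := A.shift.sum (A.sum (ctr G hG)))
    (Y := ctr _ (Bdd.sum A.bounded hG)) (Z := ctr _ (Bdd.sum A'.bounded hG'))
    (fun i => coneIso (A.X i) (A.X (i - 1)) (G i) (G (i - 1)))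
    (ctrDiag a a) s
  rw [cls_coneIso A' hG' sA' tA' sG', add_zero] at e₁
  rw [cls_coneIso A hG sA tA sG,
    cls_isoApp (ctrIso (Bdd.sum A.bounded hG) (Bdd.sum A'.bounded hG') a) _
    (fun i => rfl), add_zero] at e₂
  rw [← e₁, ← e₂]
  congr 1
  funext i
  ext1
  apply biprod.hom_ext'
  · ext <;> simp [comp_lift_assoc]
  · ext <;> simp [comp_lift_assoc]

end Stable

variable {M : ConflationCat.{v, u}} [M.Exact]

/-! ## Truncations -/

section Trunc

theorem cutIn_of_not {p : Prop} [Decidable p] (h : ¬ p) (A : M.Obj) : cutIn p A = 0 :=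
  (isZero_cut h A).eq_of_src _ _

theorem cutOut_of_not {p : Prop} [Decidable p] (h : ¬ p) (A : M.Obj) : cutOut p A = 0 :=
  (isZero_cut h A).eq_of_tgt _ _

/-- The isomorphism of an object with the sum of two complementary cut offs. -/
@[simps]
noncomputable def cutSplit {p q : Prop} [Decidable p] [Decidable q] (hpq : q ↔ ¬ p) (A : M.Obj) :
    A ≅ cut p A ⊞ cut q A where
  hom := biprod.lift (cutOut p A) (cutOut q A)
  inv := biprod.desc (cutIn p A) (cutIn q A)
  hom_inv_id := by rw [biprod.lift_desc, cut_total p hpq]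
  inv_hom_id := by
    ext
    · simp
    · simp [cutIn_cutOut_of_not p (fun h => hpq.1 h.2 h.1) A]
    · simp [cutIn_cutOut_of_not q (fun h => hpq.1 h.1 h.2) A]
    · simp

theorem AcyclicCx.conf_m_E_of_eq {ι : Type} {J : Set ℤ} (P : AcyclicCx ι J M) (b : ι) {i j : ℤ}
    (h : i - 1 = j) : M.Conf (P.m b i) (P.E b i j) := by
  subst h
  exact P.conf_m_E b i

/-- The cycles in degree `0`, as a graded object. -/
noncomputable abbrev zeroCycles (X : Ac M) (i : ℤ) : M.Obj := cut (i = 0) (X.Z () i)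

/-- The cokernel of the canonical map to `X` from the truncation `… ⟶ X 2 ⟶ X 1 ⟶ Z 0`; this
truncation is acyclic. -/
noncomputable abbrev truncGE (X : Ac M) : Ac M where
  X i := cut (1 ≤ i) (X.X i) ⊞ zeroCycles X i
  d _ i j := biprod.fst ≫ cutIn _ _ ≫
    biprod.lift (X.d () i j ≫ cutOut _ _) (X.E () i j ≫ cutOut _ _)
  shape _ i j h := by
    rw [X.shape () i j h, X.E_eq_zero () (fun h' => h (by simp; omega))]
    simp
  d_comp_d _ i j k := by
    by_cases hj : 1 ≤ j
    · ext <;> simp [cutOut_cutIn_assoc hj, ← Category.assoc (X.d () i j), X.d_comp_d]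
    · simp [cutIn_of_not hj]
  bounded := by
    obtain ⟨a, c, h⟩ := X.bounded
    refine ⟨min a 0, max c 0, fun i hi => (conf_biprod _ _).isZero (isZero_cut_of _ _
      (h i fun h => hi ⟨(min_le_left _ _).trans h.1, h.2.trans (le_max_left _ _)⟩))
      (isZero_cut (fun h => hi ?_) _)⟩
    subst h
    exact ⟨min_le_right _ _, le_max_right _ _⟩
  support i hi := absurd trivial hi
  acyclic _ := by
    -- The cycles are those of `X` in degrees `≥ 0`. In degree `0` the object itself is `Z 0`, so
    -- the inclusion of the cycles is an isomorphism there.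
    refine ⟨fun i => cut (0 ≤ i) (X.Z () i),
      fun i => biprod.lift (cutIn _ _ ≫ X.m () i ≫ cutOut _ _) (cutIn _ _ ≫ cutOut _ _),
      fun i => biprod.fst ≫ cutIn _ _ ≫ X.E () i (i - 1) ≫ cutOut _ _, ?_⟩
    have key : ∀ i, M.Conf
        (biprod.lift (cutIn (0 ≤ i) (X.Z () i) ≫ X.m () i ≫ cutOut (1 ≤ i) _)
          (cutIn _ _ ≫ cutOut (i = 0) _))
        (biprod.fst ≫ cutIn (1 ≤ i) _ ≫ X.E () i (i - 1) ≫ cutOut (0 ≤ i - 1) _) := by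
      intro i
      rcases lt_trichotomy i 0 with hi | rfl | hi
      · exact conf_zero_zero (isZero_cut (by omega) _) ((conf_biprod _ _).isZero
          (isZero_cut (by omega) _) (isZero_cut (by omega) _)) (isZero_cut (by omega) _) _ _
      · have hz : IsZero (cut (0 ≤ (0 : ℤ) - 1) (X.Z () (0 - 1))) := isZero_cut (by omega) _
        refine conf_iso_zero ⟨biprod.lift (cutIn (0 ≤ (0 : ℤ)) (X.Z () 0) ≫ X.m () 0 ≫
            cutOut (1 ≤ (0 : ℤ)) _) (cutIn _ _ ≫ cutOut ((0 : ℤ) = 0) _),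
          biprod.snd ≫ cutIn _ _ ≫ cutOut _ _, ?_, ?_⟩ hz _
        · simp [cutOut_cutIn_assoc]
        · ext
          · exact (isZero_cut (by omega) _).eq_of_src _ _
          · exact (isZero_cut (by omega) _).eq_of_src _ _
          · exact (isZero_cut (by omega) _).eq_of_tgt _ _
          · simp [cutOut_cutIn_assoc]
      · have h₀ : 0 ≤ i := by omega
        have h₁ : 1 ≤ i := by omega
        have h₂ : 0 ≤ i - 1 := by omega
        refine (X.conf_m_E () i).of_iso
          ⟨cutOut (0 ≤ i) _, cutIn _ _, cutOut_cutIn h₀ _, cutIn_cutOut _ _⟩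
          ⟨cutOut (1 ≤ i) _ ≫ biprod.inl, biprod.fst ≫ cutIn _ _, ?_, ?_⟩
          ⟨cutOut (0 ≤ i - 1) _, cutIn _ _, cutOut_cutIn h₂ _, cutIn_cutOut _ _⟩ ?_ ?_
        · simp [cutOut_cutIn h₁]
        · ext
          · simp
          · simp
          · exact (isZero_cut (by omega) _).eq_of_src _ _
          · exact (isZero_cut (by omega) _).eq_of_src _ _
        · ext
          · simp [cutOut_cutIn_assoc h₀]
          · exact (isZero_cut (by omega) _).eq_of_tgt _ _
        · simp [cutOut_cutIn_assoc h₁]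
    refine ⟨fun i => (key i).w, fun i => (key i).2, fun i => ?_⟩
    by_cases hi : 1 ≤ i
    · have h : 0 ≤ i - 1 := by omega
      ext <;> simp [cutOut_cutIn_assoc h]
    · simp [cutIn_of_not hi]

/-- The inclusion of the cycles of degree `i - 1` into the objects of degree `i - 1`. -/
noncomputable def AcyclicCx.mPrev (X : Ac M) (i j : ℤ) : X.Z () (i - 1) ⟶ X.X j :=
  if h : i - 1 = j then X.m () (i - 1) ≫ eqToHom (by rw [h]) else 0

theorem AcyclicCx.mPrev_d (X : Ac M) (i j k : ℤ) : X.mPrev i j ≫ X.d () j k = 0 := by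
  rw [mPrev]
  split_ifs with h
  · subst h
    simp [X.m_d]
  · simp

omit [M.Exact] in
theorem AcyclicCx.mPrev_self (X : Ac M) (i : ℤ) : X.mPrev i (i - 1) = X.m () (i - 1) := by
  simp [mPrev]

/-- The truncation `Z 0 ⟶ X 0 ⟶ X (-1) ⟶ …`, with `Z 0` in degree `1`. -/
noncomputable abbrev truncLE (X : Ac M) : Ac M where
  X i := zeroCycles X (i - 1) ⊞ cut (i ≤ 0) (X.X i)
  d _ i j := biprod.desc (-(cutIn _ _ ≫ X.mPrev i j)) (cutIn _ _ ≫ X.d () i j) ≫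
    cutOut _ _ ≫ biprod.inr
  shape _ i j h := by
    rw [X.shape () i j h, AcyclicCx.mPrev, dif_neg (fun h' => h (by simp; omega))]
    ext <;> simp
  d_comp_d _ i j k := by
    by_cases hj : j ≤ 0
    · ext
      · simp
      · simp [cutOut_cutIn_assoc hj, ← Category.assoc (X.mPrev i j), X.mPrev_d]
      · simp
      · simp [cutOut_cutIn_assoc hj, ← Category.assoc (X.d () i j), X.d_comp_d]
    · simp [cutOut_of_not hj]
  bounded := by
    obtain ⟨a, c, h⟩ := X.bounded
    refine ⟨min a 0, max c 1, fun i hi => (conf_biprod _ _).isZero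
      (isZero_cut (fun h => hi ?_) _) (isZero_cut_of _ _
      (h i fun h => hi ⟨(min_le_left _ _).trans h.1, h.2.trans (le_max_left _ _)⟩))⟩
    exact ⟨(min_le_right _ _).trans (by omega), le_trans (by omega) (le_max_right _ _)⟩
  support i hi := absurd trivial hi
  acyclic _ := by
    -- The cycles are those of `X` in degrees `≤ 0`. In degree `1` there are none: up to sign, the
    -- object there is mapped identically onto the cycles `Z 0` in degree `0`.
    refine ⟨fun i => cut (i ≤ 0) (X.Z () i),
      fun i => cutIn _ _ ≫ X.m () i ≫ cutOut _ _ ≫ biprod.inr,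
      fun i => biprod.desc (-(cutIn _ _)) (cutIn _ _ ≫ X.E () i (i - 1)) ≫ cutOut _ _, ?_⟩
    have key : ∀ i, M.Conf
        (cutIn (i ≤ 0) _ ≫ X.m () i ≫ cutOut (i ≤ 0) _ ≫
          (biprod.inr : _ ⟶ zeroCycles X (i - 1) ⊞ _))
        (biprod.desc (-(cutIn (i - 1 = 0) _)) (cutIn _ _ ≫ X.E () i (i - 1)) ≫
          cutOut (i - 1 ≤ 0) _) := by
      intro i
      rcases lt_trichotomy i 1 with hi | rfl | hi
      · have h₀ : i ≤ 0 := by omega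
        have h₁ : i - 1 ≤ 0 := by omega
        refine (X.conf_m_E () i).of_iso
          ⟨cutOut (i ≤ 0) _, cutIn _ _, cutOut_cutIn h₀ _, cutIn_cutOut _ _⟩
          ⟨cutOut (i ≤ 0) _ ≫ biprod.inr, biprod.snd ≫ cutIn _ _, ?_, ?_⟩
          ⟨cutOut (i - 1 ≤ 0) _, cutIn _ _, cutOut_cutIn h₁ _, cutIn_cutOut _ _⟩ ?_ ?_
        · simp [cutOut_cutIn h₀]
        · ext
          · exact (isZero_cut (by omega) _).eq_of_src _ _
          · exact (isZero_cut (by omega) _).eq_of_src _ _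
          · simp
          · simp
        · simp [cutOut_cutIn_assoc h₀]
        · simp [cutOut_cutIn_assoc h₀]
      · have hz : IsZero (cut ((1 : ℤ) ≤ 0) (X.Z () 1)) := isZero_cut (by omega) _
        refine conf_zero_iso ⟨biprod.desc (-(cutIn ((1 : ℤ) - 1 = 0) _))
            (cutIn ((1 : ℤ) ≤ 0) _ ≫ X.E () 1 (1 - 1)) ≫ cutOut ((1 : ℤ) - 1 ≤ 0) _,
          -(cutIn _ _ ≫ cutOut _ _ ≫ biprod.inl), ?_, ?_⟩ hz _
        · ext
          · simp [cutOut_cutIn_assoc]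
          · exact (isZero_cut (by omega) _).eq_of_tgt _ _
          · exact (isZero_cut (by omega) _).eq_of_src _ _
          · exact (isZero_cut (by omega) _).eq_of_src _ _
        · simp [cutOut_cutIn_assoc]
      · exact conf_zero_zero (isZero_cut (by omega) _) ((conf_biprod _ _).isZero
          (isZero_cut (by omega) _) (isZero_cut (by omega) _)) (isZero_cut (by omega) _) _ _
    refine ⟨fun i => (key i).w, fun i => (key i).2, fun i => ?_⟩
    dsimp only
    rw [X.mPrev_self]
    by_cases hi : i - 1 ≤ 0
    · ext <;> simp [cutOut_cutIn_assoc hi]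
    · simp [cutOut_of_not hi]

end Trunc

variable {M : ConflationCat.{v, u}} [M.Exact]

/-! ## Functoriality of the truncations -/

section TruncMap

/-- The morphism induced on the cycles in degree `0`. -/
noncomputable abbrev zeroCyclesMap {X Y : Ac M} (f : X ⟶ Y) (i : ℤ) :
    zeroCycles X i ⟶ zeroCycles Y i := cutMap _ (AcyclicCx.ZMap f () i)

theorem bdd_zeroCycles (X : Ac M) : Bdd (zeroCycles X) :=
  ⟨0, 0, fun _ hi => isZero_cut (fun h => hi (by simp [h])) _⟩

/-- The contractible complex on the cycles in degree `0`. -/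
noncomputable abbrev zeroCtr (X : Ac M) : Ac M := ctr (zeroCycles X) (bdd_zeroCycles X)

/-- The morphism induced on the contractible complexes on the cycles in degree `0`. -/
noncomputable abbrev zeroCtrMap {X Y : Ac M} (f : X ⟶ Y) : zeroCtr X ⟶ zeroCtr Y :=
  ctrMap _ _ (zeroCyclesMap f)

theorem cutIn_E_assoc {X Y : Ac M} (f : X ⟶ Y) (i j : ℤ) {T : M.Obj} (x : Y.Z () j ⟶ T) :
    X.E () i j ≫ AcyclicCx.ZMap f () j ≫ x = f.f i ≫ Y.E () i j ≫ x := by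
  rw [← Category.assoc, AcyclicCx.E_ZMap, Category.assoc]

omit [M.Exact] in
theorem AcyclicCx.comm_assoc {ι : Type} {J : Set ℤ} {X Y : AcyclicCx ι J M} (f : X ⟶ Y) (b : ι)
    (i j : ℤ) {T : M.Obj} (x : Y.X j ⟶ T) : f.f i ≫ Y.d b i j ≫ x = X.d b i j ≫ f.f j ≫ x := by
  rw [← Category.assoc, f.comm, Category.assoc]

theorem cutMap_cutIn_assoc (p : Prop) [Decidable p] {A B T : M.Obj} (f : A ⟶ B) (x : B ⟶ T) :
    cutMap p f ≫ cutIn p B ≫ x = cutIn p A ≫ f ≫ x := by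
  rw [← Category.assoc, cutMap_cutIn, Category.assoc]

theorem AcyclicCx.mPrev_f {X Y : Ac M} (f : X ⟶ Y) (i j : ℤ) :
    X.mPrev i j ≫ f.f j = AcyclicCx.ZMap f () (i - 1) ≫ Y.mPrev i j := by
  rw [mPrev, mPrev]
  split_ifs with h
  · subst h
    simp
  · simp

/-- The morphism induced on truncations. -/
@[simps]
noncomputable def truncGEMap {X Y : Ac M} (f : X ⟶ Y) : truncGE X ⟶ truncGE Y where
  f i := biprod.map (cutMap _ (f.f i)) (zeroCyclesMap f i)
  comm _ i j := by
    ext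
    · simp [cutMap_cutIn_assoc, cutOut_cutMap, AcyclicCx.comm_assoc]
    · simp [cutMap_cutIn_assoc, cutOut_cutMap, cutIn_E_assoc]
    · simp
    · simp

/-- The morphism induced on truncations. -/
@[simps]
noncomputable def truncLEMap {X Y : Ac M} (f : X ⟶ Y) : truncLE X ⟶ truncLE Y where
  f i := biprod.map (zeroCyclesMap f (i - 1)) (cutMap _ (f.f i))
  comm _ i j := by
    ext
    · simp
    · simp [cutMap_cutIn_assoc, cutOut_cutMap, ← AcyclicCx.mPrev_f,
        ← Category.assoc (AcyclicCx.ZMap _ _ _)]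
    · simp
    · simp [cutMap_cutIn_assoc, cutOut_cutMap, AcyclicCx.comm_assoc]

variable {X Y W : Ac M} {f : X ⟶ Y} {g : Y ⟶ W}

theorem conf_zeroCyclesMap (h : ∀ i, M.Conf (f.f i) (g.f i)) (i : ℤ) :
    M.Conf (zeroCyclesMap f i) (zeroCyclesMap g i) :=
  Conf.cut _ (AcyclicCx.conf_ZMap ((AcyclicCx.conf_iff f g).2 h).2 () i)

theorem conf_truncGEMap (h : ∀ i, M.Conf (f.f i) (g.f i)) (i : ℤ) :
    M.Conf ((truncGEMap f).f i) ((truncGEMap g).f i) :=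
  ((h i).cut _).biprod (conf_zeroCyclesMap h i)

theorem conf_truncLEMap (h : ∀ i, M.Conf (f.f i) (g.f i)) (i : ℤ) :
    M.Conf ((truncLEMap f).f i) ((truncLEMap g).f i) :=
  (conf_zeroCyclesMap h _).biprod ((h i).cut _)

theorem conf_zeroCtrMap (h : ∀ i, M.Conf (f.f i) (g.f i)) (i : ℤ) :
    M.Conf ((zeroCtrMap f).f i) ((zeroCtrMap g).f i) :=
  (conf_zeroCyclesMap h _).biprod (conf_zeroCyclesMap h _)

/-- The embedding of the truncation into the sum of the complex and a contractible complex. -/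
@[simps]
noncomputable def truncIn (X : Ac M) : truncGE X ⟶ X.sum (zeroCtr X) where
  f i := biprod.desc
    (biprod.lift (cutIn _ _) (cutIn _ _ ≫ X.E () i (i - 1) ≫ cutOut _ _ ≫ biprod.inr))
    (biprod.lift (cutIn _ _ ≫ X.m () i) biprod.inl)
  comm b i j := by
    cases b
    by_cases hj : i - 1 = j
    · subst hj
      apply biprod.hom_ext'
      · rcases lt_trichotomy i 1 with hi | rfl | hi
        · exact (isZero_cut (by omega) _).eq_of_src _ _
        · have h₀ : ¬ 1 ≤ (0 : ℤ) := by omega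
          have h₁ : (0 : ℤ) = 0 := rfl
          ext <;> simp [cutOut_of_not h₀, cutOut_cutIn_assoc h₁]
        · have h₀ : 1 ≤ i - 1 := by omega
          have h₁ : ¬ i - 1 = 0 := by omega
          ext <;> simp [cutOut_of_not h₁, cutOut_cutIn_assoc h₀, cutOut_cutIn h₀]
      · ext <;> simp [X.m_d]
    · have h : ¬ (ComplexShape.down ℤ).Rel i j := fun h => hj (by simp at h; omega)
      ext <;> simp [X.shape () i j h, X.E_eq_zero () hj, hj]

/-- The projection of the sum of the complex and a contractible complex onto the truncation. -/
@[simps]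
noncomputable def truncOut (X : Ac M) : X.sum (zeroCtr X) ⟶ truncLE X where
  f i := biprod.desc
    (biprod.lift (-(X.E () i (i - 1) ≫ cutOut _ _)) (cutOut _ _))
    (biprod.desc (-(cutIn _ _ ≫ X.m () i ≫ cutOut _ _ ≫ biprod.inr)) biprod.inl)
  comm b i j := by
    cases b
    by_cases hj : i - 1 = j
    · subst hj
      simp only [AcyclicCx.mPrev_self]
      rcases lt_trichotomy i 1 with hi | rfl | hi
      · have h₀ : i ≤ 0 := by omega
        have h₁ : ¬ i - 1 = 0 := by omega
        ext <;> simp [cutOut_of_not h₁, cutOut_cutIn_assoc h₀, reassoc_of% X.m_d () i (i - 1)]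
      · have h₀ : (0 : ℤ) = 0 := rfl
        have h₁ : ¬ (1 : ℤ) ≤ 0 := by omega
        have h₂ : ¬ (1 : ℤ) = 0 := by omega
        ext <;> simp [cutOut_of_not h₁, cutIn_of_not h₂, cutOut_cutIn_assoc h₀]
      · have h₀ : ¬ i - 1 ≤ 0 := by omega
        ext <;> simp [cutOut_of_not h₀]
    · have h : ¬ (ComplexShape.down ℤ).Rel i j := fun h => hj (by simp at h; omega)
      ext <;> simp [X.shape () i j h, AcyclicCx.mPrev, hj]

theorem zeroCycles_m (X : Ac M) (i : ℤ) :
    cutIn (i = 0) (X.Z () i) ≫ X.m () i ≫ cutOut (i ≤ 0) (X.X i) ≫ cutIn (i ≤ 0) (X.X i) =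
    cutIn (i = 0) (X.Z () i) ≫ X.m () i := by
  by_cases h : i = 0
  · rw [cutOut_cutIn (by omega), Category.comp_id]
  · simp [cutIn_of_not h]

theorem cutIn_E_cutOut (X : Ac M) (i : ℤ) :
    cutIn (i ≤ 0) (X.X i) ≫ X.E () i (i - 1) ≫ cutOut (i - 1 = 0) _ = 0 := by
  by_cases h : i - 1 = 0
  · rw [cutIn_of_not (by omega), zero_comp]
  · simp [cutOut_of_not h]

end TruncMap

variable {M : ConflationCat.{v, u}} [M.Exact]

/-! ## Shortening binary acyclic complexes -/

section Shorten

variable {J : Set ℤ}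

/-- The exchange of the last summands of `(H ⊞ A) ⊞ B`. -/
@[simps]
noncomputable def swapLast {H H' : M.Obj} (h : H ≅ H') (A B : M.Obj) :
    (H ⊞ A) ⊞ B ≅ (H' ⊞ B) ⊞ A where
  hom := biprod.lift (biprod.lift (biprod.fst ≫ biprod.fst ≫ h.hom) biprod.snd)
    (biprod.fst ≫ biprod.snd)
  inv := biprod.lift (biprod.lift (biprod.fst ≫ biprod.fst ≫ h.inv) biprod.snd)
    (biprod.fst ≫ biprod.snd)
  hom_inv_id := by ext <;> simp
  inv_hom_id := by ext <;> simp

/-- The exchange of the outer summands of `(A ⊞ L) ⊞ B`. -/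
@[simps]
noncomputable def swapOuter {L L' : M.Obj} (l : L ≅ L') (A B : M.Obj) :
    (A ⊞ L) ⊞ B ≅ (B ⊞ L') ⊞ A where
  hom := biprod.lift (biprod.lift biprod.snd (biprod.fst ≫ biprod.snd ≫ l.hom))
    (biprod.fst ≫ biprod.fst)
  inv := biprod.lift (biprod.lift biprod.snd (biprod.fst ≫ biprod.snd ≫ l.inv))
    (biprod.fst ≫ biprod.fst)
  hom_inv_id := by ext <;> simp
  inv_hom_id := by ext <;> simp

/-- The permutation of summands of the sum of two truncations. -/
@[simps]
noncomputable def truncPerm {H L X : M.Obj} (σ : X ≅ H ⊞ L) (A A' B : M.Obj) :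
    ((A' ⊞ L) ⊞ B) ⊞ (H ⊞ A) ≅ (X ⊞ (A ⊞ A')) ⊞ B where
  hom := biprod.lift (biprod.lift (biprod.lift (biprod.snd ≫ biprod.fst)
    (biprod.fst ≫ biprod.fst ≫ biprod.snd) ≫ σ.inv)
    (biprod.lift (biprod.snd ≫ biprod.snd) (biprod.fst ≫ biprod.fst ≫ biprod.fst)))
    (biprod.fst ≫ biprod.snd)
  inv := biprod.lift (biprod.lift (biprod.lift (biprod.fst ≫ biprod.snd ≫ biprod.snd)
    (biprod.fst ≫ biprod.fst ≫ σ.hom ≫ biprod.snd)) biprod.snd)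
    (biprod.lift (biprod.fst ≫ biprod.fst ≫ σ.hom ≫ biprod.fst)
      (biprod.fst ≫ biprod.snd ≫ biprod.fst))
  hom_inv_id := by ext <;> simp [comp_lift_assoc]
  inv_hom_id := by
    have : biprod.lift (σ.hom ≫ biprod.fst) (σ.hom ≫ biprod.snd) = σ.hom := by ext <;> simp
    ext <;> simp [comp_lift_assoc, this]

/-- The truncation below of `X` and the contractible complex of `Y`, shifted. -/
noncomputable abbrev lower (X Y : Ac M) : Ac M := ((truncLE X).sum (zeroCtr Y)).shift

/-- The truncation above of `X` and the contractible complex of `Y`. -/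
noncomputable abbrev upper (X Y : Ac M) : Ac M := (truncGE X).sum (zeroCtr Y)

variable (X Y : Ac M)

noncomputable abbrev truncPermIso (i : ℤ) :
    ((lower X Y).sum (truncGE X).shift).X i ≅ ((X.sum (zeroCtr X)).sum (zeroCtr Y)).shift.X i :=
  truncPerm (cutSplit (by omega : i - 1 ≤ 0 ↔ ¬ 1 ≤ i - 1) (X.X (i - 1))) _ _ _

/-- A unipotent correction turns the permutation of summands into a morphism between two extensions:
the split one, and the shift of `truncGE X ⟶ X ⊕ zeroCtr X ⟶ truncLE X` with `zeroCtr Y` added. Both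
ends are identities. -/
theorem cls_truncPerm (h : SuppIn (inner J) ((lower X Y).sum (truncGE X).shift).X)
    (h₁ : SuppIn (inner J) (lower X Y).X) (h₂ : SuppIn (inner J) (truncGE X).shift.X) :
    cls J _ _ (truncPermIso X Y) h.of_inner = 0 := by
  rw [← cls_upperUnipotent (X := lower X Y) (X' := (truncGE X).shift)
    (fun i => biprod.lift (biprod.lift
      (biprod.fst ≫ cutIn _ _ ≫ X.E () (i - 1) (i - 1 - 1) ≫ cutOut _ _)
      (biprod.snd ≫ cutIn _ _ ≫ X.m () (i - 1) ≫ cutOut _ _)) 0) _ h]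
  rw [cls_add h₂.of_inner h.of_inner h₁.of_inner
    (φ₁ := fun _ => Iso.refl _) (φ₃ := fun _ => Iso.refl _) (AcyclicCx.sumInr _ _)
    (AcyclicCx.sumFst _ _) (fun _ => conf_biprod' _ _)
    (AcyclicCx.shiftMap (truncIn X ≫ AcyclicCx.sumInl _ _))
    (AcyclicCx.shiftMap (AcyclicCx.sumMap (truncOut X) (𝟙 (zeroCtr Y)))), cls_self, cls_self,
    add_zero]
  · intro i
    ext <;> simp [comp_lift_assoc, zeroCycles_m]
  · intro i
    have h₁ := cutIn_E_cutOut X (i - 1)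
    have h₂ : cutIn (1 ≤ i - 1) (X.X (i - 1)) ≫ cutOut (i - 1 ≤ 0) _ = 0 :=
      cutIn_cutOut_of_not _ (by omega) _
    ext <;> simp [comp_lift_assoc, h₁, h₂]

theorem conf_biprod_assoc (A B C : M.Obj) :
    M.Conf ((biprod.inl : A ⟶ A ⊞ B) ≫ (biprod.inl : _ ⟶ _ ⊞ C)) (biprod.map biprod.snd (𝟙 C)) :=
  conf_of_splitting (biprod.fst ≫ biprod.fst) (biprod.map biprod.inr (𝟙 C)) (by simp)
    (by ext <;> simp) (by simp) (by ext <;> simp) (by ext <;> simp)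

/-- On the quotient by `X`, respectively `Y`, only the flip of `A ⊕ B` remains, which is a chain
isomorphism. -/
theorem cls_swapLast {X Y : Ac M} (A B : Ac M) (φ : ∀ i, X.X i ≅ Y.X i) (h : SuppIn J X.shift.X)
    (hA : SuppIn J A.shift.X) (hB : SuppIn J B.shift.X) :
    cls J ((X.sum A).sum B).shift ((Y.sum B).sum A).shift
      (fun i => swapLast (φ (i - 1)) (A.X (i - 1)) (B.X (i - 1))) ((h.sum hA).sum hB) =
    cls J X.shift Y.shift (fun i => φ (i - 1)) h := by
  rw [cls_add h ((h.sum hA).sum hB) (hA.sum hB) (φ₁ := fun i => φ (i - 1))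
    (X₃ := (A.sum B).shift) (Y₃ := (A.sum B).shift)
    (φ₃ := fun _ => Iso.refl _) (AcyclicCx.shiftMap (AcyclicCx.sumInl X A ≫ AcyclicCx.sumInl _ B))
    (AcyclicCx.shiftMap (AcyclicCx.sumMap (AcyclicCx.sumSnd X A) (𝟙 B)))
    (fun _ => conf_biprod_assoc _ _ _)
    (AcyclicCx.shiftMap (AcyclicCx.sumInl Y B ≫ AcyclicCx.sumInl _ A))
    (AcyclicCx.shiftMap (AcyclicCx.sumMap (AcyclicCx.sumSnd Y B) (𝟙 A) ≫ (sumBraid B A).hom)),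
    cls_self, add_zero]
  · intro i
    ext <;> simp
  · intro i
    ext <;> simp [sumBraid]

/-- The exchange of the last two summands of `A ⊞ (B ⊞ C)`. -/
@[simps]
noncomputable def rotateLast (A B C : M.Obj) : A ⊞ (B ⊞ C) ≅ (A ⊞ C) ⊞ B where
  hom := biprod.lift (biprod.lift biprod.fst (biprod.snd ≫ biprod.snd)) (biprod.snd ≫ biprod.fst)
  inv := biprod.lift (biprod.fst ≫ biprod.fst) (biprod.lift biprod.snd (biprod.fst ≫ biprod.snd))
  hom_inv_id := by ext <;> simp
  inv_hom_id := by ext <;> simp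

/-- Decomposing by truncation and then exchanging cycles agrees with applying `φ` first and
decomposing afterwards. In the application `H` and `L` are the parts of `X` above and below the cut,
and `A`, `A'`, `B`, `B'` are cycles. -/
theorem truncPerm_swapLast {H L X H' L' Y : M.Obj} (σ : X ≅ H ⊞ L) (τ : Y ≅ H' ⊞ L') (h : H ≅ H')
    (l : L ≅ L') (φ : X ≅ Y) (hφ : φ.hom ≫ τ.hom = σ.hom ≫ biprod.map h.hom l.hom)
    (A A' B B' : M.Obj) :
    (biprod.mapIso (rotateLast (A' ⊞ L) B B') (Iso.refl (H ⊞ A)) ≪≫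
      mapOuter' ((A' ⊞ L) ⊞ B') (swapLast h A B) ≪≫ (biprod.mapIso (rotateLast (B' ⊞ L') A A' ≪≫
        biprod.mapIso (swapOuter l A' B').symm (Iso.refl A)) (Iso.refl (H' ⊞ B))).symm) ≪≫
      truncPerm τ B B' (A ⊞ A') = truncPerm σ A A' (B ⊞ B') ≪≫ swapLast φ _ _ := by
  have h₁ : h.hom ≫ biprod.inl ≫ τ.inv = biprod.inl ≫ σ.inv ≫ φ.hom := by
    rw [← cancel_mono τ.hom]
    simp [hφ]
  have h₂ : l.hom ≫ biprod.inr ≫ τ.inv = biprod.inr ≫ σ.inv ≫ φ.hom := by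
    rw [← cancel_mono τ.hom]
    simp [hφ]
  ext <;> simp [comp_lift_assoc, h₁, h₂]

end Shorten

variable {M : ConflationCat.{v, u}} [M.Exact]

/-! ### Supports of the truncations -/

section Supports

variable {X : Ac M} {n m : ℤ}

theorem suppIn_zeroCycles (X : Ac M) (hm : 0 ≤ m) : SuppIn (Set.Icc 0 m) (zeroCycles X) :=
  fun i hi => isZero_cut (fun h => hi (by subst h; exact ⟨le_rfl, hm⟩)) _

theorem suppIn_zeroCtr (X : Ac M) (hm : 1 ≤ m) : SuppIn (Set.Icc 0 m) (zeroCtr X).X :=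
  fun i hi => (conf_biprod _ _).isZero
    (isZero_cut (fun h => hi ⟨by omega, by omega⟩) _)
    (isZero_cut (fun h => hi ⟨by omega, by omega⟩) _)

theorem suppIn_truncGE (h : SuppIn (Set.Icc 0 n) X.shift.X) (hn : n - 1 ≤ m) (hm : 0 ≤ m) :
    SuppIn (Set.Icc 0 m) (truncGE X).X := by
  refine fun i hi => (conf_biprod _ _).isZero ?_ (suppIn_zeroCycles X hm i hi)
  by_cases h₁ : 1 ≤ i
  · have := h (i + 1) (fun h => hi ⟨by omega, by have := h.2; omega⟩)
    dsimp at this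
    rw [add_sub_cancel_right] at this
    exact isZero_cut_of _ _ this
  · exact isZero_cut h₁ _

theorem suppIn_truncGE_shift (h : SuppIn (Set.Icc 0 n) X.shift.X) (hn : 1 ≤ n) :
    SuppIn (Set.Icc 0 n) (truncGE X).shift.X :=
  fun i hi => (conf_biprod _ _).isZero (isZero_cut_of _ _ (h i hi))
    (isZero_cut (fun h => hi ⟨by omega, by omega⟩) _)

theorem suppIn_truncLE_shift (h : SuppIn (Set.Icc 0 n) X.shift.X) (hm : 2 ≤ m) :
    SuppIn (Set.Icc 0 m) (truncLE X).shift.X := by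
  refine fun i hi => (conf_biprod _ _).isZero (isZero_cut (fun h => hi ⟨by omega, by omega⟩) _) ?_
  by_cases h₁ : i - 1 ≤ 0
  · exact isZero_cut_of _ _ (h i fun h => hi ⟨h.1, by omega⟩)
  · exact isZero_cut h₁ _

/-- Unshifted, `truncLE X` lives in degrees `-1, 0, 1` and `zeroCtr Y` in degrees `0, 1`; hence the
bound `2`, which no shortening can improve. -/
theorem suppIn_lower (h : SuppIn (Set.Icc 0 n) X.shift.X) (Y : Ac M) (hm : 2 ≤ m) :
    SuppIn (Set.Icc 0 m) (lower X Y).X := by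
  refine fun i hi => (conf_biprod _ _).isZero (suppIn_truncLE_shift h hm i hi)
    (suppIn_zeroCtr Y (m := m - 1) (by omega) (i - 1) fun h => hi ?_)
  have h₁ := h.1
  have h₂ := h.2
  exact ⟨by omega, by omega⟩

/-- Here the degree is gained: `truncGE X` is not shifted and ends in degree `n - 1`. -/
theorem suppIn_upper (h : SuppIn (Set.Icc 0 n) X.shift.X) (Y : Ac M) (hn : n - 1 ≤ m)
    (hm : 1 ≤ m) : SuppIn (Set.Icc 0 m) (upper X Y).X :=
  (suppIn_truncGE h hn (by omega)).sum (suppIn_zeroCtr Y hm)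

end Supports

/-! ### The shortening of a pair of complexes -/

section Shorten

variable {J : Set ℤ} {X Y : Ac M} (φ : ∀ i, X.X i ≅ Y.X i)

/-- The truncations above of complexes with isomorphic graded objects are stably isomorphic. -/
noncomputable abbrev truncGEIso (i : ℤ) :
    (truncGE X).X i ⊞ zeroCycles Y i ≅ (truncGE Y).X i ⊞ zeroCycles X i :=
  swapLast (cutIso _ (φ i)) _ _

/-- The truncations below of complexes with isomorphic graded objects are stably isomorphic. -/
noncomputable abbrev truncLEIso (i : ℤ) :
    (truncLE X).X i ⊞ zeroCycles Y (i - 1) ≅ (truncLE Y).X i ⊞ zeroCycles X (i - 1) :=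
  swapOuter (cutIso _ (φ i)) _ _

/-- The isomorphism of the graded objects underlying the two complexes which make up the
shortening of a binary complex. -/
noncomputable abbrev shortenIso (i : ℤ) :
    ((lower X Y).sum (upper Y X)).X i ≅ ((lower Y X).sum (upper X Y)).X i :=
  exchangeIso (rotateLast _ _ _)
    (rotateLast _ _ _ ≪≫ biprod.mapIso (truncLEIso φ (i - 1)).symm (Iso.refl _))
    (biprod.associator _ _ _).symm
    ((biprod.associator _ _ _).symm ≪≫ biprod.mapIso (truncGEIso φ i).symm (Iso.refl _))

/-- `X[1]` plus contractible complexes decomposes into `lower X Y` and `(truncGE X)[1]`. By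
`cls_stable`, `cls_exchange` may replace the latter, which can reach degree `n`, by `upper`, with
the roles of `X` and `Y` interchanged. -/
theorem cls_shorten {n : ℤ} (hn : 2 ≤ n) (hX : SuppIn (Set.Icc 0 n) X.shift.X)
    (hY : SuppIn (Set.Icc 0 n) Y.shift.X) (hJ : Set.Icc 0 n ⊆ inner J)
    (h : SuppIn J ((lower X Y).sum (upper Y X)).X) (h' : SuppIn J X.shift.X) :
    cls J X.shift Y.shift (fun i => φ (i - 1)) h' =
      cls J ((lower X Y).sum (upper Y X)) ((lower Y X).sum (upper X Y)) (shortenIso φ) h := by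
  have sC := (suppIn_lower hX Y hn).mono hJ
  have sC' := (suppIn_lower hY X hn).mono hJ
  have sD := (suppIn_truncGE_shift hX (by omega)).mono hJ
  have sD' := (suppIn_truncGE_shift hY (by omega)).mono hJ
  have sE := (suppIn_upper hX Y (m := n) (by omega) (by omega)).mono hJ
  have sE' := (suppIn_upper hY X (m := n) (by omega) (by omega)).mono hJ
  rw [← cls_exchange (lower X Y) (lower Y X) (truncGE X).shift (truncGE Y).shift (upper X Y)
    (upper Y X) (fun i => rotateLast _ _ _)
    (fun i => rotateLast _ _ _ ≪≫ biprod.mapIso (truncLEIso φ (i - 1)).symm (Iso.refl _))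
    (fun i => (biprod.associator _ _ _).symm)
    (fun i => (biprod.associator _ _ _).symm ≪≫ biprod.mapIso (truncGEIso φ i).symm (Iso.refl _))
    (fun i => truncGEIso φ (i - 1)) sC sD sE sD' sE'
    (cls_stable (truncGE X) (truncGE Y) (bdd_zeroCycles Y) (bdd_zeroCycles X) (truncGEIso φ)
      ((suppIn_truncGE hX (m := n) (by omega) (by omega)).mono hJ)
      ((suppIn_truncGE hY (m := n) (by omega) (by omega)).mono hJ) sD sD'
      ((suppIn_zeroCtr Y (by omega : 1 ≤ n)).mono hJ)
      ((suppIn_zeroCtr X (by omega : 1 ≤ n)).mono hJ))]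
  have s := sC.sum sD
  -- One isomorphism is factored in two ways: through the decomposed `Y`, and through the
  -- undecomposed `X` followed by `φ`. The two decompositions contribute zero.
  have e₁ := cls_trans (X := (lower X Y).sum (truncGE X).shift)
    (Y := (lower Y X).sum (truncGE Y).shift) (Z := ((Y.sum (zeroCtr Y)).sum (zeroCtr X)).shift)
    (fun i => biprod.mapIso (rotateLast _ _ _) (Iso.refl _) ≪≫ mapOuter' _ (truncGEIso φ (i - 1)) ≪≫
      (biprod.mapIso (rotateLast _ _ _ ≪≫ biprod.mapIso (truncLEIso φ (i - 1)).symm (Iso.refl _))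
      (Iso.refl _)).symm) (truncPermIso Y X) s
  have e₂ := cls_trans (X := (lower X Y).sum (truncGE X).shift)
    (Y := ((X.sum (zeroCtr X)).sum (zeroCtr Y)).shift)
    (Z := ((Y.sum (zeroCtr Y)).sum (zeroCtr X)).shift) (truncPermIso X Y)
    (fun i => swapLast (φ (i - 1)) _ _) s
  rw [cls_truncPerm Y X (sC'.sum sD') sC' sD', add_zero] at e₁
  have zJ : ∀ X : Ac M, SuppIn J (zeroCtr X).shift.X := fun X i hi =>
    suppIn_zeroCtr X (m := n - 1) (by omega) (i - 1) fun h => hi (hJ ⟨by have := h.1; omega,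
      by have := h.2; omega⟩).1
  rw [cls_truncPerm X Y s sC sD, zero_add, cls_swapLast (zeroCtr X) (zeroCtr Y) φ h' (zJ _) (zJ _)]
    at e₂
  rw [← e₁, ← e₂]
  congr 1
  funext i
  refine (truncPerm_swapLast _ _ _ _ _ ?_ _ _ _ _).symm
  ext <;> simp [cutOut_cutMap]

end Shorten

variable {M : ConflationCat.{v, u}}

/-! ## The shortening as an additive function -/

/-- The same complex with another bound for its support. -/
abbrev AcyclicCx.restrict {ι : Type} {J : Set ℤ} (P : AcyclicCx ι J M) (J' : Set ℤ)
    (h : SuppIn J' P.X) : AcyclicCx ι J' M :=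
  { P with support := h }

/-- The homomorphism induced by an enlargement of the support. -/
def DiagQuot.incl {J J' : Set ℤ} (hJ : J ⊆ J') (M : ConflationCat.{v, u}) :
    DiagQuot J M →+ DiagQuot J' M :=
  QuotientAddGroup.map _ _ (K0.map (enlarge Bool hJ M)) <| by
    rintro _ ⟨x, rfl⟩
    refine AddSubgroup.mem_comap.2 ⟨K0.map (enlarge Unit hJ M) x, ?_⟩
    rw [← AddMonoidHom.comp_apply, ← AddMonoidHom.comp_apply, ← K0.map_comp, ← K0.map_comp]
    rfl

theorem DiagQuot.incl_incl {J J' J'' : Set ℤ} (hJ : J ⊆ J') (hJ' : J' ⊆ J'') (x : DiagQuot J M) :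
    DiagQuot.incl hJ' M (DiagQuot.incl hJ M x) = DiagQuot.incl (hJ.trans hJ') M x := by
  obtain ⟨x, rfl⟩ := QuotientAddGroup.mk_surjective x
  induction x using QuotientAddGroup.induction_on with
  | H x =>
    induction x using FreeAbelianGroup.induction_on with
    | zero => simp
    | of P => rfl
    | neg P => rfl
    | add x y hx hy =>
      rw [QuotientAddGroup.mk_add, QuotientAddGroup.mk_add, map_add, map_add, map_add, hx, hy]

variable [M.Exact]

/-- The complex for one of the differentials, shifted down. -/
noncomputable abbrev AcyclicCx.side {J : Set ℤ} (P : AcyclicCx Bool J M) (b : Bool) : Ac M where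
  X i := P.X (i + 1)
  d _ i j := -P.d b (i + 1) (j + 1)
  shape _ i j h := by
    rw [P.shape b _ _ (fun h' => h (by simp at h' ⊢; omega)), neg_zero]
  d_comp_d _ i j k := by simp [P.d_comp_d]
  bounded := by
    obtain ⟨a, c, h⟩ := P.bounded
    exact ⟨a - 1, c - 1, fun i hi => h _ fun hi' => hi
      ⟨by have := hi'.1; omega, by have := hi'.2; omega⟩⟩
  support i hi := absurd trivial hi
  acyclic _ := ⟨fun i => P.Z b (i + 1), fun i => P.m b (i + 1),
    fun i => - P.E b (i + 1) (i - 1 + 1), fun i => by simp,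
    fun i => (P.conf_m_E_of_eq b (by ring)).neg_right.2, fun i => by simp⟩

/-- The morphism induced on the complexes for one of the differentials. -/
@[simps]
noncomputable def AcyclicCx.sideMap {J : Set ℤ} {P Q : AcyclicCx Bool J M} (f : P ⟶ Q) (b : Bool) :
    P.side b ⟶ Q.side b where
  f i := f.f (i + 1)
  comm _ i j := by simp [f.comm]

omit [M.Exact] in
theorem AcyclicCx.d_eqToHom {ι : Type} {J : Set ℤ} (P : AcyclicCx ι J M) (b : ι) {i i' j j' : ℤ}
    (hi : i = i') (hj : j = j') (h : P.X i = P.X i') (h' : P.X j = P.X j') :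
    eqToHom h ≫ P.d b i' j' = P.d b i j ≫ eqToHom h' := by
  subst hi hj
  simp

/-- `side` shifts down so that the cut at `Z 0` takes place at the degree `1` cycles of `P`. The
signs of the two shifts cancel, and `i - 1 + 1` is brought back to `i` by `eqToHom`. -/
theorem DiagQuot.of_restrict {J J' : Set ℤ} (P : AcyclicCx Bool J M) (h : SuppIn J' P.X)
    (h' : SuppIn J' (P.side true).shift.X) :
    DiagQuot.of (P.restrict J' h) =
      cls J' (P.side true).shift (P.side false).shift (fun _ => Iso.refl _) h' := by
  have hX : ∀ i, P.X (i - 1 + 1) = P.X i := fun i => congrArg P.X (sub_add_cancel i 1)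
  refine (DiagQuot.of_iso (AcyclicCx.isoMk
    (P := bin J' (P.side true).shift (P.side false).shift (fun _ => Iso.refl _) h')
    (Q := P.restrict J' h) { f := fun i => eqToHom (hX i), comm := fun b i j => ?_ }
    (fun i => eqToHom (hX i).symm)
    (fun i => eqToHom_trans (hX i) (hX i).symm) (fun i => eqToHom_trans (hX i).symm (hX i)))).symm
  have hd := fun b => P.d_eqToHom b (sub_add_cancel i 1) (sub_add_cancel j 1) (hX i) (hX j)
  cases b
  · simpa using hd false
  · simpa using hd true

/-- The shortening of a binary acyclic complex. -/
noncomputable abbrev AcyclicCx.shorten {J : Set ℤ} (P : AcyclicCx Bool J M) (J' : Set ℤ)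
    (h : SuppIn J' ((lower (P.side true) (P.side false)).sum
      (upper (P.side false) (P.side true))).X) : AcyclicCx Bool J' M :=
  bin J' ((lower (P.side true) (P.side false)).sum (upper (P.side false) (P.side true)))
    ((lower (P.side false) (P.side true)).sum (upper (P.side true) (P.side false)))
    (shortenIso (X := P.side true) (Y := P.side false) fun _ => Iso.refl _) h

theorem AcyclicCx.suppIn_side {J : Set ℤ} {n : ℤ} (P : AcyclicCx Bool J M)
    (h : SuppIn (Set.Icc 0 n) P.X) (b : Bool) : SuppIn (Set.Icc 0 n) (P.side b).shift.X :=
  fun i hi => h _ fun h => hi ⟨by have := h.1; omega, by have := h.2; omega⟩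

theorem AcyclicCx.suppIn_shorten {J : Set ℤ} {n m : ℤ} (P : AcyclicCx Bool J M)
    (h : SuppIn (Set.Icc 0 n) P.X) (hn : n - 1 ≤ m) (hm : 2 ≤ m) :
    SuppIn (Set.Icc 0 m) ((lower (P.side true) (P.side false)).sum
      (upper (P.side false) (P.side true))).X :=
  (suppIn_lower (P.suppIn_side h true) _ hm).sum
    (suppIn_upper (P.suppIn_side h false) _ hn (by omega))

theorem DiagQuot.of_shorten {J J' : Set ℤ} {n : ℤ} (P : AcyclicCx Bool J M) (hn : 2 ≤ n)
    (hP : SuppIn (Set.Icc 0 n) P.X) (hJ : Set.Icc 0 n ⊆ inner J') (h : SuppIn J' P.X)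
    (h' : SuppIn J' ((lower (P.side true) (P.side false)).sum
      (upper (P.side false) (P.side true))).X) :
    DiagQuot.of (P.restrict J' h) = DiagQuot.of (P.shorten J' h') := by
  have s : SuppIn J' (P.side true).shift.X :=
    (P.suppIn_side hP true).mono fun i hi => (hJ hi).1
  rw [DiagQuot.of_restrict P h s]
  exact cls_shorten (X := P.side true) (Y := P.side false) (fun _ => Iso.refl _) hn
    (P.suppIn_side hP true) (P.suppIn_side hP false) hJ h' s

theorem exchangeIso_naturality {C C' E E' B K H L D D' F F' B₁ K₁ H₁ L₁ : M.Obj}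
    {γ : C ≅ B ⊞ K} {γ' : C' ≅ B ⊞ L} {ε : E ≅ H ⊞ K} {ε' : E' ≅ H ⊞ L}
    {δ : D ≅ B₁ ⊞ K₁} {δ' : D' ≅ B₁ ⊞ L₁} {ζ : F ≅ H₁ ⊞ K₁} {ζ' : F' ≅ H₁ ⊞ L₁}
    {c : C ⟶ D} {c' : C' ⟶ D'} {e : E ⟶ F} {e' : E' ⟶ F'} {b : B ⟶ B₁} {k : K ⟶ K₁}
    {h : H ⟶ H₁} {l : L ⟶ L₁} (h₁ : c ≫ δ.hom = γ.hom ≫ biprod.map b k)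
    (h₂ : c' ≫ δ'.hom = γ'.hom ≫ biprod.map b l) (h₃ : e ≫ ζ.hom = ε.hom ≫ biprod.map h k)
    (h₄ : e' ≫ ζ'.hom = ε'.hom ≫ biprod.map h l) :
    biprod.map c e' ≫ (exchangeIso δ δ' ζ ζ').hom =
      (exchangeIso γ γ' ε ε').hom ≫ biprod.map c' e := by
  have e₁ : biprod.map c e' ≫ biprod.map δ.hom ζ'.hom =
      biprod.map γ.hom ε'.hom ≫ biprod.map (biprod.map b k) (biprod.map h l) := by
    ext <;> simp [h₁, h₄]
  have e₂ : biprod.map (biprod.map b l) (biprod.map h k) ≫ biprod.map δ'.inv ζ.inv =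
      biprod.map γ'.inv ε.inv ≫ biprod.map c' e := by
    have h₅ : biprod.map b l ≫ δ'.inv = γ'.inv ≫ c' := by
      rw [← cancel_mono δ'.hom, Category.assoc, Category.assoc, h₂]
      simp
    have h₆ : biprod.map h k ≫ ζ.inv = ε.inv ≫ e := by
      rw [← cancel_mono ζ.hom, Category.assoc, Category.assoc, h₃]
      simp
    apply biprod.hom_ext' <;> simp only [biprod.inl_map_assoc, biprod.inr_map_assoc, biprod.inl_map,
      biprod.inr_map, reassoc_of% h₅, reassoc_of% h₆]
  have e₃ : biprod.map (biprod.map b k) (biprod.map h l) ≫ (exchange _ _ _ _).hom =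
      (exchange _ _ _ _).hom ≫ biprod.map (biprod.map b l) (biprod.map h k) := by
    ext <;> simp
  simp only [exchangeIso, Iso.trans_hom, Iso.symm_hom, biprod.mapIso_hom, biprod.mapIso_inv,
    Category.assoc]
  rw [reassoc_of% e₁, reassoc_of% e₃, e₂]

/-- The morphism induced on `lower`. -/
noncomputable abbrev lowerMap {X Y X' Y' : Ac M} (f : X ⟶ X') (g : Y ⟶ Y') :
    lower X Y ⟶ lower X' Y' :=
  AcyclicCx.shiftMap (AcyclicCx.sumMap (truncLEMap f) (zeroCtrMap g))

/-- The morphism induced on `upper`. -/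
noncomputable abbrev upperMap {X Y X' Y' : Ac M} (f : X ⟶ X') (g : Y ⟶ Y') :
    upper X Y ⟶ upper X' Y' :=
  AcyclicCx.sumMap (truncGEMap f) (zeroCtrMap g)

/-- This makes the shortening functorial, without which it would not respect the relations of the
class group. -/
theorem shortenIso_naturality {X X' Y Y' : Ac M} {φ : ∀ i, X.X i ≅ Y.X i}
    {φ' : ∀ i, X'.X i ≅ Y'.X i} (f : X ⟶ X') (g : Y ⟶ Y')
    (h : ∀ i, f.f i ≫ (φ' i).hom = (φ i).hom ≫ g.f i) (i : ℤ) :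
    (AcyclicCx.sumMap (lowerMap f g) (upperMap g f)).f i ≫ (shortenIso φ' i).hom =
      (shortenIso φ i).hom ≫ (AcyclicCx.sumMap (lowerMap g f) (upperMap f g)).f i := by
  have h' : ∀ i, g.f i ≫ (φ' i).inv = (φ i).inv ≫ f.f i := fun i => by
    rw [Iso.comp_inv_eq, Category.assoc, h, Iso.inv_hom_id_assoc]
  have key : ∀ (p : Prop) [Decidable p] (i : ℤ),
      cutMap p (g.f i) ≫ cutMap p (φ' i).inv = cutMap p (φ i).inv ≫ cutMap p (f.f i) :=
    fun p _ i => by rw [← cutMap_comp, ← cutMap_comp, h']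
  refine exchangeIso_naturality
    (b := biprod.map ((truncLEMap f).f (i - 1)) (zeroCyclesMap g (i - 1 - 1)))
    (k := zeroCyclesMap g (i - 1)) (l := zeroCyclesMap f (i - 1))
    (h := biprod.map ((truncGEMap f).f i) (zeroCyclesMap g i)) ?_ ?_ ?_ ?_
  · ext <;> simp
  · ext <;> simp [comp_lift_assoc, key]
  · ext <;> simp
  · ext <;> simp [comp_lift_assoc, key]

/-- The morphism induced on shortenings. -/
noncomputable abbrev AcyclicCx.shortenMap {J : Set ℤ} {P Q : AcyclicCx Bool J M} (f : P ⟶ Q)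
    (J' : Set ℤ) (h) (h') : P.shorten J' h ⟶ Q.shorten J' h' :=
  binMap (AcyclicCx.sumMap (lowerMap (sideMap f true) (sideMap f false))
      (upperMap (sideMap f false) (sideMap f true)))
    (AcyclicCx.sumMap (lowerMap (sideMap f false) (sideMap f true))
      (upperMap (sideMap f true) (sideMap f false)))
    (shortenIso_naturality _ _ fun _ => by simp)

/-- Everything in the shortening is a sum of objects of the complex and of cycles, so this comes
down to the exactness of the cycle functors, `conf_ZMap`. -/
theorem AcyclicCx.conf_shortenMap {J : Set ℤ} {P Q R : AcyclicCx Bool J M} {f : P ⟶ Q} {g : Q ⟶ R}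
    (h : ∀ i, M.Conf (f.f i) (g.f i)) (J' : Set ℤ) (h₁) (h₂) (h₃) (i : ℤ) :
    M.Conf ((shortenMap f J' h₁ h₂).f i) ((shortenMap g J' h₂ h₃).f i) := by
  have h' : ∀ b i, M.Conf ((sideMap f b).f i) ((sideMap g b).f i) := fun b i => h (i + 1)
  exact ((conf_truncLEMap (h' true) _).biprod (conf_zeroCtrMap (h' false) _)).biprod
    ((conf_truncGEMap (h' false) _).biprod (conf_zeroCtrMap (h' true) _))

variable {M : ConflationCat.{v, u}} [M.Exact]

/-! ## Reduction of the support -/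

theorem Icc_zero_subset_inner {n m : ℤ} (h : n + 1 ≤ m) : Set.Icc 0 n ⊆ inner (Set.Icc 0 m) :=
  fun i hi => ⟨⟨hi.1, by have := hi.2; omega⟩, ⟨by have := hi.1; omega, by have := hi.2; omega⟩⟩

theorem Icc_zero_subset_Ici (n : ℤ) : Set.Icc 0 n ⊆ inner (Set.Ici 0) :=
  fun i hi => ⟨hi.1, by have := hi.1; simp; omega⟩

/-- On `[0, ∞)` there is always a spare degree, so the shortening can be repeated until the support
is `[0, 2]`. -/
theorem exists_incl_eq (x : DiagQuot (Set.Ici 0) M) : ∃ y : DiagQuot (Set.Icc 0 2) M,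
    DiagQuot.incl Set.Icc_subset_Ici_self M y = x := by
  have key : ∀ (k : ℕ) (P : AcyclicCx Bool (Set.Ici 0) M), SuppIn (Set.Icc 0 (k + 2)) P.X →
      DiagQuot.of P ∈
        (DiagQuot.incl (Set.Icc_subset_Ici_self : Set.Icc (0 : ℤ) 2 ⊆ _) M).range := by
    intro k
    induction k with
    | zero =>
      intro P hP
      exact ⟨DiagQuot.of (P.restrict (Set.Icc 0 2) (by simpa using hP)), rfl⟩
    | succ k ih =>
      intro P hP
      have h := P.suppIn_shorten hP (m := k + 2) (by push_cast; omega) (by omega)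
      have h' := h.mono (Set.Icc_subset_Ici_self : Set.Icc (0 : ℤ) (k + 2) ⊆ Set.Ici 0)
      have e := DiagQuot.of_shorten P (J' := Set.Ici 0) (by push_cast; omega) hP
        (Icc_zero_subset_Ici _) P.support h'
      have := ih (P.shorten (Set.Ici 0) h') h
      rw [← e] at this
      exact this
  obtain ⟨x, rfl⟩ := QuotientAddGroup.mk_surjective x
  obtain ⟨x, rfl⟩ := QuotientAddGroup.mk_surjective x
  refine AddMonoidHom.mem_range.1 ?_
  induction x using FreeAbelianGroup.induction_on with
  | zero => exact zero_mem _
  | of P =>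
    obtain ⟨a, c, h⟩ := P.bounded
    refine key c.toNat P fun i hi => ?_
    by_cases h₀ : 0 ≤ i
    · exact h i fun h' => hi ⟨h₀, by have := h'.2; omega⟩
    · exact P.support i (by simpa using h₀)
  | neg P h => exact neg_mem h
  | add x y hx hy => exact add_mem hx hy

theorem Icc_zero_subset {n m : ℤ} (h : n ≤ m) : Set.Icc 0 n ⊆ Set.Icc 0 m :=
  Set.Icc_subset_Icc_right h

/-- The homomorphism which the shortening induces. -/
noncomputable def shortenHom (M : ConflationCat.{v, u}) [M.Exact] {n m : ℤ} (hn : n - 1 ≤ m)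
    (hm : 2 ≤ m) : K0 (Bq (Set.Icc 0 n) M) →+ DiagQuot (Set.Icc 0 m) M :=
  K0.lift (N := Bq (Set.Icc 0 n) M)
    (fun P : AcyclicCx Bool (Set.Icc 0 n) M => DiagQuot.of (P.shorten (Set.Icc 0 m)
      (P.suppIn_shorten P.support hn hm)))
    fun S hS => DiagQuot.of_conf (AcyclicCx.shortenMap S.f _ _ _) (AcyclicCx.shortenMap S.g _ _ _)
      (AcyclicCx.conf_shortenMap ((AcyclicCx.conf_iff S.f S.g).1 ⟨S.zero, hS⟩) _ _ _ _)

/-- The complex for the top differential. -/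
def topFunctor (J : Set ℤ) (M : ConflationCat.{v, u}) : ExactFunctor (Bq J M) (Cq J M) where
  functor :=
    { obj := fun P : AcyclicCx Bool J M =>
        ({ X := P.X
           d := fun _ => P.d true
           shape := fun _ => P.shape true
           d_comp_d := fun _ => P.d_comp_d true
           bounded := P.bounded
           support := P.support
           acyclic := fun _ => P.acyclic true } : AcyclicCx Unit J M)
      map := fun {P Q} (φ : AcyclicCx.Hom P Q) =>
        { f := φ.f, comm := fun _ i j => φ.comm true i j } }
  additive := ⟨rfl⟩
  map_conf _ h := h

omit [M.Exact] in
theorem diag_comp_topFunctor (J : Set ℤ) :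
    (diag J M).comp (topFunctor J M) = ExactFunctor.id (Cq J M) := rfl

omit [M.Exact] in
theorem K0.map_id : K0.map (ExactFunctor.id M) = AddMonoidHom.id _ :=
  K0.hom_ext fun A => K0.map_of _ A

/-- A retraction which shortens the support by one degree. -/
noncomputable def retract (M : ConflationCat.{v, u}) [M.Exact] {n m : ℤ} (hn : n - 1 ≤ m)
    (hm : 2 ≤ m) : DiagQuot (Set.Icc 0 n) M →+ DiagQuot (Set.Icc 0 m) M :=
  -- The shortening of a diagonal complex need not be diagonal, since `shortenIso` exchanges
  -- summands. Subtracting the shortening of the complex with both differentials equal to the top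
  -- one forces diagonal complexes to map to zero.
  QuotientAddGroup.lift _ (shortenHom M hn hm -
    ((shortenHom M hn hm).comp (K0.map (diag _ M))).comp (K0.map (topFunctor _ M))) <| by
    rintro _ ⟨x, rfl⟩
    have : K0.map (topFunctor _ M) (K0.map (diag _ M) x) = x := by
      rw [← AddMonoidHom.comp_apply, ← K0.map_comp, diag_comp_topFunctor, K0.map_id]
      rfl
    simp [this]

/-- For `m ≥ 3` the degrees `[0, 2]` are inner in `[0, m]`, so shortening leaves the class of a
complex on `[0, 2]` unchanged. The correction term is then the class of a diagonal complex. -/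
theorem retract_incl {n m : ℤ} (hn : n - 1 ≤ m) (hm : 3 ≤ m) (hn' : 2 ≤ n)
    (x : DiagQuot (Set.Icc 0 2) M) :
    retract M hn (by omega) (DiagQuot.incl (Icc_zero_subset hn') M x) =
      DiagQuot.incl (Icc_zero_subset (by omega)) M x := by
  have h : ∀ P : AcyclicCx Bool (Set.Icc 0 2) M, shortenHom M hn (by omega)
      (K0.of (N := Bq _ M) (P.restrict _ (SuppIn.mono (Icc_zero_subset hn') P.support))) =
      DiagQuot.of (P.restrict _ (SuppIn.mono (Icc_zero_subset (by omega : 2 ≤ m)) P.support)) := by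
    intro P
    refine (K0.lift_of (N := Bq _ M) _ _ _).trans ?_
    exact (DiagQuot.of_shorten P le_rfl P.support (Icc_zero_subset_inner (by omega)) _ _).symm
  have key : (retract M hn (by omega)).comp (DiagQuot.incl (Icc_zero_subset hn') M) =
      DiagQuot.incl (Icc_zero_subset (by omega : 2 ≤ m)) M := by
    refine QuotientAddGroup.addMonoidHom_ext _ (K0.hom_ext fun P => ?_)
    have h₀ : 2 ≤ m := by omega
    change shortenHom M hn h₀ (K0.map (enlarge _ _ _) (K0.of P)) - shortenHom M hn h₀
      (K0.map (diag _ M) (K0.map (topFunctor _ M) (K0.map (enlarge _ _ _) (K0.of P)))) =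
      DiagQuot.of ((P : AcyclicCx Bool (Set.Icc 0 2) M).restrict _ _)
    rw [K0.map_of, K0.map_of, K0.map_of]
    have h₁ := h P
    have h₂ := h ((diag _ M).functor.obj ((topFunctor _ M).functor.obj P))
    have h₃ := DiagQuot.of_diag (AcyclicCx.restrict
      ((topFunctor _ M).functor.obj P : AcyclicCx Unit (Set.Icc 0 2) M) (Set.Icc 0 m)
      (SuppIn.mono (Icc_zero_subset (by omega : 2 ≤ m)) P.support))
    refine (congrArg₂ (· - ·) h₁ (h₂.trans h₃)).trans (sub_zero _)
  exact DFunLike.congr_fun key x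

open Classical in
/-- The class in `DiagQuot J M` of a complex which is supported on `J`, and zero for all other
complexes. -/
noncomputable def restrictHom (J J' : Set ℤ) (M : ConflationCat.{v, u}) :
    FreeAbelianGroup (Bq J M).Obj →+ DiagQuot J' M :=
  FreeAbelianGroup.lift fun P : AcyclicCx Bool J M =>
    if h : SuppIn J' P.X then DiagQuot.of (P.restrict J' h) else 0

/-- The elements which vanish after restriction to all large intervals. -/
def eventuallyZero (M : ConflationCat.{v, u}) :
    AddSubgroup (FreeAbelianGroup (Bq (Set.Ici 0) M).Obj) where
  carrier := { z | ∃ n : ℤ, ∀ m ≥ n, restrictHom _ (Set.Icc 0 m) M z = 0 }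
  zero_mem' := ⟨0, fun _ _ => map_zero _⟩
  add_mem' := by
    rintro x y ⟨n, hn⟩ ⟨m, hm⟩
    refine ⟨max n m, fun k hk => ?_⟩
    rw [map_add, hn k ((le_max_left _ _).trans hk), hm k ((le_max_right _ _).trans hk), add_zero]
  neg_mem' := by
    rintro x ⟨n, hn⟩
    exact ⟨n, fun k hk => by rw [map_neg, hn k hk, neg_zero]⟩

omit [M.Exact] in
theorem restrictHom_of {J J' : Set ℤ} (P : AcyclicCx Bool J M) (h : SuppIn J' P.X) :
    restrictHom J J' M (FreeAbelianGroup.of (α := (Bq J M).Obj) P) =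
      DiagQuot.of (P.restrict J' h) :=
  (FreeAbelianGroup.lift_apply_of _ _).trans (dif_pos h)

omit [M.Exact] in
theorem exists_suppIn {ι : Type} (P : AcyclicCx ι (Set.Ici 0) M) :
    ∃ n : ℤ, ∀ m ≥ n, SuppIn (Set.Icc 0 m) P.X := by
  obtain ⟨a, c, h⟩ := P.bounded
  refine ⟨c, fun m hm i hi => ?_⟩
  by_cases h₀ : 0 ≤ i
  · exact h i fun h' => hi ⟨h₀, h'.2.trans hm⟩
  · exact P.support i (by simpa using h₀)

/-- In a conflation of complexes, the support of the middle term contains the other two; once an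
interval contains it, the relation already holds there. -/
theorem K0Rel_le_eventuallyZero : (Bq (Set.Ici 0) M).K0Rel ≤ eventuallyZero M := by
  rw [K0Rel, AddSubgroup.closure_le]
  rintro _ ⟨S, hS, rfl⟩
  obtain ⟨n, hn⟩ := exists_suppIn (M := M) S.X₂
  have h := (AcyclicCx.conf_iff S.f S.g).1 ⟨S.zero, hS⟩
  refine ⟨n, fun m hm => ?_⟩
  have h₁ : SuppIn (Set.Icc 0 m) (AcyclicCx.X S.X₁) :=
    fun i hi => (h i).isZero_left (hn m hm i hi)
  have h₃ : SuppIn (Set.Icc 0 m) (AcyclicCx.X S.X₃) :=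
    fun i hi => (h i).isZero_right (hn m hm i hi)
  rw [map_sub, map_add]
  refine (congrArg₂ (· - ·) (restrictHom_of _ (hn m hm)) (congrArg₂ (· + ·) (restrictHom_of _ h₁)
    (restrictHom_of _ h₃))).trans (sub_eq_zero.2 ?_)
  exact DiagQuot.of_conf (P := AcyclicCx.restrict S.X₁ _ h₁)
    (Q := AcyclicCx.restrict S.X₂ _ (hn m hm)) (R := AcyclicCx.restrict S.X₃ _ h₃)
    { f := S.f.f, comm := S.f.comm } { f := S.g.f, comm := S.g.comm } h

omit [M.Exact] in
theorem map_diag_mem_eventuallyZero (y : FreeAbelianGroup (Cq (Set.Ici 0) M).Obj) :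
    FreeAbelianGroup.map (diag _ M).functor.obj y ∈ eventuallyZero M := by
  induction y using FreeAbelianGroup.induction_on with
  | zero => rw [map_zero]; exact zero_mem _
  | of P =>
    obtain ⟨n, hn⟩ := exists_suppIn (M := M) P
    refine ⟨n, fun m hm => ?_⟩
    rw [FreeAbelianGroup.map_of_apply]
    exact (restrictHom_of _ (hn m hm)).trans (DiagQuot.of_diag (AcyclicCx.restrict P _ (hn m hm)))
  | neg P h => rw [map_neg]; exact neg_mem h
  | add x y hx hy => rw [map_add]; exact add_mem hx hy

/-- The vanishing on `[0, ∞)` is witnessed by finitely many relations and diagonal complexes, all of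
them bounded, hence by data on one finite interval. -/
theorem exists_incl_eq_zero (x : DiagQuot (Set.Icc 0 2) M)
    (hx : DiagQuot.incl Set.Icc_subset_Ici_self M x = 0) :
    ∃ n : ℤ, ∀ m ≥ n, ∀ h : 2 ≤ m, DiagQuot.incl (Icc_zero_subset h) M x = 0 := by
  obtain ⟨x, rfl⟩ := QuotientAddGroup.mk_surjective x
  obtain ⟨x, rfl⟩ := QuotientAddGroup.mk_surjective x
  obtain ⟨y, hy⟩ := (QuotientAddGroup.eq_zero_iff _).1 hx
  obtain ⟨y, rfl⟩ := QuotientAddGroup.mk_surjective y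
  have hz := QuotientAddGroup.eq.1 hy
  have := (AddSubgroup.add_mem_cancel_left _ (neg_mem (map_diag_mem_eventuallyZero y))).1
    (K0Rel_le_eventuallyZero hz)
  obtain ⟨n, hn⟩ := this
  refine ⟨n, fun m hm h => ?_⟩
  rw [← hn m hm]
  clear * -
  induction x using FreeAbelianGroup.induction_on with
  | zero => simp
  | of P =>
    rw [FreeAbelianGroup.map_of_apply]
    exact (restrictHom_of _ (SuppIn.mono (Icc_zero_subset h) (AcyclicCx.support P))).symm
  | neg P h =>
    rw [QuotientAddGroup.mk_neg, QuotientAddGroup.mk_neg, map_neg, map_neg, map_neg, h]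
  | add x y hx hy =>
    rw [QuotientAddGroup.mk_add, QuotientAddGroup.mk_add, map_add, map_add, map_add, hx, hy]

theorem incl_eq_zero (x : DiagQuot (Set.Icc 0 2) M)
    (hx : DiagQuot.incl Set.Icc_subset_Ici_self M x = 0) :
    DiagQuot.incl (Icc_zero_subset (by norm_num : (2 : ℤ) ≤ 4)) M x = 0 := by
  obtain ⟨n, hn⟩ := exists_incl_eq_zero x hx
  have key : ∀ (k : ℕ), (∀ h : (2 : ℤ) ≤ 3 + k, DiagQuot.incl (Icc_zero_subset h) M x = 0) →
      DiagQuot.incl (Icc_zero_subset (by norm_num : (2 : ℤ) ≤ 3)) M x = 0 := by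
    intro k
    induction k with
    | zero => exact fun h => h (by simp)
    | succ k ih =>
      refine fun h => ih fun _ => ?_
      rw [← retract_incl (n := 3 + (k + 1 : ℕ)) (by push_cast; omega) (by omega) (by omega),
        h (by push_cast; omega), map_zero]
  -- The start `3 + (n - 3).toNat` is at least `n`, and each retraction lowers the end by one.
  -- Vanishing is reached on `[0, 3]`, hence on `[0, 4]`.
  have h₃ := key (n - 3).toNat fun h => hn _ (by omega) h
  rw [← DiagQuot.incl_incl (Icc_zero_subset (by norm_num : (2 : ℤ) ≤ 3))
    (Icc_zero_subset (by norm_num : (3 : ℤ) ≤ 4)), h₃, map_zero]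

/-! ## Interchanging the directions of double complexes -/

section Swap

theorem AcyclicCx.isZero_of_X {ι : Type} {J : Set ℤ} {M : ConflationCat.{v, u}}
    {P : AcyclicCx ι J M} (h : ∀ i, IsZero (P.X i)) : IsZero P :=
  (IsZero.iff_id_eq_zero P).2 (AcyclicCx.hom_ext _ _ fun i => (h i).eq_of_src _ _)

/-- The exact functor which takes the object in degree `i`. -/
def evalFunctor (ι : Type) (J : Set ℤ) (M : ConflationCat.{v, max u v}) (i : ℤ) :
    ExactFunctor (acyclicCat ι J M) M where
  functor := AcyclicCx.eval ι J M i
  additive := ⟨rfl⟩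
  map_conf _ h := h i

variable (ι ι' : Type) (J J' : Set ℤ) (M : ConflationCat.{v, max u v}) [M.Exact]

omit [M.Exact] in
theorem exists_uniform_bound (P : AcyclicCx ι J (acyclicCat ι' J' M)) :
    ∃ a c : ℤ, ∀ j ∉ Set.Icc a c, ∀ i, IsZero (AcyclicCx.X (P.X i) j) := by
  obtain ⟨a, c, h⟩ := P.bounded
  choose a' c' h' using fun i => AcyclicCx.bounded (P.X i)
  obtain ⟨A, hA⟩ := ((Set.finite_Icc a c).image a').bddBelow
  obtain ⟨C, hC⟩ := ((Set.finite_Icc a c).image c').bddAbove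
  refine ⟨A, C, fun j hj i => ?_⟩
  by_cases hi : i ∈ Set.Icc a c
  · exact h' i j fun h => hj ⟨(hA ⟨i, hi, rfl⟩).trans h.1, h.2.trans (hC ⟨i, hi, rfl⟩)⟩
  · exact AcyclicCx.isZero_X (h i hi) j

/-- The object in degree `j` for the inner direction of a double complex. -/
abbrev swapX {ι ι' : Type} {J J' : Set ℤ} {M : ConflationCat.{v, max u v}}
    (P : AcyclicCx ι J (acyclicCat ι' J' M)) (j : ℤ) : AcyclicCx ι J M :=
  (acyclicMap ι J (evalFunctor ι' J' M j)).functor.obj P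

/-- The inner differentials of a double complex. -/
abbrev swapD {ι ι' : Type} {J J' : Set ℤ} {M : ConflationCat.{v, max u v}}
    (P : AcyclicCx ι J (acyclicCat ι' J' M)) (b : ι') (j j' : ℤ) : swapX P j ⟶ swapX P j' where
  f i := AcyclicCx.d (P.X i) b j j'
  comm b' i i' := (AcyclicCx.Hom.comm (P.d b' i i') b j j').symm

/-- The inner cycles in a fixed degree again form an acyclic complex in the outer direction, because
`cycles` is an exact functor. -/
theorem acyclic_swapD {ι ι' : Type} {J J' : Set ℤ} {M : ConflationCat.{v, max u v}} [M.Exact]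
    (P : AcyclicCx ι J (acyclicCat ι' J' M)) (b : ι') :
    (acyclicCat ι J M).Acyclic
      { X := swapX P
        d := swapD P b
        shape := fun j j' h => AcyclicCx.hom_ext _ _ fun i => AcyclicCx.shape (P.X i) b j j' h
        d_comp_d' := fun j k l _ _ =>
          AcyclicCx.hom_ext _ _ fun i => AcyclicCx.d_comp_d (P.X i) b j k l } := by
  let m : ∀ j, (acyclicMap ι J (cycles ι' J' M b j)).functor.obj P ⟶ swapX P j := fun j =>
    { f := fun i => AcyclicCx.m (P.X i) b j
      comm := fun b' i i' => (AcyclicCx.ZMap_m (P.d b' i i') b j).symm }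
  let e : ∀ j, swapX P j ⟶ (acyclicMap ι J (cycles ι' J' M b (j - 1))).functor.obj P := fun j =>
    { f := fun i => AcyclicCx.E (P.X i) b j (j - 1)
      comm := fun b' i i' => AcyclicCx.E_ZMap (P.d b' i i') b j (j - 1) }
  exact ⟨fun j => (acyclicMap ι J (cycles ι' J' M b j)).functor.obj P, m, e,
    fun j => AcyclicCx.hom_ext _ _ fun i => (AcyclicCx.conf_m_E (P.X i) b j).w,
    fun j i => (AcyclicCx.conf_m_E (P.X i) b j).2,
    fun j => AcyclicCx.hom_ext _ _ fun i => (AcyclicCx.E_m (P.X i) b j (j - 1)).symm⟩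

/-- The interchange of the two directions of a double complex. -/
def swap : ExactFunctor (acyclicCat ι J (acyclicCat ι' J' M))
    (acyclicCat ι' J' (acyclicCat ι J M)) where
  functor :=
    { obj := fun P : AcyclicCx ι J (acyclicCat ι' J' M) =>
        ({ X := swapX P
           d := swapD P
           shape := fun b j j' h =>
             AcyclicCx.hom_ext _ _ fun i => AcyclicCx.shape (P.X i) b j j' h
           d_comp_d := fun b j k l =>
             AcyclicCx.hom_ext _ _ fun i => AcyclicCx.d_comp_d (P.X i) b j k l
           bounded := by
             obtain ⟨a, c, h⟩ := exists_uniform_bound ι ι' J J' M P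
             exact ⟨a, c, fun j hj => AcyclicCx.isZero_of_X (h j hj)⟩
           support := fun j hj =>
             AcyclicCx.isZero_of_X fun i => AcyclicCx.support (P.X i) j hj
           acyclic := acyclic_swapD P } : AcyclicCx ι' J' (acyclicCat ι J M))
      map := fun {P Q} (φ : AcyclicCx.Hom P Q) =>
        { f := fun j => (acyclicMap ι J (evalFunctor ι' J' M j)).functor.map φ
          comm := fun b j j' => AcyclicCx.hom_ext _ _ fun i =>
            AcyclicCx.Hom.comm (φ.f i) b j j' } }
  additive := ⟨rfl⟩
  map_conf _ h := fun j i => h i j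

end Swap

/-! ## Interchanging a direction with the directions of iterated complexes -/

section SwapIter

theorem exact_bqIter (K : Set ℤ) (N : ConflationCat.{v, max u v}) [N.Exact] (n : ℕ) :
    (BqIter.{v, u} K n N).Exact := by
  induction n with
  | zero => assumption
  | succ n ih => exact inferInstanceAs (acyclicCat Bool K (BqIter.{v, u} K n N)).Exact

instance (K : Set ℤ) (N : ConflationCat.{v, max u v}) [N.Exact] (n : ℕ) :
    (BqIter.{v, u} K n N).Exact := exact_bqIter K N n

theorem exact_faceCat (K : Set ℤ) (N : ConflationCat.{v, max u v}) [N.Exact] (n : ℕ)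
    (k : Fin n) : (faceCat.{v, u} K N n k).Exact := by
  induction n with
  | zero => exact k.elim0
  | succ n ih =>
    obtain ⟨_ | k, h⟩ := k
    · exact inferInstanceAs (acyclicCat Unit K (BqIter.{v, u} K n N)).Exact
    · have := ih ⟨k, Nat.lt_of_succ_lt_succ h⟩
      exact inferInstanceAs (acyclicCat Bool K (faceCat.{v, u} K N n
        ⟨k, Nat.lt_of_succ_lt_succ h⟩)).Exact

instance (K : Set ℤ) (N : ConflationCat.{v, max u v}) [N.Exact] (n : ℕ) (k : Fin n) :
    (faceCat.{v, u} K N n k).Exact := exact_faceCat K N n k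

variable (ι : Type) (J K : Set ℤ) (N : ConflationCat.{v, max u v}) [N.Exact]

/-- Moving the outer direction inside. -/
def swapIn : (n : ℕ) → ExactFunctor (acyclicCat ι J (BqIter.{v, u} K n N))
    (BqIter.{v, u} K n (acyclicCat ι J N))
  | 0 => ExactFunctor.id _
  | n + 1 => (swap.{v, u} ι Bool J K (BqIter.{v, u} K n N)).comp (acyclicMap Bool K (swapIn n))

/-- Moving the innermost direction outside. -/
def swapOut : (n : ℕ) → ExactFunctor (BqIter.{v, u} K n (acyclicCat ι J N))
    (acyclicCat ι J (BqIter.{v, u} K n N))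
  | 0 => ExactFunctor.id _
  | n + 1 => (acyclicMap Bool K (swapOut n)).comp (swap.{v, u} Bool ι K J (BqIter.{v, u} K n N))

theorem swapIn_comp_swapOut (n : ℕ) :
    (swapIn.{v, u} ι J K N n).comp (swapOut.{v, u} ι J K N n) = ExactFunctor.id _ := by
  induction n with
  | zero => rfl
  | succ n ih =>
    change ((swap.{v, u} ι Bool J K (BqIter.{v, u} K n N)).comp (acyclicMap Bool K
      ((swapIn.{v, u} ι J K N n).comp (swapOut.{v, u} ι J K N n)))).comp
        (swap.{v, u} Bool ι K J (BqIter.{v, u} K n N)) = _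
    rw [ih]
    rfl

variable {J K} in
theorem enlarge_swapIn {K' : Set ℤ} (h : K ⊆ K') (n : ℕ) :
    (acyclicMap ι J (BqIterEnlarge.{v, u} h N n)).comp (swapIn.{v, u} ι J K' N n) =
      (swapIn.{v, u} ι J K N n).comp (BqIterEnlarge.{v, u} h (acyclicCat ι J N) n) := by
  induction n with
  | zero => rfl
  | succ n ih =>
    have := congrArg (fun F => (swap.{v, u} ι Bool J K (BqIter.{v, u} K n N)).comp
      ((enlarge Bool h _).comp (acyclicMap Bool K' F))) ih
    exact this

variable {J K} in
theorem enlarge_swapOut {K' : Set ℤ} (h : K ⊆ K') (n : ℕ) :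
    (BqIterEnlarge.{v, u} h (acyclicCat ι J N) n).comp (swapOut.{v, u} ι J K' N n) =
      (swapOut.{v, u} ι J K N n).comp (acyclicMap ι J (BqIterEnlarge.{v, u} h N n)) := by
  induction n with
  | zero => rfl
  | succ n ih =>
    have := congrArg (fun F => ((enlarge Bool h _).comp (acyclicMap Bool K' F)).comp
      (swap.{v, u} Bool ι K' J (BqIter.{v, u} K' n N))) ih
    exact this

/-- Together with `face_swapOut`, this lets statements about `faces` over `acyclicCat ι J N` be
transported to `innerFaces`. -/
theorem face_swapIn (n : ℕ) (k : Fin n) :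
    ∃ G : ExactFunctor (acyclicCat ι J (faceCat.{v, u} K N n k))
      (faceCat.{v, u} K (acyclicCat ι J N) n k),
      (acyclicMap ι J (face.{v, u} K N n k)).comp (swapIn.{v, u} ι J K N n) =
        G.comp (face.{v, u} K (acyclicCat ι J N) n k) := by
  induction n with
  | zero => exact k.elim0
  | succ n ih =>
    obtain ⟨_ | k, h⟩ := k
    · exact ⟨(swap.{v, u} ι Unit J K (BqIter.{v, u} K n N)).comp
        (acyclicMap Unit K (swapIn.{v, u} ι J K N n)), rfl⟩
    · obtain ⟨G, hG⟩ := ih ⟨k, Nat.lt_of_succ_lt_succ h⟩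
      exact ⟨(swap.{v, u} ι Bool J K (faceCat.{v, u} K N n ⟨k, Nat.lt_of_succ_lt_succ h⟩)).comp
        (acyclicMap Bool K G), congrArg (fun F => (swap.{v, u} ι Bool J K (faceCat.{v, u} K N n
          ⟨k, Nat.lt_of_succ_lt_succ h⟩)).comp (acyclicMap Bool K F)) hG⟩

theorem face_swapOut (n : ℕ) (k : Fin n) :
    ∃ G : ExactFunctor (faceCat.{v, u} K (acyclicCat ι J N) n k)
      (acyclicCat ι J (faceCat.{v, u} K N n k)),
      (face.{v, u} K (acyclicCat ι J N) n k).comp (swapOut.{v, u} ι J K N n) =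
        G.comp (acyclicMap ι J (face.{v, u} K N n k)) := by
  induction n with
  | zero => exact k.elim0
  | succ n ih =>
    obtain ⟨_ | k, h⟩ := k
    · exact ⟨(acyclicMap Unit K (swapOut.{v, u} ι J K N n)).comp
        (swap.{v, u} Unit ι K J (BqIter.{v, u} K n N)), rfl⟩
    · obtain ⟨G, hG⟩ := ih ⟨k, Nat.lt_of_succ_lt_succ h⟩
      exact ⟨(acyclicMap Bool K G).comp
        (swap.{v, u} Bool ι K J (faceCat.{v, u} K N n ⟨k, Nat.lt_of_succ_lt_succ h⟩)),
        congrArg (fun F => (acyclicMap Bool K F).comp (swap.{v, u} Bool ι K J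
          (BqIter.{v, u} K n N))) hG⟩

end SwapIter

/-! ## Induction on the number of directions -/

/-- Correct `x` by some `t` in `T` whose image accounts for the `S`-part of `e x`. Then `e (x - t)`
lies in `D`, where the hypothesis applies, and `e' t` lies in `S'` anyway. -/
theorem mem_sup_of_lift {A B C : Type*} [AddCommGroup A] [AddCommGroup B] [AddCommGroup C]
    {e : A →+ B} {e' : A →+ C} {D S : AddSubgroup B} {T : AddSubgroup A} {D' S' : AddSubgroup C}
    (hS : S ≤ T.map e ⊔ D) (hT : T.map e' ≤ S') (hD : ∀ x, e x ∈ D → e' x ∈ D') {x : A}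
    (hx : e x ∈ D ⊔ S) : e' x ∈ D' ⊔ S' := by
  obtain ⟨d, hd, _, ⟨t, ht, rfl⟩, h⟩ := AddSubgroup.mem_sup.1
    ((sup_le le_sup_left (hS.trans (sup_comm _ _).le) : D ⊔ S ≤ D ⊔ T.map e) hx)
  have hxt : e (x - t) ∈ D := by rwa [map_sub, ← h, add_sub_cancel_right]
  have := hD _ hxt
  rw [← sub_add_cancel x t, map_add]
  exact AddSubgroup.add_mem_sup this (hT ⟨t, ht, rfl⟩)

theorem K0.map_map {A B C : ConflationCat.{v, u}} (F : ExactFunctor A B) (G : ExactFunctor B C)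
    (x : K0 A) : K0.map G (K0.map F x) = K0.map (F.comp G) x := by
  rw [K0.map_comp, AddMonoidHom.comp_apply]

theorem K0.map_range_le {A B B' C : ConflationCat.{v, u}} {F : ExactFunctor A B}
    {G : ExactFunctor B C} {F' : ExactFunctor A B'} {G' : ExactFunctor B' C}
    (h : F.comp G = F'.comp G') : (K0.map F).range.map (K0.map G) ≤ (K0.map G').range := by
  rintro _ ⟨_, ⟨x, rfl⟩, rfl⟩
  exact ⟨K0.map F' x, by rw [K0.map_map, K0.map_map, h]⟩

theorem K0.map_iSup_range_le {κ : Type*} {A A' : κ → ConflationCat.{v, u}}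
    {B B' : ConflationCat.{v, u}} {F : ∀ k, ExactFunctor (A k) B} {F' : ∀ k, ExactFunctor (A' k) B'}
    {H : ExactFunctor B B'}
    (h : ∀ k, ∃ G : ExactFunctor (A k) (A' k), (F k).comp H = G.comp (F' k)) :
    (⨆ k, (K0.map (F k)).range).map (K0.map H) ≤ ⨆ k, (K0.map (F' k)).range := by
  rw [AddSubgroup.map_iSup]
  refine iSup_mono fun k => ?_
  obtain ⟨G, hG⟩ := h k
  exact K0.map_range_le hG

/-- The subgroup generated by the complexes which are diagonal in some direction. -/
abbrev faces (J : Set ℤ) (n : ℕ) (N : ConflationCat.{v, max u v}) :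
    AddSubgroup (K0 (BqIter.{v, u} J n N)) :=
  ⨆ k : Fin n, (K0.map (face.{v, u} J N n k)).range

/-- The subgroup generated by the complexes which are diagonal in some inner direction. -/
abbrev innerFaces (ι : Type) (J K : Set ℤ) (n : ℕ) (N : ConflationCat.{v, max u v}) :
    AddSubgroup (K0 (acyclicCat ι J (BqIter.{v, u} K n N))) :=
  ⨆ k : Fin n, (K0.map (acyclicMap ι J (face.{v, u} K N n k))).range

theorem faces_succ (J : Set ℤ) (n : ℕ) (N : ConflationCat.{v, max u v}) :
    faces.{v, u} J (n + 1) N =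
      innerFaces.{v, u} Bool J J n N ⊔ (K0.map (diag J (BqIter.{v, u} J n N))).range := by
  apply le_antisymm
  · refine iSup_le fun k => ?_
    obtain ⟨_ | k, h⟩ := k
    · exact le_sup_right
    · exact le_sup_of_le_left (le_iSup (fun k : Fin n =>
        (K0.map (acyclicMap Bool J (face.{v, u} J N n k))).range)
        ⟨k, Nat.lt_of_succ_lt_succ h⟩)
  · refine sup_le (iSup_le fun k => ?_) ?_
    · exact le_iSup (fun k : Fin (n + 1) => (K0.map (face.{v, u} J N (n + 1) k)).range) k.succ
    · exact le_iSup (fun k : Fin (n + 1) => (K0.map (face.{v, u} J N (n + 1) k)).range) 0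

theorem Icc_two_subset_Icc_four : Set.Icc (0 : ℤ) 2 ⊆ Set.Icc 0 4 :=
  Icc_zero_subset (by norm_num)

theorem Icc_two_subset_Ici : Set.Icc (0 : ℤ) 2 ⊆ Set.Ici 0 := Set.Icc_subset_Ici_self

/-- Modulo degenerate complexes, every class comes from a complex supported on `[0, 2]`. -/
def Shortenable (n : ℕ) (N : ConflationCat.{v, max u v}) : Prop :=
  (K0.map (BqIterEnlarge.{v, u} Icc_two_subset_Ici N n)).range ⊔ faces.{v, u} (Set.Ici 0) n N = ⊤

/-- The relations between classes of complexes supported on `[0, 2]` hold on `[0, 4]`. -/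
def RelationsShortenable (n : ℕ) (N : ConflationCat.{v, max u v}) : Prop :=
  ∀ x, K0.map (BqIterEnlarge.{v, u} Icc_two_subset_Ici N n) x ∈ faces.{v, u} (Set.Ici 0) n N →
    K0.map (BqIterEnlarge.{v, u} Icc_two_subset_Icc_four N n) x ∈
      faces.{v, u} (Set.Icc 0 4) n N

/-! ### Shortening in the outermost direction -/

section Outer

variable (N : ConflationCat.{v, u}) [N.Exact]

theorem range_enlarge_sup_range_diag :
    (K0.map (enlarge Bool Icc_two_subset_Ici N)).range ⊔ (K0.map (diag (Set.Ici 0) N)).range =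
      ⊤ := by
  refine eq_top_iff.2 fun x _ => ?_
  obtain ⟨y, hy⟩ := exists_incl_eq (M := N) (QuotientAddGroup.mk x)
  obtain ⟨y, rfl⟩ := QuotientAddGroup.mk_surjective y
  have := QuotientAddGroup.eq.1 hy
  rw [← add_neg_cancel_left (K0.map (enlarge Bool Icc_two_subset_Ici N) y) x]
  exact AddSubgroup.add_mem_sup ⟨y, rfl⟩ this

theorem enlarge_mem_range_diag (x : K0 (Bq (Set.Icc 0 2) N))
    (hx : K0.map (enlarge Bool Icc_two_subset_Ici N) x ∈ (K0.map (diag (Set.Ici 0) N)).range) :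
    K0.map (enlarge Bool Icc_two_subset_Icc_four N) x ∈
      (K0.map (diag (Set.Icc 0 4) N)).range :=
  (QuotientAddGroup.eq_zero_iff _).1
    (incl_eq_zero (QuotientAddGroup.mk x) ((QuotientAddGroup.eq_zero_iff _).2 hx))

end Outer

/-! ### Shortening in the inner directions, and relations in both -/

section Inner

variable (ι : Type) (J : Set ℤ) {n : ℕ} {N : ConflationCat.{v, max u v}} [N.Exact]

/-- Move the outer direction innermost with `swapIn`, use the hypothesis over the exact category of
complexes in that direction, and move it back. -/
theorem range_inner_sup_innerFaces (h : Shortenable.{v, u} n (acyclicCat ι J N)) :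
    (K0.map (acyclicMap ι J (BqIterEnlarge.{v, u} Icc_two_subset_Ici N n))).range ⊔
      innerFaces.{v, u} ι J (Set.Ici 0) n N = ⊤ := by
  refine eq_top_iff.2 fun x _ => ?_
  have hx : K0.map (swapIn.{v, u} ι J (Set.Ici 0) N n) x ∈ _ := h.ge (AddSubgroup.mem_top _)
  have := AddSubgroup.mem_map_of_mem (K0.map (swapOut.{v, u} ι J (Set.Ici 0) N n)) hx
  rw [K0.map_map, swapIn_comp_swapOut, K0.map_id, AddMonoidHom.id_apply, AddSubgroup.map_sup]
    at this
  exact sup_le_sup (K0.map_range_le (enlarge_swapOut.{v, u} ι N Icc_two_subset_Ici n))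
    (K0.map_iSup_range_le (face_swapOut.{v, u} ι J (Set.Ici 0) N n)) this

theorem inner_mem_innerFaces (h : RelationsShortenable.{v, u} n (acyclicCat ι J N))
    (x : K0 (acyclicCat ι J (BqIter.{v, u} (Set.Icc 0 2) n N)))
    (hx : K0.map (acyclicMap ι J (BqIterEnlarge.{v, u} Icc_two_subset_Ici N n)) x ∈
      innerFaces.{v, u} ι J (Set.Ici 0) n N) :
    K0.map (acyclicMap ι J (BqIterEnlarge.{v, u} Icc_two_subset_Icc_four N n)) x ∈
      innerFaces.{v, u} ι J (Set.Icc 0 4) n N := by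
  have h₁ := K0.map_iSup_range_le (face_swapIn.{v, u} ι J (Set.Ici 0) N n)
    (AddSubgroup.mem_map_of_mem _ hx)
  rw [K0.map_map, enlarge_swapIn, ← K0.map_map] at h₁
  have h₂ := K0.map_iSup_range_le (face_swapOut.{v, u} ι J (Set.Icc 0 4) N n)
    (AddSubgroup.mem_map_of_mem _ (h _ h₁))
  rwa [K0.map_map, enlarge_swapOut, ← K0.map_map, K0.map_map (swapIn.{v, u} ι J _ N n),
    swapIn_comp_swapOut, K0.map_id] at h₂

/-- Shortening relations in the inner directions. -/
theorem inner_mem_innerFaces_sup (h : Shortenable.{v, u} n (Cq J N))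
    (h' : RelationsShortenable.{v, u} n (Bq J N))
    (x : K0 (Bq J (BqIter.{v, u} (Set.Icc 0 2) n N)))
    (hx : K0.map (acyclicMap Bool J (BqIterEnlarge.{v, u} Icc_two_subset_Ici N n)) x ∈
      innerFaces.{v, u} Bool J (Set.Ici 0) n N ⊔
        (K0.map (diag J (BqIter.{v, u} (Set.Ici 0) n N))).range) :
    K0.map (acyclicMap Bool J (BqIterEnlarge.{v, u} Icc_two_subset_Icc_four N n)) x ∈
      innerFaces.{v, u} Bool J (Set.Icc 0 4) n N ⊔
        (K0.map (diag J (BqIter.{v, u} (Set.Icc 0 4) n N))).range := by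
  refine mem_sup_of_lift (T := (K0.map (diag J (BqIter.{v, u} (Set.Icc 0 2) n N))).range)
    ?_ ?_ (inner_mem_innerFaces Bool J h') hx
  -- A complex diagonal in the outer direction comes from a complex over `Cq J`, whose inner
  -- directions can be shortened by the hypothesis for `Cq J N`; duplication of the differential
  -- commutes with this.
  · rw [AddMonoidHom.range_eq_map, ← range_inner_sup_innerFaces Unit J h, AddSubgroup.map_sup]
    refine sup_le_sup ?_ (K0.map_iSup_range_le fun k =>
      ⟨diag J (faceCat.{v, u} (Set.Ici 0) N n k), rfl⟩)
    rintro _ ⟨_, ⟨x, rfl⟩, rfl⟩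
    refine ⟨K0.map (diag J _) x, ⟨x, rfl⟩, ?_⟩
    rw [K0.map_map, K0.map_map]
    rfl
  · exact K0.map_range_le
      (F' := acyclicMap Unit J (BqIterEnlarge.{v, u} Icc_two_subset_Icc_four N n)) rfl

/-- Shortening relations in the outer direction. -/
theorem outer_mem_innerFaces_sup (K : Set ℤ) (x : K0 (Bq (Set.Icc 0 2) (BqIter.{v, u} K n N)))
    (hx : K0.map (enlarge Bool Icc_two_subset_Ici (BqIter.{v, u} K n N)) x ∈
      innerFaces.{v, u} Bool (Set.Ici 0) K n N ⊔
        (K0.map (diag (Set.Ici 0) (BqIter.{v, u} K n N))).range) :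
    K0.map (enlarge Bool Icc_two_subset_Icc_four (BqIter.{v, u} K n N)) x ∈
      innerFaces.{v, u} Bool (Set.Icc 0 4) K n N ⊔
        (K0.map (diag (Set.Icc 0 4) (BqIter.{v, u} K n N))).range := by
  rw [sup_comm] at hx ⊢
  refine mem_sup_of_lift (T := innerFaces.{v, u} Bool (Set.Icc 0 2) K n N) ?_
    (K0.map_iSup_range_le fun k => ⟨enlarge Bool Icc_two_subset_Icc_four
      (faceCat.{v, u} K N n k), rfl⟩) (enlarge_mem_range_diag (BqIter.{v, u} K n N)) hx
  refine iSup_le fun k => ?_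
  -- A complex diagonal in an inner direction is a binary complex over the exact category `faceCat`,
  -- so it can be shortened in the outer direction without losing that diagonality.
  rw [AddMonoidHom.range_eq_map, ← range_enlarge_sup_range_diag (faceCat.{v, u} K N n k),
    AddSubgroup.map_sup]
  refine sup_le_sup ?_ (K0.map_range_le (F' := acyclicMap Unit (Set.Ici 0)
    (face.{v, u} K N n k)) rfl)
  rintro _ ⟨_, ⟨x, rfl⟩, rfl⟩
  refine ⟨K0.map (acyclicMap Bool (Set.Icc 0 2) (face.{v, u} K N n k)) x,
    AddSubgroup.mem_iSup_of_mem k ⟨x, rfl⟩, ?_⟩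
  rw [K0.map_map, K0.map_map]
  rfl

end Inner

/-- The exact category varies in the induction, because the hypothesis is needed over the categories
of acyclic and of binary acyclic complexes in the new direction. -/
theorem shortenable_and_relationsShortenable (n : ℕ) (N : ConflationCat.{v, max u v}) [N.Exact] :
    Shortenable.{v, u} n N ∧ RelationsShortenable.{v, u} n N := by
  induction n generalizing N with
  | zero =>
    constructor
    · refine eq_top_iff.2 fun x _ => AddSubgroup.mem_sup_left ⟨x, ?_⟩
      exact DFunLike.congr_fun K0.map_id x
    · intro x hx
      have h₀ : faces.{v, u} (Set.Ici 0) 0 N = ⊥ := iSup_of_empty _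
      have h₁ : x = 0 := (DFunLike.congr_fun K0.map_id x).symm.trans
        (AddSubgroup.mem_bot.1 (h₀.le hx))
      rw [h₁, map_zero]
      exact zero_mem _
  | succ n ih =>
    constructor
    · rw [Shortenable, faces_succ]
      suffices h : (K0.map ((enlarge Bool Icc_two_subset_Ici _).comp (acyclicMap Bool (Set.Ici 0)
          (BqIterEnlarge.{v, u} Icc_two_subset_Ici N n)))).range ⊔
          (innerFaces.{v, u} Bool (Set.Ici 0) (Set.Ici 0) n N ⊔
            (K0.map (diag (Set.Ici 0) (BqIter.{v, u} (Set.Ici 0) n N))).range) = ⊤ from h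
      rw [eq_top_iff, ← range_inner_sup_innerFaces Bool (Set.Ici 0) (ih _).1,
        sup_comm (innerFaces _ _ _ _ _), ← sup_assoc]
      refine sup_le_sup ?_ le_rfl
      rw [AddMonoidHom.range_eq_map,
        ← range_enlarge_sup_range_diag (BqIter.{v, u} (Set.Icc 0 2) n N), AddSubgroup.map_sup]
      refine sup_le_sup ?_ (K0.map_range_le (F' := acyclicMap Unit (Set.Ici 0)
        (BqIterEnlarge.{v, u} Icc_two_subset_Ici N n)) rfl)
      rintro _ ⟨_, ⟨x, rfl⟩, rfl⟩
      exact ⟨x, by rw [K0.map_map]⟩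
    · intro x hx
      rw [faces_succ] at hx ⊢
      change K0 (Bq (Set.Icc 0 2) (BqIter.{v, u} (Set.Icc 0 2) n N)) at x
      change K0.map ((enlarge Bool Icc_two_subset_Ici _).comp (acyclicMap Bool _
        (BqIterEnlarge.{v, u} Icc_two_subset_Ici N n))) x ∈ _ at hx
      rw [← K0.map_map] at hx
      -- The relation is shortened in the inner directions while the outer one still runs over `[0,
      -- ∞)`. Enlargements in different directions commute, so the outer direction can be treated
      -- next, over iterated complexes supported on `[0, 4]`.
      have h₁ := inner_mem_innerFaces_sup _ (ih _).1 (ih _).2 _ hx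
      have h₂ : K0.map (acyclicMap Bool _ (BqIterEnlarge.{v, u} Icc_two_subset_Icc_four N n))
          (K0.map (enlarge Bool Icc_two_subset_Ici _) x) =
        K0.map (enlarge Bool Icc_two_subset_Ici _) (K0.map (acyclicMap Bool _
          (BqIterEnlarge.{v, u} Icc_two_subset_Icc_four N n)) x) := by
        rw [K0.map_map, K0.map_map]
        rfl
      rw [h₂] at h₁
      have h₃ := outer_mem_innerFaces_sup _ _ h₁
      rw [K0.map_map] at h₃
      exact h₃

/-! ### Compatibility of inclusions and exact functors, and the section -/

theorem BqIterEnlarge_comp {J J' J'' : Set ℤ} (h : J ⊆ J') (h' : J' ⊆ J'')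
    (N : ConflationCat.{v, max u v}) (n : ℕ) :
    (BqIterEnlarge.{v, u} h N n).comp (BqIterEnlarge.{v, u} h' N n) =
      BqIterEnlarge.{v, u} (h.trans h') N n := by
  induction n with
  | zero => rfl
  | succ n ih =>
    exact congrArg (fun F => (enlarge Bool (h.trans h') _).comp (acyclicMap Bool J'' F)) ih

theorem BqIterMap_comp_enlarge {J J' : Set ℤ} (h : J ⊆ J') {N M : ConflationCat.{v, max u v}}
    (F : ExactFunctor N M) (n : ℕ) :
    (BqIterMap.{v, u} J F n).comp (BqIterEnlarge.{v, u} h M n) =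
      (BqIterEnlarge.{v, u} h N n).comp (BqIterMap.{v, u} J' F n) := by
  induction n with
  | zero => rfl
  | succ n ih =>
    exact congrArg (fun F => (enlarge Bool h _).comp (acyclicMap Bool J' F)) ih

namespace K0Omega

theorem incl_incl {J J' J'' : Set ℤ} (h : J ⊆ J') (h' : J' ⊆ J'') (n : ℕ)
    (N : ConflationCat.{v, max u v}) (x : K0Omega.{v, u} J n N) :
    incl.{v, u} h' n N (incl.{v, u} h n N x) = incl.{v, u} (h.trans h') n N x := by
  obtain ⟨x, rfl⟩ := QuotientAddGroup.mk_surjective x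
  refine congrArg QuotientAddGroup.mk ?_
  rw [K0.map_map, BqIterEnlarge_comp]

theorem incl_map {J J' : Set ℤ} (h : J ⊆ J') (n : ℕ) {N M : ConflationCat.{v, max u v}}
    (F : ExactFunctor N M) (x : K0Omega.{v, u} J n N) :
    incl.{v, u} h n M (map.{v, u} J n F x) = map.{v, u} J' n F (incl.{v, u} h n N x) := by
  obtain ⟨x, rfl⟩ := QuotientAddGroup.mk_surjective x
  refine congrArg QuotientAddGroup.mk ?_
  rw [K0.map_map, K0.map_map, BqIterMap_comp_enlarge]

variable (n : ℕ) (N : ConflationCat.{v, max u v}) [N.Exact]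

theorem incl_surjective : Function.Surjective (incl.{v, u} Icc_two_subset_Ici n N) := by
  intro x
  obtain ⟨x, rfl⟩ := QuotientAddGroup.mk_surjective x
  obtain ⟨_, ⟨y, rfl⟩, z, hz, h⟩ := AddSubgroup.mem_sup.1
    ((shortenable_and_relationsShortenable.{v, u} n N).1.ge (AddSubgroup.mem_top x))
  refine ⟨QuotientAddGroup.mk y, QuotientAddGroup.eq.2 ?_⟩
  rw [← h, neg_add_cancel_left]
  exact hz

theorem ker_incl_le :
    (incl.{v, u} Icc_two_subset_Ici n N).ker ≤ (incl.{v, u} Icc_two_subset_Icc_four n N).ker := by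
  intro x hx
  obtain ⟨x, rfl⟩ := QuotientAddGroup.mk_surjective x
  exact (QuotientAddGroup.eq_zero_iff _).2 ((shortenable_and_relationsShortenable.{v, u} n N).2 x
    ((QuotientAddGroup.eq_zero_iff _).1 hx))

/-- The section of `K0Omega [0, 4] ⟶ K0Omega [0, ∞)`. -/
noncomputable def shorten : K0Omega.{v, u} (Set.Ici 0) n N →+ K0Omega.{v, u} (Set.Icc 0 4) n N :=
  -- A class is represented on `[0, 2]` and then included into `[0, 4]`; `ker_incl_le` makes the
  -- result independent of the representative.
  (incl.{v, u} Icc_two_subset_Ici n N).liftOfSurjective (incl_surjective.{v, u} n N)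
    ⟨incl.{v, u} Icc_two_subset_Icc_four n N, ker_incl_le.{v, u} n N⟩

theorem shorten_incl (x : K0Omega.{v, u} (Set.Icc 0 2) n N) :
    shorten.{v, u} n N (incl.{v, u} Icc_two_subset_Ici n N x) =
      incl.{v, u} Icc_two_subset_Icc_four n N x :=
  AddMonoidHom.liftOfRightInverse_comp_apply _ _ _
    ⟨incl.{v, u} Icc_two_subset_Icc_four n N, ker_incl_le.{v, u} n N⟩ x

end K0Omega

end ConflationCat

theorem mainTheorem6 (n : ℕ) (hn : 1 ≤ n) :
    (∀ N : ExactCat.{v, max u v}, Function.Surjective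
      (ConflationCat.K0Omega.incl.{v, u}
        (Set.Icc_subset_Ici_self : Set.Icc (0 : ℤ) 2 ⊆ Set.Ici 0) n N.toConflationCat)) ∧
    ∃ s : ∀ N : ExactCat.{v, max u v},
        ConflationCat.K0Omega.{v, u} (Set.Ici (0 : ℤ)) n N.toConflationCat →+
          ConflationCat.K0Omega.{v, u} (Set.Icc (0 : ℤ) 4) n N.toConflationCat,
      (∀ (N : ExactCat.{v, max u v}) (x), ConflationCat.K0Omega.incl.{v, u}
        (Set.Icc_subset_Ici_self : Set.Icc (0 : ℤ) 4 ⊆ Set.Ici 0) n N.toConflationCat (s N x) = x) ∧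
      ∀ (N M : ExactCat.{v, max u v})
        (F : ConflationCat.ExactFunctor N.toConflationCat M.toConflationCat) (x),
        s M (ConflationCat.K0Omega.map.{v, u} (Set.Ici (0 : ℤ)) n F x) =
          ConflationCat.K0Omega.map.{v, u} (Set.Icc (0 : ℤ) 4) n F (s N x) := by
  have exact (N : ExactCat.{v, max u v}) : N.toConflationCat.Exact := ⟨N.isExact⟩
  refine ⟨fun N => ConflationCat.K0Omega.incl_surjective.{v, u} n N.toConflationCat,
    fun N => ConflationCat.K0Omega.shorten.{v, u} n N.toConflationCat, fun N x => ?_,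
    fun N M F x => ?_⟩
  · obtain ⟨x, rfl⟩ := ConflationCat.K0Omega.incl_surjective.{v, u} n N.toConflationCat x
    rw [ConflationCat.K0Omega.shorten_incl, ConflationCat.K0Omega.incl_incl]
  -- On classes coming from `[0, 2]` the section is an inclusion, and inclusions commute with exact
  -- functors; by surjectivity there are no other classes.
  · obtain ⟨x, rfl⟩ := ConflationCat.K0Omega.incl_surjective.{v, u} n N.toConflationCat x
    rw [← ConflationCat.K0Omega.incl_map, ConflationCat.K0Omega.shorten_incl,
      ConflationCat.K0Omega.shorten_incl, ConflationCat.K0Omega.incl_map]
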